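/- For $\tau$ in the upper half-plane $\mathbb H$ let $\theta_1,\dots,\theta_4(z|\tau)$ be Jacobi's series $$\theta_1=-i e^{\pi i\tau/4}\sum_{k\in\mathbb Z}(-1)^k e^{(k^2+k)\pi i\tau}e^{(2k+1)\pi iz},\quad \theta_2=e^{\pi i\tau/4}\sum_{k\in\mathbb Z} e^{(k^2+k)\pi i\tau}e^{(2k+1)\pi iz},$$ $$\theta_3=\sum_{k\in\mathbb Z} e^{k^2\pi i\tau}e^{2k\pi iz},\quad \theta_4=\sum_{k\in\mathbb Z}(-1)^k e^{k^2\pi i\tau}e^{2k\pi iz},$$ let $\vartheta_k(\tau)=\theta_k(0|\tau)$, and let $\eta(\tau)=2\pi^2\bigl\{\tfrac1{24}-\sum_{k\ge1}e^{2k\pi i\tau}(1-e^{2k\pi i\tau})^{-2}\bigr\}$. Written without arguments, $\vartheta_2,\vartheta_3,\vartheta_4,\eta$ denote given coefficient functions of $\tau$, and $\theta_1,\dots,\theta_4,\theta_1'$ unknown functions of $(z,\tau)$. Put $\vartheta_1=0$, $L=\eta+\frac{\pi^2}{12}(\vartheta_3^4+\vartheta_4^4)$ and $(k,\nu,\mu)\in\{(2,3,4),(3,4,2),(4,2,3)\}$;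 for $k=1$ the terms with the factor $\vartheta_k$ are absent. The $z$-system is $$\partial_z\theta_1=\theta_1',\qquad \partial_z\theta_k=\frac{\theta_1'}{\theta_1}\theta_k-\pi\vartheta_k^2\frac{\theta_\nu\theta_\mu}{\theta_1}\ (k=2,3,4),\qquad \partial_z\theta_1'=\frac{\theta_1'^2}{\theta_1}-\pi^2\vartheta_3^2\vartheta_4^2\frac{\theta_2^2}{\theta_1}-4L\theta_1 ,$$ and the $\tau$-system is, for $k=1,2,3,4$, $$\partial_\tau\theta_k=\frac{-i}{4\pi}\frac{\theta_1'^2}{\theta_1^2}\theta_k+\frac i2\vartheta_k^2\theta_1'\frac{\theta_\nu\theta_\mu}{\theta_1^2}+\frac{i\pi}4\{\vartheta_3^2\vartheta_4^2\theta_2^2-\vartheta_k^2\vartheta_\mu^2\theta_\nu^2-\vartheta_k^2\vartheta_\nu^2\theta_\mu^2\}\frac{\theta_k}{\theta_1^2}+\frac i\pi L\theta_k,$$ $$\partial_\tau\theta_1'=\frac{-i}{4\pi}\frac{\theta_1'^3}{\theta_1^2}+\frac{3i}\pi\Bigl\{\frac{\pi^2}4\vartheta_3^2\vartheta_4^2\frac{\theta_2^2}{\theta_1^2}+L\Bigr\}\theta_1'-\frac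 i2\pi^2\vartheta_2^2\vartheta_3^2\vartheta_4^2\frac{\theta_2\theta_3\theta_4}{\theta_1^2}.$$ A simultaneous solution on a set of points $(z,\tau)$ is a quintuple of holomorphic functions there with $\theta_1\neq0$ that satisfies both systems. **Theorem.** Let $a,b,c,\delta,A,B,d\in\mathbb C$ with $a\delta-bc=1$ and $A,B,d\ne0$; let $T=\frac{a\tau+b}{c\tau+\delta}$, let $U\subseteq\mathbb C$ be an open set on which $c\tau+\delta\neq0$ and $T\in\mathbb H$, and let $\sqrt{c\tau+\delta}$ be a continuous branch on $U$. Let $$\vartheta_2=d\frac{\vartheta_2(T)}{\sqrt{c\tau+\delta}},\qquad \vartheta_3=\frac1A\frac{\vartheta_3(T)}{\sqrt{c\tau+\delta}},\qquad \vartheta_4=\frac1B\frac{\vartheta_4(T)}{\sqrt{c\tau+\delta}},$$ $$\eta=\frac1{(c\tau+\delta)^2}\Bigl\{\eta(T)+\frac{\pi^2}{12}\bigl[(1-A^{-4})\vartheta_3^4(T)+(1-B^{-4})\vartheta_4^4(T)\bigr]\Bigr\}+\frac12\frac{\pi ic}{c\tau+\delta}.\qquad(*)$$ (i) These coefficients satisfy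 on $U$ the integrability conditions $$\dot\vartheta_2=\tfrac i\pi L\vartheta_2,\quad \dot\vartheta_3=\tfrac i\pi\{L-\tfrac{\pi^2}4B^4\vartheta_4^4\}\vartheta_3,\quad \dot\vartheta_4=\tfrac i\pi\{L-\tfrac{\pi^2}4A^4\vartheta_3^4\}\vartheta_4,$$ $$\dot\eta=\tfrac{i}\pi2\eta^2-\tfrac{\pi^3}{72}i\{\vartheta_3^8+(9A^4B^4-6A^4-6B^4+2)\vartheta_3^4\vartheta_4^4+\vartheta_4^8\}.$$ (ii) For all constants $C\neq0$, $D$, $E$ and all signs $\varepsilon_k=\pm1$ with $\varepsilon_1\varepsilon_2\varepsilon_3\varepsilon_4=1$ the functions $$\theta_k=\varepsilon_k\,\lambda_k\,\frac{C}{\sqrt{c\tau+\delta}}\,\theta_k\Bigl(\frac{z+E}{c\tau+\delta}+D\Big|\frac{a\tau+b}{c\tau+\delta}\Bigr)e^{-\frac{\pi ic}{c\tau+\delta}(z+E)^2},\qquad(\lambda_1,\lambda_2,\lambda_3,\lambda_4)=\Bigl(\frac d{AB},\,d,\,\frac1A,\,\frac1B\Bigr),$$ together with $\theta_1'=\partial_z\theta_1$,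 form a simultaneous solution with the coefficients $(*)$ on the set of all $(z,\tau)$ with $\tau\in U$ and $\theta_1\ne0$. (iii) If $c\ne0$, these are all: every simultaneous solution with the coefficients $(*)$ on a connected open set $\Omega\subseteq\mathbb C\times U$ has, on $\Omega$, the form (ii) for some such $C,D,E,\varepsilon_k$. (iv) The coefficients $(*)$ do not change on $U$ if $(a,b,c,\delta)$, $B$ and $\sqrt{c\tau+\delta}$ are replaced by $(a,b,2a+c,2b+\delta)$, $-iB$ and $\sqrt{c\tau+\delta}\,\sqrt{2T+1}$ (principal branch of $\sqrt{2T+1}$); so, if $c=0$, the general simultaneous solution is given by (ii) and (iii) for the new constants. (v) (Canonical case, by $\begin{pmatrix}1&0\\2&1\end{pmatrix}\in\Gamma(2)$.) For $(a,b,c,\delta)=(1,0,2,1)$, $A=d=1$, $B=-i$ and the principal branch of $\sqrt{2\tau+1}$, the coefficients $(*)$ are the canonical ones, $\vartheta_k=\vartheta_k(\tau)$ and $\eta=\eta(\tau)$, on $\mathbb H$. For all $D,E,z\in\mathbb C$, $\tau\in\mathbb H$ and $k=1,2,3,4$, $$\frac{1}{\sqrt{2\tau+1}}\theta_k\Bigl(\frac{z+E}{2\tau+1}+D\Big|\frac{\tau}{2\tau+1}\Bigr)e^{-\frac{2\pi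 i}{2\tau+1}(z+E)^2}=\kappa_k\,e^{2\pi iD(2E+D)}\,e^{2\pi iD(2z+2D\tau)}\theta_k(z+2D\tau+E+D|\tau),$$ with $(\kappa_1,\kappa_2,\kappa_3,\kappa_4)=(-i,1,1,-i)$. For a connected open $\Omega\subseteq\mathbb C\times\mathbb H$, five functions are a simultaneous solution with the canonical coefficients on $\Omega$ if and only if on $\Omega$ they have the form $$\theta_k=C\,e^{\pi i\alpha(2z+\alpha\tau)}\,\theta_k(z+\alpha\tau+\beta|\tau)\quad(k=1,2,3,4),\qquad \theta_1'=\partial_z\theta_1,$$ for some constants $C\ne0$, $\alpha$, $\beta$, and $\theta_1$ has no zero in $\Omega$. -/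

import Mathlib

open scoped Real
open Complex

noncomputable section

namespace ThetaODE

/-! ### The classical series -/

/-- `θ₁(z|τ)`. -/
def jθ₁ (z τ : ℂ) : ℂ :=
  -I * cexp (π * I * τ / 4) *
    ∑' k : ℤ, (-1 : ℂ) ^ k * cexp (((k : ℂ) ^ 2 + k) * π * I * τ) * cexp ((2 * k + 1) * π * I * z)

/-- `θ₂(z|τ)`. -/
def jθ₂ (z τ : ℂ) : ℂ :=
  cexp (π * I * τ / 4) *
    ∑' k : ℤ, cexp (((k : ℂ) ^ 2 + k) * π * I * τ) * cexp ((2 * k + 1) * π * I * z)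

/-- `θ₃(z|τ)`. -/
def jθ₃ (z τ : ℂ) : ℂ :=
  ∑' k : ℤ, cexp ((k : ℂ) ^ 2 * π * I * τ) * cexp (2 * k * π * I * z)

/-- `θ₄(z|τ)`. -/
def jθ₄ (z τ : ℂ) : ℂ :=
  ∑' k : ℤ, (-1 : ℂ) ^ k * cexp ((k : ℂ) ^ 2 * π * I * τ) * cexp (2 * k * π * I * z)

/-- The Weierstrass function `η(τ) = ζ(1|1,τ)` (half-periods `1, τ`), through its series
`2π² (1/24 - ∑_{k ≥ 1} e^{2kπiτ} / (1 - e^{2kπiτ})²)`. -/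
def wη (τ : ℂ) : ℂ :=
  2 * π ^ 2 * (1 / 24 -
    ∑' k : ℕ, cexp (2 * (k + 1) * π * I * τ) / (1 - cexp (2 * (k + 1) * π * I * τ)) ^ 2)

/-! ### The differential equations -/

/-- The coefficients `ϑ₂, ϑ₃, ϑ₄, η` of the equations, as functions of `τ`. -/
structure Coeffs where
  ϑ₂ : ℂ → ℂ
  ϑ₃ : ℂ → ℂ
  ϑ₄ : ℂ → ℂ
  η : ℂ → ℂ

/-- The unknowns `θ₁, θ₂, θ₃, θ₄` and the fifth unknown (called `dθ₁` here, classically `θ₁` with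
a prime), as functions of `z` and `τ`. -/
structure Unknowns where
  θ₁ : ℂ → ℂ → ℂ
  θ₂ : ℂ → ℂ → ℂ
  θ₃ : ℂ → ℂ → ℂ
  θ₄ : ℂ → ℂ → ℂ
  dθ₁ : ℂ → ℂ → ℂ

/-- The combination `η + (π²/12)(ϑ₃⁴ + ϑ₄⁴)`. -/
def Coeffs.lam (K : Coeffs) (τ : ℂ) : ℂ :=
  K.η τ + π ^ 2 / 12 * (K.ϑ₃ τ ^ 4 + K.ϑ₄ τ ^ 4)

/-- The five `z`-equations at the point `(z, τ)`. -/
def ZSystemAt (K : Coeffs) (F : Unknowns) (z τ : ℂ) : Prop :=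
  HasDerivAt (fun w => F.θ₁ w τ) (F.dθ₁ z τ) z ∧
  HasDerivAt (fun w => F.θ₂ w τ)
    (F.dθ₁ z τ / F.θ₁ z τ * F.θ₂ z τ
      - π * K.ϑ₂ τ ^ 2 * (F.θ₃ z τ * F.θ₄ z τ / F.θ₁ z τ)) z ∧
  HasDerivAt (fun w => F.θ₃ w τ)
    (F.dθ₁ z τ / F.θ₁ z τ * F.θ₃ z τ
      - π * K.ϑ₃ τ ^ 2 * (F.θ₂ z τ * F.θ₄ z τ / F.θ₁ z τ)) z ∧
  HasDerivAt (fun w => F.θ₄ w τ)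
    (F.dθ₁ z τ / F.θ₁ z τ * F.θ₄ z τ
      - π * K.ϑ₄ τ ^ 2 * (F.θ₂ z τ * F.θ₃ z τ / F.θ₁ z τ)) z ∧
  HasDerivAt (fun w => F.dθ₁ w τ)
    (F.dθ₁ z τ ^ 2 / F.θ₁ z τ
      - π ^ 2 * K.ϑ₃ τ ^ 2 * K.ϑ₄ τ ^ 2 * (F.θ₂ z τ ^ 2 / F.θ₁ z τ)
      - 4 * K.lam τ * F.θ₁ z τ) z

/-- The five `τ`-equations at the point `(z, τ)`. -/
def TauSystemAt (K : Coeffs) (F : Unknowns) (z τ : ℂ) : Prop :=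
  HasDerivAt (fun t => F.θ₁ z t)
    (-I / (4 * π) * (F.dθ₁ z τ ^ 2 / F.θ₁ z τ ^ 2) * F.θ₁ z τ
      + I / 4 * π * (K.ϑ₃ τ ^ 2 * K.ϑ₄ τ ^ 2 * F.θ₂ z τ ^ 2) * (F.θ₁ z τ / F.θ₁ z τ ^ 2)
      + I / π * K.lam τ * F.θ₁ z τ) τ ∧
  HasDerivAt (fun t => F.θ₂ z t)
    (-I / (4 * π) * (F.dθ₁ z τ ^ 2 / F.θ₁ z τ ^ 2) * F.θ₂ z τ
      + I / 2 * K.ϑ₂ τ ^ 2 * F.dθ₁ z τ * (F.θ₃ z τ * F.θ₄ z τ / F.θ₁ z τ ^ 2)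
      + I / 4 * π * (K.ϑ₃ τ ^ 2 * K.ϑ₄ τ ^ 2 * F.θ₂ z τ ^ 2
          - K.ϑ₂ τ ^ 2 * K.ϑ₄ τ ^ 2 * F.θ₃ z τ ^ 2
          - K.ϑ₂ τ ^ 2 * K.ϑ₃ τ ^ 2 * F.θ₄ z τ ^ 2) * (F.θ₂ z τ / F.θ₁ z τ ^ 2)
      + I / π * K.lam τ * F.θ₂ z τ) τ ∧
  HasDerivAt (fun t => F.θ₃ z t)
    (-I / (4 * π) * (F.dθ₁ z τ ^ 2 / F.θ₁ z τ ^ 2) * F.θ₃ z τ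
      + I / 2 * K.ϑ₃ τ ^ 2 * F.dθ₁ z τ * (F.θ₄ z τ * F.θ₂ z τ / F.θ₁ z τ ^ 2)
      + I / 4 * π * (K.ϑ₃ τ ^ 2 * K.ϑ₄ τ ^ 2 * F.θ₂ z τ ^ 2
          - K.ϑ₃ τ ^ 2 * K.ϑ₂ τ ^ 2 * F.θ₄ z τ ^ 2
          - K.ϑ₃ τ ^ 2 * K.ϑ₄ τ ^ 2 * F.θ₂ z τ ^ 2) * (F.θ₃ z τ / F.θ₁ z τ ^ 2)
      + I / π * K.lam τ * F.θ₃ z τ) τ ∧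
  HasDerivAt (fun t => F.θ₄ z t)
    (-I / (4 * π) * (F.dθ₁ z τ ^ 2 / F.θ₁ z τ ^ 2) * F.θ₄ z τ
      + I / 2 * K.ϑ₄ τ ^ 2 * F.dθ₁ z τ * (F.θ₂ z τ * F.θ₃ z τ / F.θ₁ z τ ^ 2)
      + I / 4 * π * (K.ϑ₃ τ ^ 2 * K.ϑ₄ τ ^ 2 * F.θ₂ z τ ^ 2
          - K.ϑ₄ τ ^ 2 * K.ϑ₃ τ ^ 2 * F.θ₂ z τ ^ 2
          - K.ϑ₄ τ ^ 2 * K.ϑ₂ τ ^ 2 * F.θ₃ z τ ^ 2) * (F.θ₄ z τ / F.θ₁ z τ ^ 2)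
      + I / π * K.lam τ * F.θ₄ z τ) τ ∧
  HasDerivAt (fun t => F.dθ₁ z t)
    (-I / (4 * π) * (F.dθ₁ z τ ^ 3 / F.θ₁ z τ ^ 2)
      + 3 * I / π * (π ^ 2 / 4 * K.ϑ₃ τ ^ 2 * K.ϑ₄ τ ^ 2 * (F.θ₂ z τ ^ 2 / F.θ₁ z τ ^ 2)
          + K.lam τ) * F.dθ₁ z τ
      - I / 2 * π ^ 2 * K.ϑ₂ τ ^ 2 * K.ϑ₃ τ ^ 2 * K.ϑ₄ τ ^ 2
          * (F.θ₂ z τ * F.θ₃ z τ * F.θ₄ z τ / F.θ₁ z τ ^ 2)) τ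

/-- `F` is a simultaneous holomorphic solution of the `z`- and the `τ`-equations on the set `Ω` of
points `(z, τ)`; `θ₁` stands in the denominators and must not vanish. -/
def IsSolutionOn (K : Coeffs) (F : Unknowns) (Ω : Set (ℂ × ℂ)) : Prop :=
  DifferentiableOn ℂ (fun p : ℂ × ℂ => F.θ₁ p.1 p.2) Ω ∧
  DifferentiableOn ℂ (fun p : ℂ × ℂ => F.θ₂ p.1 p.2) Ω ∧
  DifferentiableOn ℂ (fun p : ℂ × ℂ => F.θ₃ p.1 p.2) Ω ∧
  DifferentiableOn ℂ (fun p : ℂ × ℂ => F.θ₄ p.1 p.2) Ω ∧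
  DifferentiableOn ℂ (fun p : ℂ × ℂ => F.dθ₁ p.1 p.2) Ω ∧
  ∀ p ∈ Ω, F.θ₁ p.1 p.2 ≠ 0 ∧ ZSystemAt K F p.1 p.2 ∧ TauSystemAt K F p.1 p.2

/-- The integrability conditions: the dynamical system for `ϑ₂, ϑ₃, ϑ₄, η` with constants
`A, B`, on the set `U` of values of `τ`. -/
def Integrability (A B : ℂ) (K : Coeffs) (U : Set ℂ) : Prop :=
  ∀ τ ∈ U,
    HasDerivAt K.ϑ₂
      (I / π * (K.η τ + π ^ 2 / 12 * (K.ϑ₃ τ ^ 4 + K.ϑ₄ τ ^ 4)) * K.ϑ₂ τ) τ ∧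
    HasDerivAt K.ϑ₃
      (I / π * (K.η τ + π ^ 2 / 12 * (K.ϑ₃ τ ^ 4 + K.ϑ₄ τ ^ 4 - 3 * B ^ 4 * K.ϑ₄ τ ^ 4))
        * K.ϑ₃ τ) τ ∧
    HasDerivAt K.ϑ₄
      (I / π * (K.η τ + π ^ 2 / 12 * (K.ϑ₃ τ ^ 4 + K.ϑ₄ τ ^ 4 - 3 * A ^ 4 * K.ϑ₃ τ ^ 4))
        * K.ϑ₄ τ) τ ∧
    HasDerivAt K.η
      (I / π * (2 * K.η τ ^ 2) - π ^ 3 / 72 * I *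
        (K.ϑ₃ τ ^ 8
          + (9 * A ^ 4 * B ^ 4 - 6 * A ^ 4 - 6 * B ^ 4 + 2) * (K.ϑ₃ τ ^ 4 * K.ϑ₄ τ ^ 4)
          + K.ϑ₄ τ ^ 8)) τ

/-! ### The explicit coefficients and the explicit integral -/

/-- `(aτ + b)/(cτ + δ)`. -/
def moeb (a b c δ τ : ℂ) : ℂ := (a * τ + b) / (c * τ + δ)

/-- The canonical coefficients: the theta-constants `ϑₖ(τ) = θₖ(0|τ)` and `η(τ)`. -/
def canonicalCoeffs : Coeffs where
  ϑ₂ τ := jθ₂ 0 τ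
  ϑ₃ τ := jθ₃ 0 τ
  ϑ₄ τ := jθ₄ 0 τ
  η := wη

/-- The general solution of the integrability conditions; `r` is the chosen branch of
`√(cτ + δ)`. -/
def generalCoeffs (a b c δ A B d : ℂ) (r : ℂ → ℂ) : Coeffs where
  ϑ₂ τ := d * (jθ₂ 0 (moeb a b c δ τ) / r τ)
  ϑ₃ τ := 1 / A * (jθ₃ 0 (moeb a b c δ τ) / r τ)
  ϑ₄ τ := 1 / B * (jθ₄ 0 (moeb a b c δ τ) / r τ)
  η τ := 1 / (c * τ + δ) ^ 2 *
      (wη (moeb a b c δ τ) + π ^ 2 / 12 *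
        ((1 - (A ^ 4)⁻¹) * jθ₃ 0 (moeb a b c δ τ) ^ 4
          + (1 - (B ^ 4)⁻¹) * jθ₄ 0 (moeb a b c δ τ) ^ 4))
    + 1 / 2 * (π * I * c / (c * τ + δ))

/-- For one of the four series `θ`, the function
`(cτ+δ)^{-1/2} θ((z+E)/(cτ+δ) + D | (aτ+b)/(cτ+δ)) exp(-πic(z+E)²/(cτ+δ))`. -/
def transformed (θ : ℂ → ℂ → ℂ) (a b c δ : ℂ) (r : ℂ → ℂ) (D E z τ : ℂ) : ℂ :=
  1 / r τ * θ ((z + E) / (c * τ + δ) + D) (moeb a b c δ τ)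
    * cexp (-π * I * c / (c * τ + δ) * (z + E) ^ 2)

/-- The explicit simultaneous integral, with signs `ε k`; its fifth member is the `z`-derivative of
its first. -/
def generalIntegral (a b c δ A B d : ℂ) (r : ℂ → ℂ) (ε : Fin 4 → ℂ) (C D E : ℂ) : Unknowns where
  θ₁ z τ := ε 0 * (1 / (A * B) * (d * C) * transformed jθ₁ a b c δ r D E z τ)
  θ₂ z τ := ε 1 * (d * C * transformed jθ₂ a b c δ r D E z τ)
  θ₃ z τ := ε 2 * (1 / A * C * transformed jθ₃ a b c δ r D E z τ)
  θ₄ z τ := ε 3 * (1 / B * C * transformed jθ₄ a b c δ r D E z τ)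
  dθ₁ z τ := deriv
    (fun w => ε 0 * (1 / (A * B) * (d * C) * transformed jθ₁ a b c δ r D E w τ)) z

/-- Admissible signs: each `ε k` is `1` or `-1`, and signs change in pairs. -/
def AdmissibleSigns (ε : Fin 4 → ℂ) : Prop :=
  (∀ k, ε k = 1 ∨ ε k = -1) ∧ ε 0 * ε 1 * ε 2 * ε 3 = 1

/-- The linear-exponential deformation `exp(πiα(2z + ατ)) θ(z + ατ + β | τ)`. -/
def linearExp (θ : ℂ → ℂ → ℂ) (α β z τ : ℂ) : ℂ :=
  cexp (π * I * α * (2 * z + α * τ)) * θ (z + α * τ + β) τ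

/-- The integral of the canonical equations, with constants `C, α, β`. -/
def canonicalIntegral (C α β : ℂ) : Unknowns where
  θ₁ z τ := C * linearExp jθ₁ α β z τ
  θ₂ z τ := C * linearExp jθ₂ α β z τ
  θ₃ z τ := C * linearExp jθ₃ α β z τ
  θ₄ z τ := C * linearExp jθ₄ α β z τ
  dθ₁ z τ := deriv (fun w => C * linearExp jθ₁ α β w τ) z

/-- The five components of `F` and `G` agree on `Ω`. -/
def Unknowns.AgreeOn (F G : Unknowns) (Ω : Set (ℂ × ℂ)) : Prop :=
  ∀ p ∈ Ω, F.θ₁ p.1 p.2 = G.θ₁ p.1 p.2 ∧ F.θ₂ p.1 p.2 = G.θ₂ p.1 p.2 ∧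
    F.θ₃ p.1 p.2 = G.θ₃ p.1 p.2 ∧ F.θ₄ p.1 p.2 = G.θ₄ p.1 p.2 ∧
    F.dθ₁ p.1 p.2 = G.dθ₁ p.1 p.2

/-- The coefficients `K` and `L` agree on `U`. -/
def Coeffs.AgreeOn (K L : Coeffs) (U : Set ℂ) : Prop :=
  ∀ τ ∈ U, K.ϑ₂ τ = L.ϑ₂ τ ∧ K.ϑ₃ τ = L.ϑ₃ τ ∧ K.ϑ₄ τ = L.ϑ₄ τ ∧ K.η τ = L.η τ

end ThetaODE

end

/-! Existence. The `τ`-system is the heat equation `4πi ∂_τ f = ∂_z² f` in disguise: if the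
`z`-system holds near a point and the five functions satisfy the heat equation there, computing the
second `z`-derivatives from the `z`-system gives exactly the right-hand sides of the `τ`-system
(`tauSystemAt_of_heat`). The theta series satisfy the heat equation term by term, and the
substitution by a matrix of determinant one, with its Gaussian factor and the weight `1/2` factor
`1/√(cτ+δ)`, preserves it. So only the `z`-system needs a proof for the Jacobi series: it consists
of the Wronskians of `θ_k` and `θ₁` (`wronskian_Θ₂`, `wronskian_Θ₃`, `wronskian_Θ₄`) and of a
formula for `θ₁''θ₁ - θ₁'²` (`second_order`). These follow from product formulas that express
`θ(x|τ)θ(y|τ)` through the modulus `2τ` and come from splitting `ℤ²` by parity; the constants are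
fixed by `jacobi_derivative_formula`.

Coefficients. For the Jacobi series, `L = -θ₂''(0)/(4θ₂(0))`. The heat equation turns
`τ`-derivatives of theta constants into Taylor coefficients at `z = 0`, which the same bilinear
identities compute, so the integrability conditions close up (`hasDerivAt_thetaL`). That the Lambert
series `η` is `L - (π²/12)(ϑ₃⁴ + ϑ₄⁴)` is modular: `(ϑ₂ϑ₃ϑ₄)⁸` is a cusp form of weight 12, hence a
multiple of the 24th power of Dedekind's eta function, and logarithmic derivatives give `E₂`
(`wη_eq`).

Completeness. Put `x_k = θ_k/θ₁`, `Q = ϑ₃²ϑ₄²x₂²`, `R = ϑ₂²ϑ₄²x₃²`, `S = ϑ₂²ϑ₃²x₄²`. These three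
have the same `z`-derivative, and equality of mixed derivatives forces `R - Q = B⁴ϑ₄⁴` and `S - Q =
A⁴ϑ₃⁴` (`IsSolutionOn.hypersurface`); the degenerate alternative is excluded because `A⁴ϑ₃⁴ ≠
B⁴ϑ₄⁴`, that is, because `ϑ₂ ≠ 0`. Thus the values of a solution at one point have three degrees of
freedom besides signs. The explicit family reaches all of them if `c ≠ 0` (`exists_matching`): an
elliptic function takes every value, which gives the argument `u` of the theta functions; `E` then
adjusts `θ₁'/θ₁` through the Gaussian factor, and `C` the scale. Uniqueness for the Pfaffian system,
by Grönwall along segments and connectedness, spreads the agreement over `Ω` (`eqOn_of_eq`).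

For `c = 0` the Gaussian factor is trivial and `E` cannot do its work. The element `τ ↦ τ/(2τ+1)` of
`Γ(2)` fixes the coefficients up to constants that `B` absorbs, and makes `c ≠ 0`. In the canonical
case the quadratic exponent then cancels, which leaves linear exponentials, and the signs are
absorbed by translations by `1` and `τ`. -/

namespace ThetaODE

/-! ### Theta series with a bounded coefficient function, and all their derivatives -/

/-- The `n`-th term of the `m`-th `z`-derivative of `∑ χ(n) exp(πi n²τ/4 + πi n z)`. -/
noncomputable def thetaTerm (χ : ℤ → ℂ) (m : ℕ) (n : ℤ) (z τ : ℂ) : ℂ :=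
  χ n * (π * I * n) ^ m * jacobiTheta₂_term n (z / 2) (τ / 4)

/-- The `m`-th `z`-derivative of `∑ χ(n) exp(πi n²τ/4 + πi n z)`. -/
noncomputable def thetaSeries (χ : ℤ → ℂ) (m : ℕ) (z τ : ℂ) : ℂ :=
  ∑' n : ℤ, thetaTerm χ m n z τ

lemma hasFDerivAt_thetaTerm (χ : ℤ → ℂ) (m : ℕ) (n : ℤ) (z τ : ℂ) :
    HasFDerivAt (fun p : ℂ × ℂ => thetaTerm χ m n p.1 p.2)
      (thetaTerm χ (m + 1) n z τ • ContinuousLinearMap.fst ℂ ℂ ℂ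
        + (thetaTerm χ (m + 2) n z τ / (4 * π * I)) • ContinuousLinearMap.snd ℂ ℂ ℂ) (z, τ) := by
  have h1 : HasFDerivAt (fun p : ℂ × ℂ => 2 * π * I * n * (p.1 / 2) + π * I * n ^ 2 * (p.2 / 4))
      ((π * I * n) • ContinuousLinearMap.fst ℂ ℂ ℂ
        + (π * I * n ^ 2 / 4) • ContinuousLinearMap.snd ℂ ℂ ℂ) (z, τ) := by
    have := ((ContinuousLinearMap.fst ℂ ℂ ℂ).hasFDerivAt (x := (z, τ))).const_mul
      (π * I * n : ℂ) |>.add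
      (((ContinuousLinearMap.snd ℂ ℂ ℂ).hasFDerivAt (x := (z, τ))).const_mul
        (π * I * n ^ 2 / 4 : ℂ))
    convert! this using 1
    ext p
    simp
    ring
  have h2 := (h1.cexp).const_mul (χ n * (π * I * n) ^ m)
  refine h2.congr_fderiv ?_
  have hpi : (π : ℂ) ≠ 0 := by exact_mod_cast Real.pi_ne_zero
  simp only [thetaTerm, jacobiTheta₂_term]
  ext
  · simp
    ring
  · simp
    field_simp
    ring

/-- A Gaussian bound uniform for `|im z| ≤ S` and `im τ ≥ T`. It serves both the termwise
differentiation and the limits at `i∞`. -/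
lemma norm_thetaTerm_le {χ : ℤ → ℂ} (hχ : ∀ n, ‖χ n‖ ≤ 1) (m : ℕ) (n : ℤ) {S T : ℝ} (hT : 0 < T)
    {z τ : ℂ} (hz : |z.im| ≤ S) (hτ : T ≤ τ.im) :
    ‖thetaTerm χ m n z τ‖ ≤
      π ^ m * ((|n| : ℝ) ^ m * Real.exp (-π * (T / 4 * n ^ 2 - 2 * (S / 2) * |n|))) := by
  have h1 : ‖jacobiTheta₂_term n (z / 2) (τ / 4)‖ ≤
      Real.exp (-π * (T / 4 * n ^ 2 - 2 * (S / 2) * |n|)) := by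
    apply norm_jacobiTheta₂_term_le (by positivity)
    · have : (z / 2).im = z.im / 2 := by
        simp
      rw [this, abs_div, abs_two]
      linarith
    · have : (τ / 4).im = τ.im / 4 := by
        simp
      rw [this]
      linarith
  rw [thetaTerm, norm_mul, norm_mul, norm_pow]
  have h2 : ‖(π * I * n : ℂ)‖ = π * |(n : ℝ)| := by
    simp [abs_of_pos Real.pi_pos]
  rw [h2, mul_pow]
  calc ‖χ n‖ * (π ^ m * |(n : ℝ)| ^ m) * ‖jacobiTheta₂_term n (z / 2) (τ / 4)‖
      ≤ 1 * (π ^ m * |(n : ℝ)| ^ m) *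
        Real.exp (-π * (T / 4 * n ^ 2 - 2 * (S / 2) * |n|)) := by
        gcongr
        exact hχ n
    _ = _ := by push_cast; ring

lemma summable_thetaTerm_bound (m : ℕ) (S : ℝ) {T : ℝ} (hT : 0 < T) :
    Summable fun n : ℤ =>
      π ^ m * ((|n| : ℝ) ^ m * Real.exp (-π * (T / 4 * n ^ 2 - 2 * (S / 2) * |n|))) := by
  have := (summable_pow_mul_jacobiTheta₂_term_bound (S / 2) (T := T / 4) (by positivity) m).mul_left
    (π ^ m)
  simpa using this

lemma summable_thetaTerm {χ : ℤ → ℂ} (hχ : ∀ n, ‖χ n‖ ≤ 1) (m : ℕ) (z : ℂ) {τ : ℂ}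
    (hτ : 0 < τ.im) : Summable fun n => thetaTerm χ m n z τ :=
  (summable_thetaTerm_bound m |z.im| hτ).of_norm_bounded
    fun n => norm_thetaTerm_le hχ m n hτ le_rfl le_rfl

/-- The tower of `z`-derivatives and the heat equation. -/
lemma hasFDerivAt_thetaSeries {χ : ℤ → ℂ} (hχ : ∀ n, ‖χ n‖ ≤ 1) (m : ℕ) (z : ℂ) {τ : ℂ}
    (hτ : 0 < τ.im) :
    HasFDerivAt (fun p : ℂ × ℂ => thetaSeries χ m p.1 p.2)
      (thetaSeries χ (m + 1) z τ • ContinuousLinearMap.fst ℂ ℂ ℂ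
        + (thetaSeries χ (m + 2) z τ / (4 * π * I)) • ContinuousLinearMap.snd ℂ ℂ ℂ) (z, τ) := by
  obtain ⟨T, hT, hτ'⟩ := exists_between hτ
  obtain ⟨S, hz⟩ := exists_gt |im z|
  -- A strip times a half-plane: preconnected, and small enough for one summable bound on all
  -- derivative terms.
  let V : Set (ℂ × ℂ) := {u | |im u| < S} ×ˢ {v | T < im v}
  have hVo : IsOpen V := by
    refine ((_root_.continuous_abs.comp continuous_im).isOpen_preimage _ isOpen_Iio).prod ?_
    exact continuous_im.isOpen_preimage _ isOpen_Ioi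
  have hVmem : (z, τ) ∈ V := ⟨hz, hτ'⟩
  have hVp : IsPreconnected V := by
    refine (Convex.isPreconnected ?_).prod (convex_halfSpace_im_gt T).isPreconnected
    simpa only [abs_lt] using! (convex_halfSpace_im_gt _).inter (convex_halfSpace_im_lt _)
  let b : ℕ → ℤ → ℝ := fun m n =>
    π ^ m * ((|n| : ℝ) ^ m * Real.exp (-π * (T / 4 * n ^ 2 - 2 * (S / 2) * |n|)))
  have hbs : ∀ m, Summable (b m) := fun m => summable_thetaTerm_bound m S hT
  have hu : ∀ (n : ℤ), ∀ p ∈ V,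
      ‖thetaTerm χ (m + 1) n p.1 p.2 • ContinuousLinearMap.fst ℂ ℂ ℂ
        + (thetaTerm χ (m + 2) n p.1 p.2 / (4 * π * I)) • ContinuousLinearMap.snd ℂ ℂ ℂ‖
        ≤ b (m + 1) n + b (m + 2) n := by
    intro n p hp
    refine (norm_add_le _ _).trans (add_le_add ?_ ?_)
    · rw [norm_smul]
      refine (mul_le_of_le_one_right (norm_nonneg _) (ContinuousLinearMap.norm_fst_le _ _ _)).trans ?_
      exact norm_thetaTerm_le hχ _ n hT (le_of_lt hp.1) (le_of_lt hp.2)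
    · rw [norm_smul]
      refine (mul_le_of_le_one_right (norm_nonneg _) (ContinuousLinearMap.norm_snd_le _ _ _)).trans ?_
      rw [norm_div]
      refine (div_le_self (norm_nonneg _) ?_).trans
        (norm_thetaTerm_le hχ _ n hT (le_of_lt hp.1) (le_of_lt hp.2))
      simp [abs_of_pos Real.pi_pos]
      linarith [Real.pi_gt_three]
  have key := hasFDerivAt_tsum_of_isPreconnected ((hbs (m + 1)).add (hbs (m + 2))) hVo hVp
    (fun n p _ => hasFDerivAt_thetaTerm χ m n p.1 p.2) hu hVmem (summable_thetaTerm hχ m z hτ) hVmem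
  refine key.congr_fderiv ?_
  refine HasSum.tsum_eq ?_
  refine HasSum.add ?_ ?_
  · exact (summable_thetaTerm hχ (m + 1) z hτ).hasSum.smul_const _
  · exact ((summable_thetaTerm hχ (m + 2) z hτ).hasSum.div_const _).smul_const _

lemma hasDerivAt_thetaSeries_fst {χ : ℤ → ℂ} (hχ : ∀ n, ‖χ n‖ ≤ 1) (m : ℕ) (z : ℂ) {τ : ℂ}
    (hτ : 0 < τ.im) :
    HasDerivAt (fun w => thetaSeries χ m w τ) (thetaSeries χ (m + 1) z τ) z := by
  have := (hasFDerivAt_thetaSeries hχ m z hτ).comp (𝕜 := ℂ) z (hasFDerivAt_prodMk_left z τ)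
  simpa using! this.hasDerivAt

lemma hasDerivAt_thetaSeries_snd {χ : ℤ → ℂ} (hχ : ∀ n, ‖χ n‖ ≤ 1) (m : ℕ) (z : ℂ) {τ : ℂ}
    (hτ : 0 < τ.im) :
    HasDerivAt (fun t => thetaSeries χ m z t) (thetaSeries χ (m + 2) z τ / (4 * π * I)) τ := by
  have := (hasFDerivAt_thetaSeries hχ m z hτ).comp (𝕜 := ℂ) τ (hasFDerivAt_prodMk_right z τ)
  simpa using! this.hasDerivAt

lemma thetaTerm_add_half (χ : ℤ → ℂ) (m : ℕ) (n : ℤ) (z τ : ℂ) :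
    thetaTerm χ m n (z + 1 / 2) τ = thetaTerm (fun n => χ n * I ^ n) m n z τ := by
  have h : jacobiTheta₂_term n ((z + 1 / 2) / 2) (τ / 4)
      = I ^ n * jacobiTheta₂_term n (z / 2) (τ / 4) := by
    have hI : I ^ n = cexp (n * (π / 2 * I)) := by
      rw [Complex.exp_int_mul, Complex.exp_pi_div_two_mul_I]
    rw [hI, jacobiTheta₂_term, jacobiTheta₂_term, ← Complex.exp_add]
    congr 1
    ring
  simp only [thetaTerm, h]
  ring

/-- The shift by `1/2` acts on the coefficients alone, by `χ(n) ↦ χ(n) iⁿ`. Writing all four series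
over one index set with exponents `πi n z` makes them four coefficient functions permuted, up to
sign, by this operation. -/
lemma thetaSeries_add_half {χ χ' : ℤ → ℂ} (h : ∀ n, χ n * I ^ n = χ' n) (m : ℕ) (z τ : ℂ) :
    thetaSeries χ m (z + 1 / 2) τ = thetaSeries χ' m z τ := by
  simp only [thetaSeries, thetaTerm_add_half, h]

lemma thetaSeries_neg_coeff (χ : ℤ → ℂ) (m : ℕ) (z τ : ℂ) :
    thetaSeries (fun n => -χ n) m z τ = -thetaSeries χ m z τ := by
  simp only [thetaSeries, thetaTerm, ← tsum_neg, neg_mul]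

lemma thetaSeries_neg {χ : ℤ → ℂ} {s : ℂ} (h : ∀ n, χ (-n) = s * χ n) (m : ℕ) (z τ : ℂ) :
    thetaSeries χ m (-z) τ = s * (-1) ^ m * thetaSeries χ m z τ := by
  rw [thetaSeries, thetaSeries, ← (Equiv.neg ℤ).tsum_eq, ← tsum_mul_left]
  refine tsum_congr fun n => ?_
  simp only [thetaTerm, Equiv.neg_apply, h, jacobiTheta₂_term]
  push_cast
  rw [show (π * I * -n : ℂ) = (-1) * (π * I * n) by ring, mul_pow]
  rw [show (2 * π * I * -n * (-z / 2) + π * I * (-n) ^ 2 * (τ / 4) : ℂ)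
    = 2 * π * I * n * (z / 2) + π * I * n ^ 2 * (τ / 4) by ring]
  ring

/-! ### The four coefficient functions -/

/-- Coefficients of `θ₁`. -/
noncomputable def χ₁ (n : ℤ) : ℂ := if Even n then 0 else -I ^ n
/-- Coefficients of `θ₂`. -/
noncomputable def χ₂ (n : ℤ) : ℂ := if Even n then 0 else 1
/-- Coefficients of `θ₃`. -/
noncomputable def χ₃ (n : ℤ) : ℂ := if Even n then 1 else 0
/-- Coefficients of `θ₄`. -/
noncomputable def χ₄ (n : ℤ) : ℂ := if Even n then I ^ n else 0

lemma norm_χ₁_le (n : ℤ) : ‖χ₁ n‖ ≤ 1 := by unfold χ₁; split_ifs <;> simp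
lemma norm_χ₂_le (n : ℤ) : ‖χ₂ n‖ ≤ 1 := by unfold χ₂; split_ifs <;> simp
lemma norm_χ₃_le (n : ℤ) : ‖χ₃ n‖ ≤ 1 := by unfold χ₃; split_ifs <;> simp
lemma norm_χ₄_le (n : ℤ) : ‖χ₄ n‖ ≤ 1 := by unfold χ₄; split_ifs <;> simp

lemma I_zpow_two_mul (k : ℤ) : I ^ (2 * k) = (-1) ^ k := by
  rw [zpow_mul]; simp [zpow_ofNat]

lemma I_zpow_two_mul_add_one (k : ℤ) : I ^ (2 * k + 1) = (-1) ^ k * I := by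
  rw [zpow_add₀ I_ne_zero, I_zpow_two_mul, zpow_one]

lemma neg_one_zpow_mul_self (k : ℤ) : ((-1 : ℂ) ^ k) * (-1) ^ k = 1 := by
  rw [← mul_zpow]; simp

lemma χ₁_mul_I_zpow (n : ℤ) : χ₁ n * I ^ n = χ₂ n := by
  unfold χ₁ χ₂
  split_ifs with h
  · simp
  · obtain ⟨k, rfl⟩ := Int.not_even_iff_odd.mp h
    rw [I_zpow_two_mul_add_one]
    linear_combination -((-1 : ℂ) ^ k * (-1) ^ k) * I_sq + neg_one_zpow_mul_self k

lemma χ₂_mul_I_zpow (n : ℤ) : χ₂ n * I ^ n = -χ₁ n := by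
  unfold χ₁ χ₂
  split_ifs with h <;> simp

lemma χ₃_mul_I_zpow (n : ℤ) : χ₃ n * I ^ n = χ₄ n := by
  unfold χ₃ χ₄
  split_ifs with h <;> simp

lemma χ₄_mul_I_zpow (n : ℤ) : χ₄ n * I ^ n = χ₃ n := by
  unfold χ₃ χ₄
  split_ifs with h
  · obtain ⟨k, rfl⟩ := even_iff_exists_two_mul.mp h
    rw [I_zpow_two_mul, neg_one_zpow_mul_self]
  · simp

lemma χ₁_neg (n : ℤ) : χ₁ (-n) = -1 * χ₁ n := by
  unfold χ₁
  simp only [even_neg]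
  split_ifs with h
  · simp
  · obtain ⟨k, rfl⟩ := Int.not_even_iff_odd.mp h
    rw [zpow_neg, I_zpow_two_mul_add_one, mul_inv, Complex.inv_I,
      inv_eq_of_mul_eq_one_left (neg_one_zpow_mul_self k)]
    ring

lemma χ₂_neg (n : ℤ) : χ₂ (-n) = 1 * χ₂ n := by simp [χ₂]
lemma χ₃_neg (n : ℤ) : χ₃ (-n) = 1 * χ₃ n := by simp [χ₃]
lemma χ₄_neg (n : ℤ) : χ₄ (-n) = 1 * χ₄ n := by
  unfold χ₄
  simp only [even_neg]
  split_ifs with h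
  · obtain ⟨k, rfl⟩ := even_iff_exists_two_mul.mp h
    rw [zpow_neg, I_zpow_two_mul, inv_eq_of_mul_eq_one_left (neg_one_zpow_mul_self k), one_mul]
  · simp

lemma tsum_even_eq {f : ℤ → ℂ} (hf : ∀ n, ¬Even n → f n = 0) :
    ∑' k : ℤ, f (2 * k) = ∑' n, f n := by
  refine Function.Injective.tsum_eq (g := fun k : ℤ => 2 * k) (fun a b h => by simpa using h) ?_
  intro n hn
  by_contra hc
  exact hn (hf n fun he => hc (by obtain ⟨k, rfl⟩ := even_iff_exists_two_mul.mp he; exact ⟨k, rfl⟩))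

lemma tsum_odd_eq {f : ℤ → ℂ} (hf : ∀ n, Even n → f n = 0) :
    ∑' k : ℤ, f (2 * k + 1) = ∑' n, f n := by
  refine Function.Injective.tsum_eq (g := fun k : ℤ => 2 * k + 1) (fun a b h => by simpa using h) ?_
  intro n hn
  by_contra hc
  exact hn (hf n (by
    by_contra he
    obtain ⟨k, rfl⟩ := Int.not_even_iff_odd.mp he
    exact hc ⟨k, rfl⟩))

/-! ### Jacobi's series as instances of `thetaSeries`. -/

lemma jθ₁_eq (z τ : ℂ) : jθ₁ z τ = thetaSeries χ₁ 0 z τ := by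
  rw [jθ₁, thetaSeries, ← tsum_odd_eq (f := fun n => thetaTerm χ₁ 0 n z τ), ← tsum_mul_left]
  · refine tsum_congr fun k => ?_
    have hodd : ¬ Even (2 * k + 1) := by simp
    rw [thetaTerm, χ₁, if_neg hodd, I_zpow_two_mul_add_one, jacobiTheta₂_term, Complex.exp_add]
    push_cast
    rw [show (π * I * (2 * k + 1) ^ 2 * (τ / 4) : ℂ)
      = π * I * τ / 4 + (k ^ 2 + k) * π * I * τ by ring, Complex.exp_add,
      show (2 * π * I * (2 * k + 1) * (z / 2) : ℂ) = (2 * k + 1) * π * I * z by ring]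
    ring
  · intro n hn
    simp [thetaTerm, χ₁, hn]

lemma jθ₂_eq (z τ : ℂ) : jθ₂ z τ = thetaSeries χ₂ 0 z τ := by
  rw [jθ₂, thetaSeries, ← tsum_odd_eq (f := fun n => thetaTerm χ₂ 0 n z τ), ← tsum_mul_left]
  · refine tsum_congr fun k => ?_
    have hodd : ¬ Even (2 * k + 1) := by simp
    rw [thetaTerm, χ₂, if_neg hodd, jacobiTheta₂_term, Complex.exp_add]
    push_cast
    rw [show (π * I * (2 * k + 1) ^ 2 * (τ / 4) : ℂ)
      = π * I * τ / 4 + (k ^ 2 + k) * π * I * τ by ring, Complex.exp_add,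
      show (2 * π * I * (2 * k + 1) * (z / 2) : ℂ) = (2 * k + 1) * π * I * z by ring]
    ring
  · intro n hn
    simp [thetaTerm, χ₂, hn]

lemma jθ₃_eq (z τ : ℂ) : jθ₃ z τ = thetaSeries χ₃ 0 z τ := by
  rw [jθ₃, thetaSeries, ← tsum_even_eq (f := fun n => thetaTerm χ₃ 0 n z τ)]
  · refine tsum_congr fun k => ?_
    rw [thetaTerm, χ₃, if_pos (even_two_mul k), jacobiTheta₂_term, Complex.exp_add]
    push_cast
    rw [show (π * I * (2 * k) ^ 2 * (τ / 4) : ℂ) = k ^ 2 * π * I * τ by ring,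
      show (2 * π * I * (2 * k) * (z / 2) : ℂ) = 2 * k * π * I * z by ring]
    ring
  · intro n hn
    simp [thetaTerm, χ₃, hn]

lemma jθ₄_eq (z τ : ℂ) : jθ₄ z τ = thetaSeries χ₄ 0 z τ := by
  rw [jθ₄, thetaSeries, ← tsum_even_eq (f := fun n => thetaTerm χ₄ 0 n z τ)]
  · refine tsum_congr fun k => ?_
    rw [thetaTerm, χ₄, if_pos (even_two_mul k), I_zpow_two_mul, jacobiTheta₂_term, Complex.exp_add]
    push_cast
    rw [show (π * I * (2 * k) ^ 2 * (τ / 4) : ℂ) = k ^ 2 * π * I * τ by ring,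
      show (2 * π * I * (2 * k) * (z / 2) : ℂ) = 2 * k * π * I * z by ring]
    ring
  · intro n hn
    simp [thetaTerm, χ₄, hn]

lemma jθ₃_eq_jacobiTheta₂ (z τ : ℂ) : jθ₃ z τ = jacobiTheta₂ z τ := by
  rw [jθ₃, jacobiTheta₂]
  refine tsum_congr fun k => ?_
  rw [jacobiTheta₂_term, ← Complex.exp_add]
  ring_nf

lemma jθ₂_eq_jacobiTheta₂ (z τ : ℂ) :
    jθ₂ z τ = cexp (π * I * τ / 4 + π * I * z) * jacobiTheta₂ (z + τ / 2) τ := by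
  rw [jθ₂, jacobiTheta₂, ← tsum_mul_left, ← tsum_mul_left]
  refine tsum_congr fun k => ?_
  rw [jacobiTheta₂_term, ← Complex.exp_add, ← Complex.exp_add, ← Complex.exp_add]
  ring_nf

/-! ### Half-period shifts, parity, and vanishing at `z = 0`. -/

section shifts
variable (m : ℕ) (z τ : ℂ)

lemma thetaSeries_χ₁_add_half : thetaSeries χ₁ m (z + 1 / 2) τ = thetaSeries χ₂ m z τ :=
  thetaSeries_add_half χ₁_mul_I_zpow m z τ
lemma thetaSeries_χ₂_add_half : thetaSeries χ₂ m (z + 1 / 2) τ = -thetaSeries χ₁ m z τ := by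
  rw [thetaSeries_add_half χ₂_mul_I_zpow, thetaSeries_neg_coeff]
lemma thetaSeries_χ₃_add_half : thetaSeries χ₃ m (z + 1 / 2) τ = thetaSeries χ₄ m z τ :=
  thetaSeries_add_half χ₃_mul_I_zpow m z τ
lemma thetaSeries_χ₄_add_half : thetaSeries χ₄ m (z + 1 / 2) τ = thetaSeries χ₃ m z τ :=
  thetaSeries_add_half χ₄_mul_I_zpow m z τ

lemma thetaSeries_χ₁_neg : thetaSeries χ₁ m (-z) τ = -((-1) ^ m * thetaSeries χ₁ m z τ) := by
  rw [thetaSeries_neg χ₁_neg]; ring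
lemma thetaSeries_χ₂_neg : thetaSeries χ₂ m (-z) τ = (-1) ^ m * thetaSeries χ₂ m z τ := by
  rw [thetaSeries_neg χ₂_neg]; ring
lemma thetaSeries_χ₃_neg : thetaSeries χ₃ m (-z) τ = (-1) ^ m * thetaSeries χ₃ m z τ := by
  rw [thetaSeries_neg χ₃_neg]; ring
lemma thetaSeries_χ₄_neg : thetaSeries χ₄ m (-z) τ = (-1) ^ m * thetaSeries χ₄ m z τ := by
  rw [thetaSeries_neg χ₄_neg]; ring

variable {m}

lemma thetaSeries_χ₁_zero (hm : Even m) : thetaSeries χ₁ m 0 τ = 0 := by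
  have := thetaSeries_χ₁_neg m 0 τ
  rw [neg_zero, hm.neg_one_pow, one_mul] at this
  linear_combination this / 2
lemma thetaSeries_χ₂_zero (hm : Odd m) : thetaSeries χ₂ m 0 τ = 0 := by
  have := thetaSeries_χ₂_neg m 0 τ
  rw [neg_zero, hm.neg_one_pow] at this
  linear_combination this / 2
lemma thetaSeries_χ₃_zero (hm : Odd m) : thetaSeries χ₃ m 0 τ = 0 := by
  have := thetaSeries_χ₃_neg m 0 τ
  rw [neg_zero, hm.neg_one_pow] at this
  linear_combination this / 2
lemma thetaSeries_χ₄_zero (hm : Odd m) : thetaSeries χ₄ m 0 τ = 0 := by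
  have := thetaSeries_χ₄_neg m 0 τ
  rw [neg_zero, hm.neg_one_pow] at this
  linear_combination this / 2

end shifts

local notation "Θ₁" => thetaSeries χ₁
local notation "Θ₂" => thetaSeries χ₂
local notation "Θ₃" => thetaSeries χ₃
local notation "Θ₄" => thetaSeries χ₄

/-! ### Behaviour at `i∞` -/

open Filter Topology

lemma tendsto_cexp_mul_I_zero {c : ℝ} (hc : 0 < c) :
    Tendsto (fun τ : ℂ => cexp (c * I * τ)) (comap im atTop) (𝓝 0) := by
  rw [tendsto_zero_iff_norm_tendsto_zero]
  have : (fun τ : ℂ => ‖cexp (c * I * τ)‖) = (fun y : ℝ => Real.exp (-(c * y))) ∘ im := by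
    ext τ
    simp [Complex.norm_exp]
  rw [this]
  exact (Real.tendsto_exp_neg_atTop_nhds_zero.comp (tendsto_id.const_mul_atTop hc)).comp
    tendsto_comap

lemma thetaTerm_zero_left (χ : ℤ → ℂ) (m : ℕ) (n : ℤ) (τ : ℂ) :
    thetaTerm χ m n 0 τ = χ n * (π * I * n) ^ m * cexp ((π * n ^ 2 / 4 : ℝ) * I * τ) := by
  rw [thetaTerm, jacobiTheta₂_term]
  congr 2
  push_cast
  ring

lemma tendsto_thetaSeries_zero {χ : ℤ → ℂ} (hχ : ∀ n, ‖χ n‖ ≤ 1) :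
    Tendsto (fun τ => thetaSeries χ 0 0 τ) (comap im atTop) (𝓝 (χ 0)) := by
  have h0 : χ 0 = ∑' n : ℤ, if n = 0 then χ 0 else 0 := by rw [tsum_ite_eq]
  rw [h0]
  refine tendsto_tsum_of_dominated_convergence (summable_thetaTerm_bound 0 0 one_pos) ?_ ?_
  · intro n
    split_ifs with hn
    · subst hn
      simpa [thetaTerm_zero_left] using tendsto_const_nhds
    · have hn' : (0 : ℝ) < π * n ^ 2 / 4 := by
        have : (n : ℝ) ≠ 0 := by exact_mod_cast hn
        have := Real.pi_pos
        positivity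
      have := (tendsto_cexp_mul_I_zero hn').const_mul (χ n)
      simpa [thetaTerm_zero_left] using this
  · filter_upwards [preimage_mem_comap (Ici_mem_atTop (1 : ℝ))] with τ hτ n
    exact norm_thetaTerm_le hχ 0 n one_pos (by simp) hτ

/-- Without constant term the leading terms are `n = ±1`, both of order `e^{πiτ/4}`. Dividing by it
leaves the exponents `π(n² - 1)/4 · iτ`, which tend to zero for every other `n ≠ 0`. -/
lemma tendsto_exp_mul_thetaSeries {χ : ℤ → ℂ} (hχ : ∀ n, ‖χ n‖ ≤ 1) (h0 : χ 0 = 0) (m : ℕ) :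
    Tendsto (fun τ => cexp (-(π * I * τ / 4)) * thetaSeries χ m 0 τ) (comap im atTop)
      (𝓝 (χ 1 * (π * I) ^ m + χ (-1) * (-(π * I)) ^ m)) := by
  have hlim : χ 1 * (π * I) ^ m + χ (-1) * (-(π * I)) ^ m
      = ∑' n : ℤ, if n = 1 ∨ n = -1 then χ n * (π * I * n) ^ m else 0 := by
    rw [tsum_eq_sum (s := {1, -1})]
    · rw [Finset.sum_pair (by norm_num)]
      simp
    · intro n hn
      rw [if_neg]
      simpa using hn
  rw [hlim]
  simp only [thetaSeries, ← tsum_mul_left]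
  have hterm : ∀ (n : ℤ) (τ : ℂ), cexp (-(π * I * τ / 4)) * thetaTerm χ m n 0 τ
      = χ n * (π * I * n) ^ m * cexp ((π * (n ^ 2 - 1) / 4 : ℝ) * I * τ) := by
    intro n τ
    rw [thetaTerm_zero_left, mul_left_comm, ← Complex.exp_add]
    congr 2
    push_cast
    ring
  refine tendsto_tsum_of_dominated_convergence
    ((summable_thetaTerm_bound m 0 one_pos).mul_left (Real.exp (π / 4))) ?_ ?_
  · intro n
    simp only [hterm]
    split_ifs with hn
    · have : ((n : ℝ) ^ 2 - 1) = 0 := by rcases hn with rfl | rfl <;> norm_num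
      simpa [this] using tendsto_const_nhds
    · by_cases hn0 : n = 0
      · simpa [hn0, h0] using tendsto_const_nhds
      have hn' : (0 : ℝ) < π * (n ^ 2 - 1) / 4 := by
        have h1 : 1 < n ^ 2 := by
          push Not at hn
          have : 2 ≤ |n| := by
            rcases abs_cases n with h | h <;> omega
          nlinarith [sq_abs n]
        have h2 : (1 : ℝ) < n ^ 2 := by exact_mod_cast h1
        have := Real.pi_pos
        have : (0 : ℝ) < n ^ 2 - 1 := by linarith
        positivity
      have := (tendsto_cexp_mul_I_zero hn').const_mul (χ n * (π * I * n) ^ m)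
      simpa using this
  · filter_upwards [preimage_mem_comap (Ici_mem_atTop (1 : ℝ))] with τ hτ n
    -- The index `0` must be set aside: there `n² - 1` is negative and only `χ 0 = 0` saves the
    -- bound.
    by_cases hn0 : n = 0
    · rw [hterm, hn0, h0]
      simp
      positivity
    have hn1 : (1 : ℝ) ≤ n ^ 2 := by
      have : 0 < n ^ 2 := by positivity
      exact_mod_cast this
    have hτ' : 1 ≤ τ.im := hτ
    rw [hterm, norm_mul, norm_mul, norm_pow, Complex.norm_exp]
    have h2 : ‖(π * I * n : ℂ)‖ = π * |(n : ℝ)| := by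
      simp [abs_of_pos Real.pi_pos]
    rw [h2]
    have h3 : (((π * (n ^ 2 - 1) / 4 : ℝ) : ℂ) * I * τ).re ≤ π / 4 + -π * (1 / 4 * n ^ 2) := by
      have : (((π * (n ^ 2 - 1) / 4 : ℝ) : ℂ) * I * τ).re = -(π * (n ^ 2 - 1) / 4) * τ.im := by
        simp [-ofReal_div, -ofReal_mul]
      rw [this]
      have h4 : 0 ≤ π * (n ^ 2 - 1) / 4 := by
        have := Real.pi_pos
        have : (0 : ℝ) ≤ n ^ 2 - 1 := by linarith
        positivity
      nlinarith
    calc ‖χ n‖ * (π * |(n : ℝ)|) ^ m * Real.exp (((π * (n ^ 2 - 1) / 4 : ℝ) : ℂ) * I * τ).re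
        ≤ 1 * (π * |(n : ℝ)|) ^ m * Real.exp (π / 4 + -π * (1 / 4 * n ^ 2)) := by
          gcongr
          exact hχ n
      _ = _ := by
          rw [Real.exp_add, mul_pow]
          push_cast
          rw [show -π * (1 / 4 * (n : ℝ) ^ 2 - 2 * (0 / 2) * |(n : ℝ)|) = -π * (1 / 4 * n ^ 2) by ring]
          ring

/-! ### Doubling formulas -/

lemma thetaTerm_χ₂_odd (k : ℤ) (z τ : ℂ) : thetaTerm χ₂ 0 (2 * k + 1) z τ
    = cexp (2 * π * I * (k + 1 / 2) * z + π * I * (k + 1 / 2) ^ 2 * τ) := by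
  have hodd : ¬ Even (2 * k + 1) := by simp
  rw [thetaTerm, χ₂, if_neg hodd, jacobiTheta₂_term]
  push_cast
  ring_nf

/-- For `p = m + n`, `q = m - n` one has `p² + q² = 2(m² + n²)` and `px + qy = m(x+y) + n(x-y)`.
Pairs `(p, q)` of equal parity correspond to integers `m, n` and give the `θ₃` product; pairs of
opposite parity correspond to half-integers and give the `θ₂` product. -/
lemma jacobiTheta₂_mul_jacobiTheta₂ (x y : ℂ) {τ : ℂ} (hτ : 0 < τ.im) :
    jacobiTheta₂ x τ * jacobiTheta₂ y τ =
      jacobiTheta₂ (x + y) (2 * τ) * jacobiTheta₂ (x - y) (2 * τ)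
        + jθ₂ (x + y) (2 * τ) * jθ₂ (x - y) (2 * τ) := by
  have hτ2 : 0 < (2 * τ).im := by simpa using hτ
  have hJ : ∀ (z : ℂ) {t : ℂ}, 0 < t.im → Summable fun n => ‖jacobiTheta₂_term n z t‖ :=
    fun z t ht => ((summable_jacobiTheta₂_term_iff z t).mpr ht).norm
  have hS : ∀ z : ℂ, Summable fun k : ℤ => ‖thetaTerm χ₂ 0 (2 * k + 1) z (2 * τ)‖ := fun z =>
    (summable_thetaTerm norm_χ₂_le 0 z hτ2).norm.comp_injective
      (i := fun k : ℤ => 2 * k + 1) (fun a b h => by simpa using h)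
  have h2 : ∀ z, jθ₂ z (2 * τ) = ∑' k : ℤ, thetaTerm χ₂ 0 (2 * k + 1) z (2 * τ) := by
    intro z
    rw [jθ₂_eq, thetaSeries, tsum_odd_eq (f := fun n => thetaTerm χ₂ 0 n z (2 * τ))]
    intro n hn
    simp [thetaTerm, χ₂, hn]
  rw [h2, h2, jacobiTheta₂, jacobiTheta₂, jacobiTheta₂, jacobiTheta₂,
    tsum_mul_tsum_of_summable_norm (hJ x hτ) (hJ y hτ),
    tsum_mul_tsum_of_summable_norm (hJ _ hτ2) (hJ _ hτ2),
    tsum_mul_tsum_of_summable_norm (hS _) (hS _)]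
  set F : ℤ × ℤ → ℂ := fun p => jacobiTheta₂_term p.1 x τ * jacobiTheta₂_term p.2 y τ with hF
  have hFs : Summable F := by
    have := summable_mul_of_summable_norm (hJ x hτ) (hJ y hτ)
    exact this
  let g : ℤ × ℤ → ℤ × ℤ := fun p => (p.1 + p.2, p.1 - p.2)
  -- This is `(m', n') ↦ (m' + n', m' - n')` for `m' = m + 1/2` and `n' = n + 1/2`.
  let h : ℤ × ℤ → ℤ × ℤ := fun p => (p.1 + p.2 + 1, p.1 - p.2)
  have hg : Function.Injective g := by
    rintro ⟨a, b⟩ ⟨c, d⟩ he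
    simp only [g, Prod.mk.injEq] at he ⊢
    omega
  have hh : Function.Injective h := by
    rintro ⟨a, b⟩ ⟨c, d⟩ he
    simp only [h, Prod.mk.injEq] at he ⊢
    omega
  have hcompl : (Set.range g)ᶜ = Set.range h := by
    ext ⟨a, b⟩
    simp only [Set.mem_compl_iff, Set.mem_range, Prod.exists, g, h, Prod.mk.injEq]
    constructor
    · intro hn
      push Not at hn
      refine ⟨(a + b - 1) / 2, (a - b - 1) / 2, ?_⟩
      have := hn ((a + b) / 2) ((a - b) / 2)
      omega
    · rintro ⟨s, t, h1, h2⟩ ⟨u, v, h3, h4⟩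
      omega
  have hsplit : ∑' p, F p = ∑' p, F (g p) + ∑' p, F (h p) := by
    rw [← hFs.tsum_subtype_add_tsum_subtype_compl (Set.range g), hcompl]
    congr 1
    · exact tsum_range F hg
    · exact tsum_range F hh
  rw [hsplit]
  congr 1
  · refine tsum_congr fun p => ?_
    simp only [hF, g, jacobiTheta₂_term, ← Complex.exp_add]
    congr 1
    push_cast
    ring
  · refine tsum_congr fun p => ?_
    simp only [hF, h, jacobiTheta₂_term, thetaTerm_χ₂_odd, ← Complex.exp_add]
    congr 1
    push_cast
    ring

variable {τ : ℂ}

lemma Θ₃_mul_Θ₃ (hτ : 0 < τ.im) (x y : ℂ) : Θ₃ 0 x τ * Θ₃ 0 y τ =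
    Θ₃ 0 (x + y) (2 * τ) * Θ₃ 0 (x - y) (2 * τ)
      + Θ₂ 0 (x + y) (2 * τ) * Θ₂ 0 (x - y) (2 * τ) := by
  simpa only [← jθ₃_eq, ← jθ₂_eq, jθ₃_eq_jacobiTheta₂] using jacobiTheta₂_mul_jacobiTheta₂ x y hτ

/-- Both arguments are shifted by `τ/2`, which turns `θ₃` into `θ₂` up to an exponential. The sum
then moves by `τ`, a half-period for the modulus `2τ` that exchanges `θ₂` and `θ₃`, while the
difference stays fixed. -/
lemma Θ₂_mul_Θ₂ (hτ : 0 < τ.im) (x y : ℂ) : Θ₂ 0 x τ * Θ₂ 0 y τ =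
    Θ₂ 0 (x + y) (2 * τ) * Θ₃ 0 (x - y) (2 * τ)
      + Θ₃ 0 (x + y) (2 * τ) * Θ₂ 0 (x - y) (2 * τ) := by
  have key := jacobiTheta₂_mul_jacobiTheta₂ (x + τ / 2) (y + τ / 2) hτ
  rw [show x + τ / 2 - (y + τ / 2) = x - y by ring,
    show x + τ / 2 + (y + τ / 2) = x + y + τ by ring] at key
  have h1 : jθ₂ (x + y + τ) (2 * τ)
      = cexp (-(π * I * τ / 2 + π * I * (x + y))) * jacobiTheta₂ (x + y) (2 * τ) := by
    rw [jθ₂_eq_jacobiTheta₂, show x + y + τ + 2 * τ / 2 = x + y + 2 * τ by ring,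
      jacobiTheta₂_add_left', ← mul_assoc, ← Complex.exp_add]
    congr 2
    ring
  have h2 : jθ₂ (x + y) (2 * τ)
      = cexp (π * I * τ / 2 + π * I * (x + y)) * jacobiTheta₂ (x + y + τ) (2 * τ) := by
    rw [jθ₂_eq_jacobiTheta₂, show x + y + 2 * τ / 2 = x + y + τ by ring,
      show (π * I * (2 * τ) / 4 : ℂ) = π * I * τ / 2 by ring]
  rw [h1] at key
  simp only [← jθ₃_eq, ← jθ₂_eq, jθ₃_eq_jacobiTheta₂]
  rw [h2, jθ₂_eq_jacobiTheta₂ x τ, jθ₂_eq_jacobiTheta₂ y τ]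
  have e1 : cexp (π * I * τ / 4 + π * I * x) * cexp (π * I * τ / 4 + π * I * y)
      = cexp (π * I * τ / 2 + π * I * (x + y)) := by
    rw [← Complex.exp_add]; ring_nf
  have e2 : cexp (π * I * τ / 2 + π * I * (x + y)) * cexp (-(π * I * τ / 2 + π * I * (x + y)))
      = 1 := by
    rw [← Complex.exp_add, add_neg_cancel, Complex.exp_zero]
  linear_combination jacobiTheta₂ (x + τ / 2) τ * jacobiTheta₂ (y + τ / 2) τ * e1
    + cexp (π * I * τ / 2 + π * I * (x + y)) * key
    + jacobiTheta₂ (x + y) (2 * τ) * jθ₂ (x - y) (2 * τ) * e2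

lemma Θ₂_sub_half (m : ℕ) (z : ℂ) (t : ℂ) : Θ₂ m (z - 1 / 2) t = Θ₁ m z t := by
  rw [← thetaSeries_χ₁_add_half, sub_add_cancel]

lemma Θ₃_sub_half (m : ℕ) (z : ℂ) (t : ℂ) : Θ₃ m (z - 1 / 2) t = Θ₄ m z t := by
  rw [← thetaSeries_χ₄_add_half, sub_add_cancel]

lemma Θ₃_mul_Θ₄ (hτ : 0 < τ.im) (x y : ℂ) : Θ₃ 0 x τ * Θ₄ 0 y τ =
    Θ₄ 0 (x + y) (2 * τ) * Θ₄ 0 (x - y) (2 * τ)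
      - Θ₁ 0 (x + y) (2 * τ) * Θ₁ 0 (x - y) (2 * τ) := by
  have := Θ₃_mul_Θ₃ hτ x (y + 1 / 2)
  rw [thetaSeries_χ₃_add_half, show x + (y + 1 / 2) = x + y + 1 / 2 by ring,
    show x - (y + 1 / 2) = x - y - 1 / 2 by ring, thetaSeries_χ₃_add_half, thetaSeries_χ₂_add_half,
    Θ₂_sub_half, Θ₃_sub_half] at this
  rw [this]; ring

lemma Θ₂_mul_Θ₁ (hτ : 0 < τ.im) (x y : ℂ) : Θ₂ 0 x τ * Θ₁ 0 y τ =
    Θ₁ 0 (x + y) (2 * τ) * Θ₄ 0 (x - y) (2 * τ)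
      - Θ₄ 0 (x + y) (2 * τ) * Θ₁ 0 (x - y) (2 * τ) := by
  have := Θ₂_mul_Θ₂ hτ x (y + 1 / 2)
  rw [thetaSeries_χ₂_add_half, show x + (y + 1 / 2) = x + y + 1 / 2 by ring,
    show x - (y + 1 / 2) = x - y - 1 / 2 by ring, thetaSeries_χ₃_add_half, thetaSeries_χ₂_add_half,
    Θ₂_sub_half, Θ₃_sub_half] at this
  linear_combination -this

lemma Θ₄_mul_Θ₄ (hτ : 0 < τ.im) (x y : ℂ) : Θ₄ 0 x τ * Θ₄ 0 y τ =
    Θ₃ 0 (x + y) (2 * τ) * Θ₃ 0 (x - y) (2 * τ)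
      - Θ₂ 0 (x + y) (2 * τ) * Θ₂ 0 (x - y) (2 * τ) := by
  have := Θ₃_mul_Θ₃ hτ (x + 1 / 2) (y + 1 / 2)
  rw [thetaSeries_χ₃_add_half, thetaSeries_χ₃_add_half,
    show x + 1 / 2 + (y + 1 / 2) = x + y + 1 / 2 + 1 / 2 by ring,
    show x + 1 / 2 - (y + 1 / 2) = x - y by ring, thetaSeries_χ₃_add_half, thetaSeries_χ₂_add_half,
    thetaSeries_χ₁_add_half, thetaSeries_χ₄_add_half] at this
  rw [this]; ring

lemma Θ₁_mul_Θ₁ (hτ : 0 < τ.im) (x y : ℂ) : Θ₁ 0 x τ * Θ₁ 0 y τ =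
    Θ₃ 0 (x + y) (2 * τ) * Θ₂ 0 (x - y) (2 * τ)
      - Θ₂ 0 (x + y) (2 * τ) * Θ₃ 0 (x - y) (2 * τ) := by
  have := Θ₂_mul_Θ₂ hτ (x + 1 / 2) (y + 1 / 2)
  rw [thetaSeries_χ₂_add_half, thetaSeries_χ₂_add_half,
    show x + 1 / 2 + (y + 1 / 2) = x + y + 1 / 2 + 1 / 2 by ring,
    show x + 1 / 2 - (y + 1 / 2) = x - y by ring, thetaSeries_χ₃_add_half, thetaSeries_χ₂_add_half,
    thetaSeries_χ₁_add_half, thetaSeries_χ₄_add_half] at this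
  linear_combination this

/-! ### The theta constants do not vanish -/

lemma im_two_pow_mul (hτ : 0 < τ.im) (n : ℕ) : 0 < ((2 : ℂ) ^ n * τ).im := by
  have : ((2 : ℂ) ^ n * τ).im = 2 ^ n * τ.im := by
    have h : ((2 : ℂ) ^ n) = ((2 ^ n : ℝ) : ℂ) := by push_cast; rfl
    rw [h, Complex.im_ofReal_mul]
  rw [this]
  positivity

lemma tendsto_two_pow_mul (hτ : 0 < τ.im) :
    Tendsto (fun n : ℕ => (2 : ℂ) ^ n * τ) atTop (comap im atTop) := by
  rw [tendsto_comap_iff]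
  have : (im ∘ fun n : ℕ => (2 : ℂ) ^ n * τ) = fun n : ℕ => (2 : ℝ) ^ n * τ.im := by
    ext n
    have h : ((2 : ℂ) ^ n) = ((2 ^ n : ℝ) : ℂ) := by push_cast; rfl
    simp only [Function.comp, h, Complex.im_ofReal_mul]
  rw [this]
  exact (tendsto_pow_atTop_atTop_of_one_lt one_lt_two).atTop_mul_const hτ

lemma Θ₃_zero_mul_Θ₄_zero (hτ : 0 < τ.im) : Θ₃ 0 0 τ * Θ₄ 0 0 τ = Θ₄ 0 0 (2 * τ) ^ 2 := by
  have := Θ₃_mul_Θ₄ hτ 0 0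
  rw [add_zero, sub_zero, thetaSeries_χ₁_zero _ (by decide)] at this
  rw [this]; ring

lemma Θ₂_zero_sq (hτ : 0 < τ.im) :
    Θ₂ 0 0 τ ^ 2 = 2 * (Θ₂ 0 0 (2 * τ) * Θ₃ 0 0 (2 * τ)) := by
  have := Θ₂_mul_Θ₂ hτ 0 0
  rw [add_zero, sub_zero] at this
  rw [sq, this]; ring

/-- By `ϑ₃(τ)ϑ₄(τ) = ϑ₄(2τ)²` a zero at `τ` propagates to all `2ⁿτ`, against the limit `1` at `i∞`.
-/
lemma Θ₄_zero_ne_zero (hτ : 0 < τ.im) : Θ₄ 0 0 τ ≠ 0 := by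
  intro h
  have hn : ∀ n : ℕ, Θ₄ 0 0 ((2 : ℂ) ^ n * τ) = 0 := by
    intro n
    induction n with
    | zero => simpa using h
    | succ n ih =>
      have := Θ₃_zero_mul_Θ₄_zero (im_two_pow_mul hτ n)
      rw [ih, mul_zero, ← mul_assoc, ← pow_succ'] at this
      exact pow_eq_zero_iff two_ne_zero |>.mp this.symm
  have hlim := (tendsto_thetaSeries_zero norm_χ₄_le).comp (tendsto_two_pow_mul hτ)
  have h0 : ((fun t => Θ₄ 0 0 t) ∘ fun n : ℕ => (2 : ℂ) ^ n * τ) = fun _ => 0 := by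
    ext n; exact hn n
  rw [h0] at hlim
  have := tendsto_nhds_unique hlim tendsto_const_nhds
  simp [χ₄] at this

lemma Θ₃_zero_ne_zero (hτ : 0 < τ.im) : Θ₃ 0 0 τ ≠ 0 := by
  intro h
  have := Θ₃_zero_mul_Θ₄_zero hτ
  rw [h, zero_mul] at this
  exact Θ₄_zero_ne_zero (τ := 2 * τ) (by simpa using hτ) (pow_eq_zero_iff two_ne_zero |>.mp this.symm)

/-- The same descent with `ϑ₂(τ)² = 2ϑ₂(2τ)ϑ₃(2τ)`; since `ϑ₂` itself tends to zero, the
contradiction comes from `e^{-πiτ/4}ϑ₂ → 2`. -/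
lemma Θ₂_zero_ne_zero (hτ : 0 < τ.im) : Θ₂ 0 0 τ ≠ 0 := by
  intro h
  have hn : ∀ n : ℕ, Θ₂ 0 0 ((2 : ℂ) ^ n * τ) = 0 := by
    intro n
    induction n with
    | zero => simpa using h
    | succ n ih =>
      have := Θ₂_zero_sq (im_two_pow_mul hτ n)
      rw [ih, ← mul_assoc 2 _ τ, ← pow_succ'] at this
      have h3 := Θ₃_zero_ne_zero (im_two_pow_mul hτ (n + 1))
      simpa [h3] using this
  have hlim := (tendsto_exp_mul_thetaSeries norm_χ₂_le (by simp [χ₂]) 0).comp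
    (tendsto_two_pow_mul hτ)
  have h0 : ((fun t => cexp (-(π * I * t / 4)) * Θ₂ 0 0 t) ∘ fun n : ℕ => (2 : ℂ) ^ n * τ)
      = fun _ => 0 := by
    ext n; simp [hn n]
  rw [h0] at hlim
  have := tendsto_nhds_unique hlim tendsto_const_nhds
  norm_num [χ₂] at this

/-! ### Quadratic relations -/

/-- The product formulas write every square in terms of `θ₂` and `θ₃` at `(2z|2τ)` and `(0|2τ)`,
where the relation is a polynomial identity. -/
lemma Θ₄_sq_mul_Θ₁_sq (hτ : 0 < τ.im) (z : ℂ) : Θ₄ 0 0 τ ^ 2 * Θ₁ 0 z τ ^ 2 =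
    Θ₂ 0 0 τ ^ 2 * Θ₃ 0 z τ ^ 2 - Θ₃ 0 0 τ ^ 2 * Θ₂ 0 z τ ^ 2 := by
  have h1 := Θ₁_mul_Θ₁ hτ z z
  have h2 := Θ₂_mul_Θ₂ hτ z z
  have h3 := Θ₃_mul_Θ₃ hτ z z
  have c2 := Θ₂_mul_Θ₂ hτ 0 0
  have c3 := Θ₃_mul_Θ₃ hτ 0 0
  have c4 := Θ₄_mul_Θ₄ hτ 0 0
  rw [sub_self] at h1 h2 h3
  rw [add_zero, sub_zero] at c2 c3 c4
  simp only [sq, h1, h2, h3, c2, c3, c4]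
  ring

lemma Θ₃_sq_mul_Θ₁_sq (hτ : 0 < τ.im) (z : ℂ) : Θ₃ 0 0 τ ^ 2 * Θ₁ 0 z τ ^ 2 =
    Θ₂ 0 0 τ ^ 2 * Θ₄ 0 z τ ^ 2 - Θ₄ 0 0 τ ^ 2 * Θ₂ 0 z τ ^ 2 := by
  have h1 := Θ₁_mul_Θ₁ hτ z z
  have h2 := Θ₂_mul_Θ₂ hτ z z
  have h4 := Θ₄_mul_Θ₄ hτ z z
  have c2 := Θ₂_mul_Θ₂ hτ 0 0
  have c3 := Θ₃_mul_Θ₃ hτ 0 0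
  have c4 := Θ₄_mul_Θ₄ hτ 0 0
  rw [sub_self] at h1 h2 h4
  rw [add_zero, sub_zero] at c2 c3 c4
  simp only [sq, h1, h2, h4, c2, c3, c4]
  ring

lemma Θ₃_zero_pow_four (hτ : 0 < τ.im) :
    Θ₃ 0 0 τ ^ 4 = Θ₂ 0 0 τ ^ 4 + Θ₄ 0 0 τ ^ 4 := by
  have c2 := Θ₂_mul_Θ₂ hτ 0 0
  have c3 := Θ₃_mul_Θ₃ hτ 0 0
  have c4 := Θ₄_mul_Θ₄ hτ 0 0
  rw [add_zero, sub_zero] at c2 c3 c4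
  have e : ∀ x : ℂ, x ^ 4 = (x * x) ^ 2 := fun x => by ring
  simp only [e, c2, c3, c4]
  ring

variable {τ : ℂ}

/-! ### First and second order bilinear identities -/

lemma hasDerivAt_thetaSeries_two_mul {χ : ℤ → ℂ} (hχ : ∀ n, ‖χ n‖ ≤ 1) (hτ : 0 < τ.im) (m : ℕ)
    (h : ℂ) : HasDerivAt (fun h => thetaSeries χ m (2 * h) τ)
      (2 * thetaSeries χ (m + 1) (2 * h) τ) h := by
  have := (hasDerivAt_thetaSeries_fst hχ m (2 * h) hτ).comp h ((hasDerivAt_id h).const_mul 2)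
  refine HasDerivAt.congr_deriv (f := fun h => thetaSeries χ m (2 * h) τ) this ?_
  ring

lemma deriv_unique_of_eq {f g : ℂ → ℂ} {f' g' x : ℂ} (h : f = g) (hf : HasDerivAt f f' x)
    (hg : HasDerivAt g g' x) : f' = g' :=
  (h ▸ hf).unique hg

lemma im_two_mul_pos (hτ : 0 < τ.im) : 0 < (2 * τ).im := by simpa using hτ

/-- With `x = z + h` and `y = z - h` the product formula separates `z` from `h`; its derivative at
`h = 0` is the Wronskian. -/
lemma wronskian_Θ₂_Θ₁_doubled (hτ : 0 < τ.im) (z : ℂ) :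
    Θ₂ 1 z τ * Θ₁ 0 z τ - Θ₁ 1 z τ * Θ₂ 0 z τ
      = -2 * Θ₁ 1 0 (2 * τ) * Θ₄ 0 (2 * z) (2 * τ) := by
  have hτ2 := im_two_mul_pos hτ
  have hL : HasDerivAt (fun h => Θ₂ 0 (z + h) τ * Θ₁ 0 (z - h) τ)
      (Θ₂ 1 (z + 0) τ * Θ₁ 0 (z - 0) τ + Θ₂ 0 (z + 0) τ * -Θ₁ 1 (z - 0) τ) 0 :=
    ((hasDerivAt_thetaSeries_fst norm_χ₂_le 0 (z + 0) hτ).comp_const_add z 0).mul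
      ((hasDerivAt_thetaSeries_fst norm_χ₁_le 0 (z - 0) hτ).comp_const_sub z 0)
  have hR : HasDerivAt (fun h => Θ₁ 0 (2 * z) (2 * τ) * Θ₄ 0 (2 * h) (2 * τ)
        - Θ₄ 0 (2 * z) (2 * τ) * Θ₁ 0 (2 * h) (2 * τ))
      (Θ₁ 0 (2 * z) (2 * τ) * (2 * Θ₄ 1 (2 * 0) (2 * τ))
        - Θ₄ 0 (2 * z) (2 * τ) * (2 * Θ₁ 1 (2 * 0) (2 * τ))) 0 :=
    ((hasDerivAt_thetaSeries_two_mul norm_χ₄_le hτ2 0 0).const_mul _).sub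
      ((hasDerivAt_thetaSeries_two_mul norm_χ₁_le hτ2 0 0).const_mul _)
  have heq : (fun h => Θ₂ 0 (z + h) τ * Θ₁ 0 (z - h) τ) =
      fun h => Θ₁ 0 (2 * z) (2 * τ) * Θ₄ 0 (2 * h) (2 * τ)
        - Θ₄ 0 (2 * z) (2 * τ) * Θ₁ 0 (2 * h) (2 * τ) := by
    ext h
    rw [Θ₂_mul_Θ₁ hτ, show z + h + (z - h) = 2 * z by ring, show z + h - (z - h) = 2 * h by ring]
  have := deriv_unique_of_eq heq hL hR
  rw [mul_zero, add_zero, sub_zero, thetaSeries_χ₄_zero _ (by decide)] at this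
  linear_combination this

/-- The doubled modulus is eliminated: `θ₄(2z|2τ)` is proportional to `θ₃(z)θ₄(z)`, and the unknown
`θ₁'(0|2τ)` is read off from the same identity at `z = 0`. -/
lemma wronskian_Θ₂_Θ₁_aux (hτ : 0 < τ.im) (z : ℂ) :
    (Θ₂ 1 z τ * Θ₁ 0 z τ - Θ₁ 1 z τ * Θ₂ 0 z τ) * (Θ₃ 0 0 τ * Θ₄ 0 0 τ)
      = -(Θ₁ 1 0 τ * Θ₂ 0 0 τ) * (Θ₃ 0 z τ * Θ₄ 0 z τ) := by
  have h1 := wronskian_Θ₂_Θ₁_doubled hτ z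
  have h0 := wronskian_Θ₂_Θ₁_doubled hτ 0
  have h2 := Θ₃_mul_Θ₄ hτ z z
  have h3 := Θ₃_zero_mul_Θ₄_zero hτ
  rw [sub_self, thetaSeries_χ₁_zero _ (by decide), mul_zero, sub_zero, ← two_mul] at h2
  rw [thetaSeries_χ₁_zero _ (by decide), mul_zero, mul_zero, zero_sub] at h0
  rw [h1, h2, h3]
  linear_combination -(Θ₄ 0 (2 * z) (2 * τ) * Θ₄ 0 0 (2 * τ)) * h0

/-- Half of the second `h`-derivative, at `h = 0`, of the product formula for `θ₁(z+h)θ₁(z-h)`. -/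
lemma second_order_doubled (hτ : 0 < τ.im) (z : ℂ) :
    Θ₁ 2 z τ * Θ₁ 0 z τ - Θ₁ 1 z τ ^ 2
      = 2 * (Θ₃ 0 (2 * z) (2 * τ) * Θ₂ 2 0 (2 * τ) - Θ₂ 0 (2 * z) (2 * τ) * Θ₃ 2 0 (2 * τ)) := by
  have hτ2 := im_two_mul_pos hτ
  have hp : ∀ m h, HasDerivAt (fun h => Θ₁ m (z + h) τ) (Θ₁ (m + 1) (z + h) τ) h := fun m h =>
    (hasDerivAt_thetaSeries_fst norm_χ₁_le m (z + h) hτ).comp_const_add z h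
  have hm : ∀ m h, HasDerivAt (fun h => Θ₁ m (z - h) τ) (-Θ₁ (m + 1) (z - h) τ) h := fun m h =>
    (hasDerivAt_thetaSeries_fst norm_χ₁_le m (z - h) hτ).comp_const_sub z h
  have heq : (fun h => Θ₁ 0 (z + h) τ * Θ₁ 0 (z - h) τ) =
      fun h => Θ₃ 0 (2 * z) (2 * τ) * Θ₂ 0 (2 * h) (2 * τ)
        - Θ₂ 0 (2 * z) (2 * τ) * Θ₃ 0 (2 * h) (2 * τ) := by
    ext h
    rw [Θ₁_mul_Θ₁ hτ, show z + h + (z - h) = 2 * z by ring, show z + h - (z - h) = 2 * h by ring]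
  have heq1 : (fun h => Θ₁ 1 (z + h) τ * Θ₁ 0 (z - h) τ + Θ₁ 0 (z + h) τ * -Θ₁ 1 (z - h) τ) =
      fun h => Θ₃ 0 (2 * z) (2 * τ) * (2 * Θ₂ 1 (2 * h) (2 * τ))
        - Θ₂ 0 (2 * z) (2 * τ) * (2 * Θ₃ 1 (2 * h) (2 * τ)) := by
    ext h
    have hL := (hp 0 h).mul (hm 0 h)
    have hR := ((hasDerivAt_thetaSeries_two_mul norm_χ₂_le hτ2 0 h).const_mul
      (Θ₃ 0 (2 * z) (2 * τ))).sub
      ((hasDerivAt_thetaSeries_two_mul norm_χ₃_le hτ2 0 h).const_mul (Θ₂ 0 (2 * z) (2 * τ)))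
    exact deriv_unique_of_eq heq hL hR
  have hL := ((hp 1 0).mul (hm 0 0)).add ((hp 0 0).mul (hm 1 0).neg)
  have hR := (((hasDerivAt_thetaSeries_two_mul norm_χ₂_le hτ2 1 0).const_mul 2).const_mul
      (Θ₃ 0 (2 * z) (2 * τ))).sub
      (((hasDerivAt_thetaSeries_two_mul norm_χ₃_le hτ2 1 0).const_mul 2).const_mul
        (Θ₂ 0 (2 * z) (2 * τ)))
  have := deriv_unique_of_eq heq1 hL hR
  simp only [mul_zero, add_zero, sub_zero, zero_add, Nat.reduceAdd, Pi.neg_apply] at this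
  linear_combination this / 2

/-- The functions `θ₂(2z|2τ)` and `θ₃(2z|2τ)` are combinations of `θ₁(z)²` and `θ₂(z)²`, so the left
side is `pθ₂² + qθ₁²` for constants `p, q`. These are found at `z = 0` and at `z = 1/2`, where one
of the two squares vanishes. -/
lemma second_order_Θ₁ (hτ : 0 < τ.im) (z : ℂ) :
    Θ₁ 2 z τ * Θ₁ 0 z τ - Θ₁ 1 z τ ^ 2
      = -(Θ₁ 1 0 τ / Θ₂ 0 0 τ) ^ 2 * Θ₂ 0 z τ ^ 2 + Θ₂ 2 0 τ / Θ₂ 0 0 τ * Θ₁ 0 z τ ^ 2 := by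
  have hτ2 := im_two_mul_pos hτ
  have ha := Θ₃_zero_ne_zero hτ2
  have hb := Θ₂_zero_ne_zero hτ2
  have hc := Θ₂_zero_ne_zero hτ
  obtain ⟨p, q, hpq⟩ : ∃ p q : ℂ, ∀ z, Θ₁ 2 z τ * Θ₁ 0 z τ - Θ₁ 1 z τ ^ 2
      = p * Θ₂ 0 z τ ^ 2 + q * Θ₁ 0 z τ ^ 2 := by
    refine ⟨Θ₂ 2 0 (2 * τ) / Θ₂ 0 0 (2 * τ) - Θ₃ 2 0 (2 * τ) / Θ₃ 0 0 (2 * τ),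
      Θ₂ 2 0 (2 * τ) / Θ₂ 0 0 (2 * τ) + Θ₃ 2 0 (2 * τ) / Θ₃ 0 0 (2 * τ), fun z => ?_⟩
    have h1 := Θ₁_mul_Θ₁ hτ z z
    have h2 := Θ₂_mul_Θ₂ hτ z z
    rw [sub_self, ← two_mul] at h1 h2
    rw [second_order_doubled hτ, sq, sq, h1, h2]
    field_simp
    ring
  have e0 := hpq 0
  have e1 := hpq (0 + 1 / 2)
  simp only [thetaSeries_χ₁_add_half, thetaSeries_χ₂_add_half] at e1
  rw [thetaSeries_χ₁_zero (m := 0) _ (by decide)] at e0 e1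
  rw [thetaSeries_χ₂_zero (m := 1) _ (by decide)] at e1
  have hp : p = -(Θ₁ 1 0 τ / Θ₂ 0 0 τ) ^ 2 := by
    field_simp
    linear_combination -e0
  have hq : q = Θ₂ 2 0 τ / Θ₂ 0 0 τ := by
    have : Θ₂ 0 0 τ * (q * Θ₂ 0 0 τ) = Θ₂ 0 0 τ * Θ₂ 2 0 τ := by linear_combination -e1
    rw [eq_div_iff hc]
    exact mul_left_cancel₀ hc this
  rw [hpq z, hp, hq]

lemma second_order_Θ₂ (hτ : 0 < τ.im) (z : ℂ) :
    Θ₂ 2 z τ * Θ₂ 0 z τ - Θ₂ 1 z τ ^ 2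
      = -(Θ₁ 1 0 τ / Θ₂ 0 0 τ) ^ 2 * Θ₁ 0 z τ ^ 2 + Θ₂ 2 0 τ / Θ₂ 0 0 τ * Θ₂ 0 z τ ^ 2 := by
  have := second_order_Θ₁ hτ (z + 1 / 2)
  simp only [thetaSeries_χ₁_add_half, thetaSeries_χ₂_add_half, neg_sq] at this
  exact this

/-! ### Jacobi's derivative formula -/

/-- The second `z`-derivative at `0` of the Wronskian identity; parity removes the other terms. -/
lemma third_derivative_relation (hτ : 0 < τ.im) :
    Θ₁ 3 0 τ * (Θ₂ 0 0 τ * Θ₃ 0 0 τ * Θ₄ 0 0 τ)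
      = Θ₁ 1 0 τ * (Θ₂ 2 0 τ * Θ₃ 0 0 τ * Θ₄ 0 0 τ + Θ₂ 0 0 τ * Θ₃ 2 0 τ * Θ₄ 0 0 τ
        + Θ₂ 0 0 τ * Θ₃ 0 0 τ * Θ₄ 2 0 τ) := by
  have d1 := fun m z => hasDerivAt_thetaSeries_fst norm_χ₁_le m z hτ
  have d2 := fun m z => hasDerivAt_thetaSeries_fst norm_χ₂_le m z hτ
  have d3 := fun m z => hasDerivAt_thetaSeries_fst norm_χ₃_le m z hτ
  have d4 := fun m z => hasDerivAt_thetaSeries_fst norm_χ₄_le m z hτ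
  set c := Θ₃ 0 0 τ * Θ₄ 0 0 τ with hc
  set k := -(Θ₁ 1 0 τ * Θ₂ 0 0 τ) with hk
  have heq : (fun z => (Θ₂ 1 z τ * Θ₁ 0 z τ - Θ₁ 1 z τ * Θ₂ 0 z τ) * c)
      = fun z => k * (Θ₃ 0 z τ * Θ₄ 0 z τ) := by
    ext z; exact wronskian_Θ₂_Θ₁_aux hτ z
  have heq1 : (fun z => (Θ₂ 2 z τ * Θ₁ 0 z τ - Θ₁ 2 z τ * Θ₂ 0 z τ) * c)
      = fun z => k * (Θ₃ 1 z τ * Θ₄ 0 z τ + Θ₃ 0 z τ * Θ₄ 1 z τ) := by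
    ext z
    have hL := (((d2 1 z).mul (d1 0 z)).sub ((d1 1 z).mul (d2 0 z))).mul_const c
    have hR := ((d3 0 z).mul (d4 0 z)).const_mul k
    have := deriv_unique_of_eq heq hL hR
    linear_combination this
  have hL := (((d2 2 0).mul (d1 0 0)).sub ((d1 2 0).mul (d2 0 0))).mul_const c
  have hR := (((d3 1 0).mul (d4 0 0)).add ((d3 0 0).mul (d4 1 0))).const_mul k
  have := deriv_unique_of_eq heq1 hL hR
  rw [thetaSeries_χ₁_zero (m := 0) _ (by decide), thetaSeries_χ₁_zero (m := 2) _ (by decide),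
    thetaSeries_χ₂_zero (m := 1) _ (by decide), thetaSeries_χ₃_zero (m := 0 + 1) _ (by decide),
    thetaSeries_χ₄_zero (m := 0 + 1) _ (by decide)] at this
  simp only [hc, hk] at this
  linear_combination -this

instance neBot_comap_im_atTop : (comap im atTop).NeBot := by
  refine comap_neBot fun s hs => ?_
  obtain ⟨y, hy⟩ := (mem_atTop_sets.mp hs)
  exact ⟨y * I, by simpa using hy y le_rfl⟩

lemma isOpen_im_pos : IsOpen {τ : ℂ | 0 < τ.im} := continuous_im.isOpen_preimage _ isOpen_Ioi

/-- By the heat equation, `third_derivative_relation` says that `θ₁'(0)/(ϑ₂ϑ₃ϑ₄)` has zero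
`τ`-derivative. It is therefore constant on the half-plane, and its limit at `i∞` is `2π/2`. -/
lemma jacobi_derivative_formula (hτ : 0 < τ.im) :
    Θ₁ 1 0 τ = π * (Θ₂ 0 0 τ * Θ₃ 0 0 τ * Θ₄ 0 0 τ) := by
  have hne : ∀ t : ℂ, 0 < t.im → Θ₂ 0 0 t * Θ₃ 0 0 t * Θ₄ 0 0 t ≠ 0 := fun t ht =>
    mul_ne_zero (mul_ne_zero (Θ₂_zero_ne_zero ht) (Θ₃_zero_ne_zero ht)) (Θ₄_zero_ne_zero ht)
  let Q : ℂ → ℂ := fun t => Θ₁ 1 0 t / (Θ₂ 0 0 t * Θ₃ 0 0 t * Θ₄ 0 0 t)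
  have hQ : ∀ t ∈ {t : ℂ | 0 < t.im}, HasDerivAt Q 0 t := by
    intro t ht
    have ht' : 0 < t.im := ht
    have := (hasDerivAt_thetaSeries_snd norm_χ₁_le 1 0 ht').div
      (((hasDerivAt_thetaSeries_snd norm_χ₂_le 0 0 ht').mul
        (hasDerivAt_thetaSeries_snd norm_χ₃_le 0 0 ht')).mul
        (hasDerivAt_thetaSeries_snd norm_χ₄_le 0 0 ht')) (hne t ht')
    refine this.congr_deriv ?_
    rw [div_eq_zero_iff]
    left
    have h3 := third_derivative_relation ht'
    simp only [Pi.mul_apply]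
    linear_combination h3 / (4 * π * I)
  have hconst : ∀ t : ℂ, 0 < t.im → Q t = Q τ := fun t ht =>
    isOpen_im_pos.is_const_of_deriv_eq_zero (convex_halfSpace_im_gt 0).isPreconnected
      (fun t ht => (hQ t ht).differentiableAt.differentiableWithinAt)
      (fun t ht => (hQ t ht).deriv) ht hτ
  have l1 := tendsto_exp_mul_thetaSeries norm_χ₁_le (by simp [χ₁]) 1
  have l2 := tendsto_exp_mul_thetaSeries norm_χ₂_le (by simp [χ₂]) 0
  have l3 := tendsto_thetaSeries_zero norm_χ₃_le
  have l4 := tendsto_thetaSeries_zero norm_χ₄_le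
  have e1 : χ₁ 1 * (π * I) ^ 1 + χ₁ (-1) * (-(π * I)) ^ 1 = 2 * π := by
    simp [χ₁]
    linear_combination (-2 * π) * I_sq
  have e2 : χ₂ 1 * (π * I) ^ 0 + χ₂ (-1) * (-(π * I)) ^ 0 = 2 := by
    norm_num [χ₂]
  have e3 : χ₃ 0 = 1 := by simp [χ₃]
  have e4 : χ₄ 0 = 1 := by simp [χ₄]
  rw [e1] at l1
  rw [e2] at l2
  rw [e3] at l3
  rw [e4] at l4
  have lQ := l1.div ((l2.mul l3).mul l4) (by norm_num)
  have hQc : Tendsto (fun _ : ℂ => Q τ) (comap im atTop) (𝓝 (2 * π / (2 * 1 * 1))) := by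
    refine lQ.congr' ?_
    filter_upwards [preimage_mem_comap (Ioi_mem_atTop (0 : ℝ))] with t ht
    rw [← hconst t ht]
    have := hne t ht
    have he := Complex.exp_ne_zero (-(π * I * t / 4))
    simp only [Q, Pi.div_apply]
    rw [mul_assoc (_ * _), mul_assoc (cexp _), mul_div_mul_left _ _ he, mul_assoc]
  have hlim := tendsto_nhds_unique hQc tendsto_const_nhds
  have hne' := hne τ hτ
  have : Q τ = π := by rw [← hlim]; ring
  simp only [Q] at this
  rwa [div_eq_iff hne'] at this

lemma Θ₁_one_zero_ne_zero (hτ : 0 < τ.im) : Θ₁ 1 0 τ ≠ 0 := by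
  rw [jacobi_derivative_formula hτ]
  refine mul_ne_zero (by exact_mod_cast Real.pi_ne_zero) ?_
  exact mul_ne_zero (mul_ne_zero (Θ₂_zero_ne_zero hτ) (Θ₃_zero_ne_zero hτ)) (Θ₄_zero_ne_zero hτ)

/-! ### The `z`-equations for the Jacobi series -/

lemma wronskian_Θ₂ (hτ : 0 < τ.im) (z : ℂ) :
    Θ₂ 1 z τ * Θ₁ 0 z τ - Θ₁ 1 z τ * Θ₂ 0 z τ
      = -(π * Θ₂ 0 0 τ ^ 2) * (Θ₃ 0 z τ * Θ₄ 0 z τ) := by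
  have h := wronskian_Θ₂_Θ₁_aux hτ z
  rw [jacobi_derivative_formula hτ] at h
  have h34 := mul_ne_zero (Θ₃_zero_ne_zero hτ) (Θ₄_zero_ne_zero hτ)
  refine mul_right_cancel₀ h34 ?_
  rw [h]; ring

lemma differentiable_thetaSeries {χ : ℤ → ℂ} (hχ : ∀ n, ‖χ n‖ ≤ 1) (m : ℕ) (hτ : 0 < τ.im) :
    Differentiable ℂ fun z => thetaSeries χ m z τ :=
  fun z => (hasDerivAt_thetaSeries_fst hχ m z hτ).differentiableAt

lemma eq_zero_of_mul_eq_zero_of_entire {f g : ℂ → ℂ} (hf : Differentiable ℂ f)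
    (hg : Differentiable ℂ g) (h : ∀ z, f z * g z = 0) {z₀ : ℂ} (h0 : f z₀ ≠ 0) (z : ℂ) :
    g z = 0 := by
  have hev : ∀ᶠ w in 𝓝 z₀, g w = 0 := by
    filter_upwards [hf.continuous.continuousAt.eventually_ne h0] with w hw
    exact (mul_eq_zero.mp (h w)).resolve_left hw
  have hga : AnalyticOnNhd ℂ g Set.univ := fun w _ => hg.analyticAt w
  exact hga.eqOn_zero_of_preconnected_of_eventuallyEq_zero isPreconnected_univ (Set.mem_univ z₀)
    hev (Set.mem_univ z)

/-- Differentiating the quadratic relation between `θ₁²`, `θ₂²`, `θ₃²` and inserting the Wronskian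
of `θ₂` gives the claim multiplied by `θ₃(z)`. The entire factor `θ₃` is not identically zero and
cancels by the identity theorem. -/
lemma wronskian_Θ₃ (hτ : 0 < τ.im) (z : ℂ) :
    Θ₃ 1 z τ * Θ₁ 0 z τ - Θ₁ 1 z τ * Θ₃ 0 z τ
      = -(π * Θ₃ 0 0 τ ^ 2) * (Θ₂ 0 z τ * Θ₄ 0 z τ) := by
  have d1 := fun z => hasDerivAt_thetaSeries_fst norm_χ₁_le 0 z hτ
  have d2 := fun z => hasDerivAt_thetaSeries_fst norm_χ₂_le 0 z hτ
  have d3 := fun z => hasDerivAt_thetaSeries_fst norm_χ₃_le 0 z hτ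
  have df := fun {χ : ℤ → ℂ} (hχ : ∀ n : ℤ, ‖χ n‖ ≤ 1) m => differentiable_thetaSeries hχ m hτ
  suffices ∀ z, Θ₃ 1 z τ * Θ₁ 0 z τ - Θ₁ 1 z τ * Θ₃ 0 z τ
      + (π * Θ₃ 0 0 τ ^ 2) * (Θ₂ 0 z τ * Θ₄ 0 z τ) = 0 by linear_combination this z
  refine eq_zero_of_mul_eq_zero_of_entire (f := fun z => Θ₃ 0 z τ) (df norm_χ₃_le 0) ?_ ?_
    (Θ₃_zero_ne_zero hτ)
  · exact (((df norm_χ₃_le 1).mul (df norm_χ₁_le 0)).sub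
      ((df norm_χ₁_le 1).mul (df norm_χ₃_le 0))).add
      (((df norm_χ₂_le 0).mul (df norm_χ₄_le 0)).const_mul _)
  · intro z
    have heq : (fun z => Θ₄ 0 0 τ ^ 2 * Θ₁ 0 z τ ^ 2) = fun z =>
      Θ₂ 0 0 τ ^ 2 * Θ₃ 0 z τ ^ 2 - Θ₃ 0 0 τ ^ 2 * Θ₂ 0 z τ ^ 2 := by
      ext z; exact Θ₄_sq_mul_Θ₁_sq hτ z
    have hL := ((d1 z).pow 2).const_mul (Θ₄ 0 0 τ ^ 2)
    have hR := (((d3 z).pow 2).const_mul (Θ₂ 0 0 τ ^ 2)).sub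
      (((d2 z).pow 2).const_mul (Θ₃ 0 0 τ ^ 2))
    have hd := deriv_unique_of_eq heq hL hR
    have hz := congrFun heq z
    have hw := wronskian_Θ₂ hτ z
    simp only [zero_add, Nat.cast_ofNat, Nat.add_one_sub_one, pow_one] at hd hz
    refine mul_left_cancel₀ (pow_ne_zero 2 (Θ₂_zero_ne_zero hτ)) ?_
    linear_combination -Θ₁ 0 z τ / 2 * hd + Θ₁ 1 z τ * hz + Θ₃ 0 0 τ ^ 2 * Θ₂ 0 z τ * hw

lemma wronskian_Θ₄ (hτ : 0 < τ.im) (z : ℂ) :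
    Θ₄ 1 z τ * Θ₁ 0 z τ - Θ₁ 1 z τ * Θ₄ 0 z τ
      = -(π * Θ₄ 0 0 τ ^ 2) * (Θ₂ 0 z τ * Θ₃ 0 z τ) := by
  have d1 := fun z => hasDerivAt_thetaSeries_fst norm_χ₁_le 0 z hτ
  have d2 := fun z => hasDerivAt_thetaSeries_fst norm_χ₂_le 0 z hτ
  have d4 := fun z => hasDerivAt_thetaSeries_fst norm_χ₄_le 0 z hτ
  have df := fun {χ : ℤ → ℂ} (hχ : ∀ n : ℤ, ‖χ n‖ ≤ 1) m => differentiable_thetaSeries hχ m hτ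
  suffices ∀ z, Θ₄ 1 z τ * Θ₁ 0 z τ - Θ₁ 1 z τ * Θ₄ 0 z τ
      + (π * Θ₄ 0 0 τ ^ 2) * (Θ₂ 0 z τ * Θ₃ 0 z τ) = 0 by linear_combination this z
  refine eq_zero_of_mul_eq_zero_of_entire (f := fun z => Θ₄ 0 z τ) (df norm_χ₄_le 0) ?_ ?_
    (Θ₄_zero_ne_zero hτ)
  · exact (((df norm_χ₄_le 1).mul (df norm_χ₁_le 0)).sub
      ((df norm_χ₁_le 1).mul (df norm_χ₄_le 0))).add
      (((df norm_χ₂_le 0).mul (df norm_χ₃_le 0)).const_mul _)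
  · intro z
    have heq : (fun z => Θ₃ 0 0 τ ^ 2 * Θ₁ 0 z τ ^ 2) = fun z =>
      Θ₂ 0 0 τ ^ 2 * Θ₄ 0 z τ ^ 2 - Θ₄ 0 0 τ ^ 2 * Θ₂ 0 z τ ^ 2 := by
      ext z; exact Θ₃_sq_mul_Θ₁_sq hτ z
    have hL := ((d1 z).pow 2).const_mul (Θ₃ 0 0 τ ^ 2)
    have hR := (((d4 z).pow 2).const_mul (Θ₂ 0 0 τ ^ 2)).sub
      (((d2 z).pow 2).const_mul (Θ₄ 0 0 τ ^ 2))
    have hd := deriv_unique_of_eq heq hL hR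
    have hz := congrFun heq z
    have hw := wronskian_Θ₂ hτ z
    simp only [zero_add, Nat.cast_ofNat, Nat.add_one_sub_one, pow_one] at hd hz
    refine mul_left_cancel₀ (pow_ne_zero 2 (Θ₂_zero_ne_zero hτ)) ?_
    linear_combination -Θ₁ 0 z τ / 2 * hd + Θ₁ 1 z τ * hz + Θ₄ 0 0 τ ^ 2 * Θ₂ 0 z τ * hw

/-- The combination `η + (π²/12)(ϑ₃⁴ + ϑ₄⁴)` for the Jacobi series. -/
noncomputable def thetaL (τ : ℂ) : ℂ := -(Θ₂ 2 0 τ / Θ₂ 0 0 τ) / 4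

lemma second_order (hτ : 0 < τ.im) (z : ℂ) :
    Θ₁ 2 z τ * Θ₁ 0 z τ - Θ₁ 1 z τ ^ 2
      = -(π ^ 2 * Θ₃ 0 0 τ ^ 2 * Θ₄ 0 0 τ ^ 2) * Θ₂ 0 z τ ^ 2 - 4 * thetaL τ * Θ₁ 0 z τ ^ 2 := by
  rw [second_order_Θ₁ hτ, jacobi_derivative_formula hτ, thetaL]
  have := Θ₂_zero_ne_zero hτ
  field_simp
  ring

/-! ### The theta constants as functions of `τ` -/

lemma Θ₂_two_zero (hτ : 0 < τ.im) : Θ₂ 2 0 τ = -4 * thetaL τ * Θ₂ 0 0 τ := by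
  rw [thetaL]
  have := Θ₂_zero_ne_zero hτ
  field_simp

/-- The second `z`-derivative at `0` of the quadratic relation links `θ₃''(0)` to `θ₂''(0)` and
`θ₁'(0)²`. -/
lemma Θ₃_two_zero (hτ : 0 < τ.im) :
    Θ₃ 2 0 τ = (-4 * thetaL τ + π ^ 2 * Θ₄ 0 0 τ ^ 4) * Θ₃ 0 0 τ := by
  have d1 := fun m z => hasDerivAt_thetaSeries_fst norm_χ₁_le m z hτ
  have d3 := fun m z => hasDerivAt_thetaSeries_fst norm_χ₃_le m z hτ
  have heq : (fun z => Θ₃ 1 z τ * Θ₁ 0 z τ - Θ₁ 1 z τ * Θ₃ 0 z τ) =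
      fun z => -(π * Θ₃ 0 0 τ ^ 2) * (Θ₂ 0 z τ * Θ₄ 0 z τ) := by
    ext z; exact wronskian_Θ₃ hτ z
  have hsq : (fun z => Θ₄ 0 0 τ ^ 2 * (Θ₁ 0 z τ * Θ₁ 0 z τ)) = fun z =>
      Θ₂ 0 0 τ ^ 2 * (Θ₃ 0 z τ * Θ₃ 0 z τ) - Θ₃ 0 0 τ ^ 2 * (Θ₂ 0 z τ * Θ₂ 0 z τ) := by
    ext z; linear_combination Θ₄_sq_mul_Θ₁_sq hτ z
  have d2 := fun m z => hasDerivAt_thetaSeries_fst norm_χ₂_le m z hτ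
  have hsq1 : (fun z => Θ₄ 0 0 τ ^ 2 * (Θ₁ 0 z τ * Θ₁ 1 z τ)) = fun z =>
      Θ₂ 0 0 τ ^ 2 * (Θ₃ 0 z τ * Θ₃ 1 z τ) - Θ₃ 0 0 τ ^ 2 * (Θ₂ 0 z τ * Θ₂ 1 z τ) := by
    ext z
    have hL := ((d1 0 z).mul (d1 0 z)).const_mul (Θ₄ 0 0 τ ^ 2)
    have hR := (((d3 0 z).mul (d3 0 z)).const_mul (Θ₂ 0 0 τ ^ 2)).sub
      (((d2 0 z).mul (d2 0 z)).const_mul (Θ₃ 0 0 τ ^ 2))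
    have := deriv_unique_of_eq hsq hL hR
    simp only [zero_add] at this
    linear_combination this / 2
  have hL := ((d1 0 0).mul (d1 1 0)).const_mul (Θ₄ 0 0 τ ^ 2)
  have hR := (((d3 0 0).mul (d3 1 0)).const_mul (Θ₂ 0 0 τ ^ 2)).sub
      (((d2 0 0).mul (d2 1 0)).const_mul (Θ₃ 0 0 τ ^ 2))
  have h := deriv_unique_of_eq hsq1 hL hR
  simp only [zero_add, Nat.reduceAdd] at h
  rw [thetaSeries_χ₁_zero (m := 0) _ (by decide), thetaSeries_χ₂_zero (m := 1) _ (by decide),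
    thetaSeries_χ₃_zero (m := 1) _ (by decide), jacobi_derivative_formula hτ,
    Θ₂_two_zero hτ] at h
  refine mul_left_cancel₀ (mul_ne_zero (pow_ne_zero 2 (Θ₂_zero_ne_zero hτ))
    (Θ₃_zero_ne_zero hτ)) ?_
  linear_combination -h

lemma Θ₄_two_zero (hτ : 0 < τ.im) :
    Θ₄ 2 0 τ = (-4 * thetaL τ + π ^ 2 * Θ₃ 0 0 τ ^ 4) * Θ₄ 0 0 τ := by
  have d1 := fun m z => hasDerivAt_thetaSeries_fst norm_χ₁_le m z hτ
  have d4 := fun m z => hasDerivAt_thetaSeries_fst norm_χ₄_le m z hτ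
  have d2 := fun m z => hasDerivAt_thetaSeries_fst norm_χ₂_le m z hτ
  have hsq : (fun z => Θ₃ 0 0 τ ^ 2 * (Θ₁ 0 z τ * Θ₁ 0 z τ)) = fun z =>
      Θ₂ 0 0 τ ^ 2 * (Θ₄ 0 z τ * Θ₄ 0 z τ) - Θ₄ 0 0 τ ^ 2 * (Θ₂ 0 z τ * Θ₂ 0 z τ) := by
    ext z; linear_combination Θ₃_sq_mul_Θ₁_sq hτ z
  have hsq1 : (fun z => Θ₃ 0 0 τ ^ 2 * (Θ₁ 0 z τ * Θ₁ 1 z τ)) = fun z =>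
      Θ₂ 0 0 τ ^ 2 * (Θ₄ 0 z τ * Θ₄ 1 z τ) - Θ₄ 0 0 τ ^ 2 * (Θ₂ 0 z τ * Θ₂ 1 z τ) := by
    ext z
    have hL := ((d1 0 z).mul (d1 0 z)).const_mul (Θ₃ 0 0 τ ^ 2)
    have hR := (((d4 0 z).mul (d4 0 z)).const_mul (Θ₂ 0 0 τ ^ 2)).sub
      (((d2 0 z).mul (d2 0 z)).const_mul (Θ₄ 0 0 τ ^ 2))
    have := deriv_unique_of_eq hsq hL hR
    simp only [zero_add] at this
    linear_combination this / 2
  have hL := ((d1 0 0).mul (d1 1 0)).const_mul (Θ₃ 0 0 τ ^ 2)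
  have hR := (((d4 0 0).mul (d4 1 0)).const_mul (Θ₂ 0 0 τ ^ 2)).sub
      (((d2 0 0).mul (d2 1 0)).const_mul (Θ₄ 0 0 τ ^ 2))
  have h := deriv_unique_of_eq hsq1 hL hR
  simp only [zero_add, Nat.reduceAdd] at h
  rw [thetaSeries_χ₁_zero (m := 0) _ (by decide), thetaSeries_χ₂_zero (m := 1) _ (by decide),
    thetaSeries_χ₄_zero (m := 1) _ (by decide), jacobi_derivative_formula hτ,
    Θ₂_two_zero hτ] at h
  refine mul_left_cancel₀ (mul_ne_zero (pow_ne_zero 2 (Θ₂_zero_ne_zero hτ))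
    (Θ₄_zero_ne_zero hτ)) ?_
  linear_combination -h

lemma pi_ne_zero' : (π : ℂ) ≠ 0 := by exact_mod_cast Real.pi_ne_zero

lemma inv_four_pi_I : (1 : ℂ) / (4 * π * I) = -I / (4 * π) := by
  have := pi_ne_zero'
  field_simp
  linear_combination I_sq

lemma hasDerivAt_Θ₂_zero (hτ : 0 < τ.im) :
    HasDerivAt (fun t => Θ₂ 0 0 t) (I / π * thetaL τ * Θ₂ 0 0 τ) τ := by
  refine (hasDerivAt_thetaSeries_snd norm_χ₂_le 0 0 hτ).congr_deriv ?_
  rw [div_eq_mul_one_div, inv_four_pi_I, zero_add, Θ₂_two_zero hτ]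
  have := pi_ne_zero'
  field_simp

lemma hasDerivAt_Θ₃_zero (hτ : 0 < τ.im) :
    HasDerivAt (fun t => Θ₃ 0 0 t)
      (I / π * (thetaL τ - π ^ 2 / 4 * Θ₄ 0 0 τ ^ 4) * Θ₃ 0 0 τ) τ := by
  refine (hasDerivAt_thetaSeries_snd norm_χ₃_le 0 0 hτ).congr_deriv ?_
  rw [div_eq_mul_one_div, inv_four_pi_I, zero_add, Θ₃_two_zero hτ]
  have := pi_ne_zero'
  field_simp
  ring

lemma hasDerivAt_Θ₄_zero (hτ : 0 < τ.im) :
    HasDerivAt (fun t => Θ₄ 0 0 t)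
      (I / π * (thetaL τ - π ^ 2 / 4 * Θ₃ 0 0 τ ^ 4) * Θ₄ 0 0 τ) τ := by
  refine (hasDerivAt_thetaSeries_snd norm_χ₄_le 0 0 hτ).congr_deriv ?_
  rw [div_eq_mul_one_div, inv_four_pi_I, zero_add, Θ₄_two_zero hτ]
  have := pi_ne_zero'
  field_simp
  ring

/-- The fourth derivative is what the `τ`-derivative of `θ₂''(0)` needs. It comes from
differentiating `second_order_Θ₂` twice at `0`. -/
lemma Θ₂_four_zero (hτ : 0 < τ.im) : Θ₂ 4 0 τ
    = (48 * thetaL τ ^ 2 - 2 * π ^ 4 * Θ₃ 0 0 τ ^ 4 * Θ₄ 0 0 τ ^ 4) * Θ₂ 0 0 τ := by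
  have d1 := fun m z => hasDerivAt_thetaSeries_fst norm_χ₁_le m z hτ
  have d2 := fun m z => hasDerivAt_thetaSeries_fst norm_χ₂_le m z hτ
  set p := -(Θ₁ 1 0 τ / Θ₂ 0 0 τ) ^ 2 with hp
  set q := Θ₂ 2 0 τ / Θ₂ 0 0 τ with hq
  have h0 : (fun z => Θ₂ 2 z τ * Θ₂ 0 z τ - Θ₂ 1 z τ * Θ₂ 1 z τ)
      = fun z => p * (Θ₁ 0 z τ * Θ₁ 0 z τ) + q * (Θ₂ 0 z τ * Θ₂ 0 z τ) := by
    ext z; linear_combination second_order_Θ₂ hτ z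
  have h1 : (fun z => Θ₂ 3 z τ * Θ₂ 0 z τ - Θ₂ 1 z τ * Θ₂ 2 z τ)
      = fun z => p * (2 * (Θ₁ 0 z τ * Θ₁ 1 z τ)) + q * (2 * (Θ₂ 0 z τ * Θ₂ 1 z τ)) := by
    ext z
    have hL := ((d2 2 z).mul (d2 0 z)).sub ((d2 1 z).mul (d2 1 z))
    have hR := (((d1 0 z).mul (d1 0 z)).const_mul p).add (((d2 0 z).mul (d2 0 z)).const_mul q)
    have := deriv_unique_of_eq h0 hL hR
    simp only [zero_add, Nat.reduceAdd] at this
    linear_combination this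
  have hL := ((d2 3 0).mul (d2 0 0)).sub ((d2 1 0).mul (d2 2 0))
  have hR := ((((d1 0 0).mul (d1 1 0)).const_mul 2).const_mul p).add
    ((((d2 0 0).mul (d2 1 0)).const_mul 2).const_mul q)
  have h := deriv_unique_of_eq h1 hL hR
  simp only [zero_add, Nat.reduceAdd] at h
  have hne := Θ₂_zero_ne_zero hτ
  have hp' : p = -(π ^ 2 * Θ₃ 0 0 τ ^ 2 * Θ₄ 0 0 τ ^ 2) := by
    rw [hp, jacobi_derivative_formula hτ]
    field_simp
  have hq' : q = -4 * thetaL τ := by rw [hq, thetaL]; ring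
  rw [thetaSeries_χ₁_zero (m := 0) _ (by decide), thetaSeries_χ₂_zero (m := 1) _ (by decide),
    hp', hq', jacobi_derivative_formula hτ, Θ₂_two_zero hτ] at h
  refine mul_left_cancel₀ hne ?_
  linear_combination h

lemma hasDerivAt_thetaL (hτ : 0 < τ.im) :
    HasDerivAt thetaL
      (2 * I / π * thetaL τ ^ 2 - I * π ^ 3 / 8 * (Θ₃ 0 0 τ ^ 4 * Θ₄ 0 0 τ ^ 4)) τ := by
  have hne := Θ₂_zero_ne_zero hτ
  have h := (((hasDerivAt_thetaSeries_snd norm_χ₂_le 2 0 hτ).div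
    (hasDerivAt_Θ₂_zero hτ) hne).neg).div_const 4
  refine h.congr_deriv ?_
  rw [div_eq_mul_one_div _ (4 * π * I), inv_four_pi_I]
  simp only [Nat.reduceAdd]
  rw [Θ₂_four_zero hτ, Θ₂_two_zero hτ]
  have := pi_ne_zero'
  field_simp
  ring

/-! ### Translations and the inversion -/

lemma cexp_sq_mul_pi_I (k : ℤ) : cexp ((k : ℂ) ^ 2 * π * I) = (-1) ^ k := by
  have h : ((k : ℂ) ^ 2 * π * I) = ((k * k : ℤ) : ℂ) * (π * I) := by push_cast; ring
  rw [h, Complex.exp_int_mul, Complex.exp_pi_mul_I, zpow_mul]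
  rcases Int.even_or_odd k with hk | hk
  · rw [hk.neg_one_zpow, one_zpow]
  · rw [hk.neg_one_zpow, hk.neg_one_zpow]

lemma cexp_sq_add_mul_pi_I (k : ℤ) : cexp (((k : ℂ) ^ 2 + k) * π * I) = 1 := by
  have h : (((k : ℂ) ^ 2 + k) * π * I) = (k : ℂ) ^ 2 * π * I + k * (π * I) := by ring
  rw [h, Complex.exp_add, cexp_sq_mul_pi_I, Complex.exp_int_mul, Complex.exp_pi_mul_I,
    neg_one_zpow_mul_self]

lemma jθ₃_add_one (z τ : ℂ) : jθ₃ z (τ + 1) = jθ₄ z τ := by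
  rw [jθ₃, jθ₄]
  refine tsum_congr fun k => ?_
  rw [show (k : ℂ) ^ 2 * π * I * (τ + 1) = k ^ 2 * π * I + k ^ 2 * π * I * τ by ring,
    Complex.exp_add, cexp_sq_mul_pi_I]

lemma jθ₄_add_one (z τ : ℂ) : jθ₄ z (τ + 1) = jθ₃ z τ := by
  rw [jθ₃, jθ₄]
  refine tsum_congr fun k => ?_
  rw [show (k : ℂ) ^ 2 * π * I * (τ + 1) = k ^ 2 * π * I + k ^ 2 * π * I * τ by ring,
    Complex.exp_add, cexp_sq_mul_pi_I, ← mul_assoc, neg_one_zpow_mul_self, one_mul]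

lemma jθ₂_add_one (z τ : ℂ) : jθ₂ z (τ + 1) = cexp (π * I / 4) * jθ₂ z τ := by
  rw [jθ₂, jθ₂, ← mul_assoc, ← Complex.exp_add]
  congr 1
  · congr 1; ring
  refine tsum_congr fun k => ?_
  rw [show ((k : ℂ) ^ 2 + k) * π * I * (τ + 1)
    = (k ^ 2 + k) * π * I + (k ^ 2 + k) * π * I * τ by ring,
    Complex.exp_add, cexp_sq_add_mul_pi_I, one_mul]

lemma jθ₁_add_one (z τ : ℂ) : jθ₁ z (τ + 1) = cexp (π * I / 4) * jθ₁ z τ := by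
  have h : ∀ t, jθ₁ z t = -jθ₂ (z + 1 / 2) t := fun t => by
    rw [jθ₁_eq, jθ₂_eq, thetaSeries_χ₂_add_half, neg_neg]
  rw [h, h, jθ₂_add_one]; ring

lemma jθ₄_eq_jacobiTheta₂ (z τ : ℂ) : jθ₄ z τ = jacobiTheta₂ (z + 1 / 2) τ := by
  rw [← jθ₃_eq_jacobiTheta₂, jθ₃_eq, jθ₄_eq, thetaSeries_χ₃_add_half]

lemma jθ₁_eq_neg_jθ₂ (z τ : ℂ) : jθ₁ z τ = -jθ₂ (z + 1 / 2) τ := by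
  rw [jθ₁_eq, jθ₂_eq, thetaSeries_χ₂_add_half, neg_neg]

lemma jθ₁_neg (z τ : ℂ) : jθ₁ (-z) τ = -jθ₁ z τ := by
  rw [jθ₁_eq, jθ₁_eq, thetaSeries_χ₁_neg]; simp
lemma jθ₂_neg (z τ : ℂ) : jθ₂ (-z) τ = jθ₂ z τ := by
  rw [jθ₂_eq, jθ₂_eq, thetaSeries_χ₂_neg]; simp
lemma jθ₃_neg (z τ : ℂ) : jθ₃ (-z) τ = jθ₃ z τ := by
  rw [jθ₃_eq, jθ₃_eq, thetaSeries_χ₃_neg]; simp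
lemma jθ₄_neg (z τ : ℂ) : jθ₄ (-z) τ = jθ₄ z τ := by
  rw [jθ₄_eq, jθ₄_eq, thetaSeries_χ₄_neg]; simp

/-- The factor in the inversion formulas. -/
noncomputable def inversionFactor (z τ : ℂ) : ℂ :=
  1 / (-I * τ) ^ (1 / 2 : ℂ) * cexp (-π * I * z ^ 2 / τ)

variable {τ : ℂ}

lemma ne_zero_of_im_pos (hτ : 0 < τ.im) : τ ≠ 0 := by
  rintro rfl; simp at hτ

lemma jθ₃_inversion (z τ : ℂ) : jθ₃ z τ = inversionFactor z τ * jθ₃ (z / τ) (-1 / τ) := by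
  rw [jθ₃_eq_jacobiTheta₂, jθ₃_eq_jacobiTheta₂, jacobiTheta₂_functional_equation, inversionFactor]

lemma jθ₂_inversion (hτ : 0 < τ.im) (z : ℂ) :
    jθ₂ z τ = inversionFactor z τ * jθ₄ (z / τ) (-1 / τ) := by
  have h0 := ne_zero_of_im_pos hτ
  rw [jθ₂_eq_jacobiTheta₂, jθ₄_eq_jacobiTheta₂, jacobiTheta₂_functional_equation, inversionFactor,
    show (z + τ / 2) / τ = z / τ + 1 / 2 by field_simp]
  have : cexp (π * I * τ / 4 + π * I * z) * cexp (-π * I * (z + τ / 2) ^ 2 / τ)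
      = cexp (-π * I * z ^ 2 / τ) := by
    rw [← Complex.exp_add]
    congr 1
    field_simp
    ring
  rw [← this]; ring

lemma jθ₄_inversion (hτ : 0 < τ.im) (z : ℂ) :
    jθ₄ z τ = inversionFactor z τ * jθ₂ (z / τ) (-1 / τ) := by
  have h0 := ne_zero_of_im_pos hτ
  rw [← jθ₂_neg, jθ₂_eq_jacobiTheta₂, jθ₄_eq_jacobiTheta₂, jacobiTheta₂_functional_equation,
    inversionFactor, ← jacobiTheta₂_neg_left,
    show -((z + 1 / 2) / τ) = -(z / τ) + -1 / τ / 2 by field_simp; ring]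
  have : cexp (-π * I * (z + 1 / 2) ^ 2 / τ)
      = cexp (-π * I * z ^ 2 / τ) * cexp (π * I * (-1 / τ) / 4 + π * I * -(z / τ)) := by
    rw [← Complex.exp_add]
    congr 1
    field_simp
    ring
  rw [this]; ring

/-- In contrast to the other three series a factor `I` appears: it is the effect of the shift by
`1/2` on the exponential that relates `θ₂` to `θ₃`. -/
lemma jθ₁_inversion (hτ : 0 < τ.im) (z : ℂ) :
    jθ₁ z τ = I * inversionFactor z τ * jθ₁ (z / τ) (-1 / τ) := by
  have h0 := ne_zero_of_im_pos hτ
  have h1 : jθ₁ (z / τ) (-1 / τ) = -jθ₁ (-(z / τ)) (-1 / τ) := by rw [jθ₁_neg, neg_neg]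
  rw [h1, jθ₁_eq_neg_jθ₂, jθ₁_eq_neg_jθ₂ (-(z / τ)), jθ₂_eq_jacobiTheta₂, jθ₂_eq_jacobiTheta₂,
    jacobiTheta₂_functional_equation, inversionFactor, ← jacobiTheta₂_neg_left,
    ← jacobiTheta₂_add_left,
    show -((z + 1 / 2 + τ / 2) / τ) + 1 = -(z / τ) + 1 / 2 + -1 / τ / 2 by
      field_simp; ring]
  have e1 : cexp (π * I * τ / 4 + π * I * (z + 1 / 2)) * cexp (-π * I * (z + 1 / 2 + τ / 2) ^ 2 / τ)
      = cexp (-π * I * z ^ 2 / τ + (π * I * (-1 / τ) / 4 + π * I * -(z / τ))) := by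
    rw [← Complex.exp_add]
    congr 1
    field_simp
    ring
  have e2 : cexp (π * I * (-1 / τ) / 4 + π * I * (-(z / τ) + 1 / 2))
      = I * cexp (π * I * (-1 / τ) / 4 + π * I * -(z / τ)) := by
    rw [show π * I * (-1 / τ) / 4 + π * I * (-(z / τ) + 1 / 2)
      = π / 2 * I + (π * I * (-1 / τ) / 4 + π * I * -(z / τ)) by ring, Complex.exp_add,
      Complex.exp_pi_div_two_mul_I]
  rw [e2]
  rw [Complex.exp_add (-π * I * z ^ 2 / τ)] at e1
  set J := jacobiTheta₂ (-(z / τ) + 1 / 2 + -1 / τ / 2) (-1 / τ)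
  linear_combination -(1 / (-I * τ) ^ (1 / 2 : ℂ)) * J * e1
    - (1 / (-I * τ) ^ (1 / 2 : ℂ)) * J * cexp (-π * I * z ^ 2 / τ)
      * cexp (π * I * (-1 / τ) / 4 + π * I * -(z / τ)) * I_sq

/-! ### The element `τ ↦ τ/(2τ+1)` of `Γ(2)` -/

lemma im_neg_one_div_pos (hτ : 0 < τ.im) : 0 < (-1 / τ).im := by
  have : -1 / τ = -τ⁻¹ := by ring
  rw [this, neg_im, inv_im, neg_div, neg_neg]
  exact div_pos hτ (Complex.normSq_pos.mpr (ne_zero_of_im_pos hτ))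

lemma im_two_mul_add_one_pos (hτ : 0 < τ.im) : 0 < (2 * τ + 1).im := by simpa using hτ

lemma two_mul_add_one_ne_zero (hτ : 0 < τ.im) : 2 * τ + 1 ≠ 0 :=
  ne_zero_of_im_pos (im_two_mul_add_one_pos hτ)

lemma im_moeb_two_one_pos (hτ : 0 < τ.im) : 0 < (τ / (2 * τ + 1)).im := by
  have h0 := ne_zero_of_im_pos hτ
  have h2 := two_mul_add_one_ne_zero hτ
  have h1 : 0 < (-1 / τ - 2).im := by simpa using im_neg_one_div_pos hτ
  have h3 : τ / (2 * τ + 1) = -1 / (-1 / τ - 2) := by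
    have : -1 / τ - 2 ≠ 0 := ne_zero_of_im_pos h1
    rw [eq_div_iff this, div_mul_eq_mul_div, div_eq_iff h2]
    field_simp
    ring
  rw [h3]
  exact im_neg_one_div_pos h1

lemma cpow_half_sq {w : ℂ} : (w ^ (1 / 2 : ℂ)) ^ 2 = w := by
  rw [← Complex.cpow_nat_mul]
  norm_num

lemma cpow_half_ne_zero {w : ℂ} (hw : w ≠ 0) : w ^ (1 / 2 : ℂ) ≠ 0 := by
  intro h
  apply hw
  rw [← cpow_half_sq (w := w), h]
  simp

/-- Both factors on the left have bases with positive real part, so their arguments add up to less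
than `π` in absolute value and the principal roots multiply without a sign. -/
lemma cpow_half_mul (hτ : 0 < τ.im) :
    (-I * τ) ^ (1 / 2 : ℂ) * (-I * (-1 / τ - 2)) ^ (1 / 2 : ℂ) = (2 * τ + 1) ^ (1 / 2 : ℂ) := by
  have h0 := ne_zero_of_im_pos hτ
  have h1 : 0 < (-1 / τ - 2).im := by simpa using im_neg_one_div_pos hτ
  have re1 : 0 < (-I * τ).re := by simpa using hτ
  have re2 : 0 < (-I * (-1 / τ - 2)).re := by
    have e : (-I * (-1 / τ - 2)).re = (-1 / τ - 2).im := by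
      generalize -1 / τ - 2 = w
      simp
    rw [e]; exact h1
  have a1 := Complex.abs_arg_lt_pi_div_two_iff.mpr (Or.inl re1)
  have a2 := Complex.abs_arg_lt_pi_div_two_iff.mpr (Or.inl re2)
  rw [abs_lt] at a1 a2
  have hn1 : -I * τ ≠ 0 := fun h => by rw [h] at re1; simp at re1
  have hn2 : -I * (-1 / τ - 2) ≠ 0 := fun h => by rw [h] at re2; simp at re2
  have hprod : -I * τ * (-I * (-1 / τ - 2)) = 2 * τ + 1 := by
    field_simp
    linear_combination (-(1 + 2 * τ)) * I_sq
  have hlog := (Complex.log_mul_eq_add_log_iff hn1 hn2).mpr (by constructor <;> linarith)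
  rw [← hprod, Complex.cpow_def_of_ne_zero hn1, Complex.cpow_def_of_ne_zero hn2,
    Complex.cpow_def_of_ne_zero (mul_ne_zero hn1 hn2), hlog, add_mul, Complex.exp_add]

lemma inversionFactor_mul (hτ : 0 < τ.im) (z : ℂ) :
    inversionFactor z τ * inversionFactor (z / τ) (-1 / τ - 2)
      = 1 / (2 * τ + 1) ^ (1 / 2 : ℂ) * cexp (-(2 * π * I * z ^ 2 / (2 * τ + 1))) := by
  have h0 := ne_zero_of_im_pos hτ
  have h2 := two_mul_add_one_ne_zero hτ
  have h1 : -1 / τ - 2 ≠ 0 := ne_zero_of_im_pos (τ := -1 / τ - 2) (by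
    simpa using im_neg_one_div_pos hτ)
  rw [inversionFactor, inversionFactor, ← cpow_half_mul hτ]
  have : cexp (-(2 * π * I * z ^ 2 / (2 * τ + 1)))
      = cexp (-π * I * z ^ 2 / τ) * cexp (-π * I * (z / τ) ^ 2 / (-1 / τ - 2)) := by
    rw [← Complex.exp_add]
    congr 1
    have e : -1 / τ - 2 = -(2 * τ + 1) / τ := by field_simp; ring
    rw [e]
    field_simp
    ring
  have hmul : ∀ a b x y : ℂ, 1 / a * x * (1 / b * y) = 1 / (a * b) * (x * y) := fun a b x y => by
    rw [one_div, one_div, one_div, mul_inv]; ring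
  rw [this, hmul]

lemma div_div_inversion (hτ : 0 < τ.im) (z : ℂ) :
    z / τ / (-1 / τ - 2) = -(z / (2 * τ + 1)) := by
  have h0 := ne_zero_of_im_pos hτ
  have h2 := two_mul_add_one_ne_zero hτ
  have e : -1 / τ - 2 = -(2 * τ + 1) / τ := by field_simp; ring
  rw [e]
  field_simp

lemma neg_one_div_inversion (hτ : 0 < τ.im) : -1 / (-1 / τ - 2) = τ / (2 * τ + 1) := by
  have h0 := ne_zero_of_im_pos hτ
  have h2 := two_mul_add_one_ne_zero hτ
  have e : -1 / τ - 2 = -(2 * τ + 1) / τ := by field_simp; ring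
  rw [e]
  field_simp

lemma cexp_pi_I_div_four_mul_self : cexp (π * I / 4) * cexp (π * I / 4) = I := by
  rw [← Complex.exp_add, show π * I / 4 + π * I / 4 = π / 2 * I by ring,
    Complex.exp_pi_div_two_mul_I]

/-- The map `τ ↦ τ/(2τ+1)` is inversion, translation by `-2`, inversion. On `θ₃` and `θ₂` this
produces no extra constant, because the translation acts on `θ₃` or `θ₄`, which have period `2` in
`τ`. -/
lemma jθ₃_gamma2 (hτ : 0 < τ.im) (z : ℂ) :
    jθ₃ z τ = 1 / (2 * τ + 1) ^ (1 / 2 : ℂ)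
      * cexp (-(2 * π * I * z ^ 2 / (2 * τ + 1))) * jθ₃ (z / (2 * τ + 1)) (τ / (2 * τ + 1)) := by
  have hT : jθ₃ (z / τ) (-1 / τ) = jθ₃ (z / τ) (-1 / τ - 2) := by
    conv_lhs => rw [show -1 / τ = -1 / τ - 2 + 1 + 1 by ring]
    rw [jθ₃_add_one, jθ₄_add_one]
  rw [jθ₃_inversion, hT, jθ₃_inversion (z / τ), div_div_inversion hτ, neg_one_div_inversion hτ,
    jθ₃_neg, ← mul_assoc, inversionFactor_mul hτ]

lemma jθ₂_gamma2 (hτ : 0 < τ.im) (z : ℂ) :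
    jθ₂ z τ = 1 / (2 * τ + 1) ^ (1 / 2 : ℂ)
      * cexp (-(2 * π * I * z ^ 2 / (2 * τ + 1))) * jθ₂ (z / (2 * τ + 1)) (τ / (2 * τ + 1)) := by
  have hT : jθ₄ (z / τ) (-1 / τ) = jθ₄ (z / τ) (-1 / τ - 2) := by
    conv_lhs => rw [show -1 / τ = -1 / τ - 2 + 1 + 1 by ring]
    rw [jθ₄_add_one, jθ₃_add_one]
  have h1 : 0 < (-1 / τ - 2).im := by simpa using im_neg_one_div_pos hτ
  rw [jθ₂_inversion hτ, hT, jθ₄_inversion h1, div_div_inversion hτ, neg_one_div_inversion hτ,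
    jθ₂_neg, ← mul_assoc, inversionFactor_mul hτ]

/-- Inversion turns `θ₄` into `θ₂`, on which translation by `2` acts as `(e^{πi/4})² = I`. -/
lemma jθ₄_gamma2 (hτ : 0 < τ.im) (z : ℂ) :
    jθ₄ z τ = I * (1 / (2 * τ + 1) ^ (1 / 2 : ℂ)
      * cexp (-(2 * π * I * z ^ 2 / (2 * τ + 1))) * jθ₄ (z / (2 * τ + 1)) (τ / (2 * τ + 1))) := by
  have hT : jθ₂ (z / τ) (-1 / τ) = I * jθ₂ (z / τ) (-1 / τ - 2) := by
    conv_lhs => rw [show -1 / τ = -1 / τ - 2 + 1 + 1 by ring]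
    rw [jθ₂_add_one, jθ₂_add_one, ← mul_assoc, cexp_pi_I_div_four_mul_self]
  have h1 : 0 < (-1 / τ - 2).im := by simpa using im_neg_one_div_pos hτ
  rw [jθ₄_inversion hτ, hT, jθ₂_inversion h1, div_div_inversion hτ, neg_one_div_inversion hτ,
    jθ₄_neg, ← inversionFactor_mul hτ]
  ring

/-- Each of the two inversions and the translation contributes `I`, and the sign of the argument
contributes `-1`, since `θ₁` is odd; the product is `I`. -/
lemma jθ₁_gamma2 (hτ : 0 < τ.im) (z : ℂ) :
    jθ₁ z τ = I * (1 / (2 * τ + 1) ^ (1 / 2 : ℂ)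
      * cexp (-(2 * π * I * z ^ 2 / (2 * τ + 1))) * jθ₁ (z / (2 * τ + 1)) (τ / (2 * τ + 1))) := by
  have hT : jθ₁ (z / τ) (-1 / τ) = I * jθ₁ (z / τ) (-1 / τ - 2) := by
    conv_lhs => rw [show -1 / τ = -1 / τ - 2 + 1 + 1 by ring]
    rw [jθ₁_add_one, jθ₁_add_one, ← mul_assoc, cexp_pi_I_div_four_mul_self]
  have h1 : 0 < (-1 / τ - 2).im := by simpa using im_neg_one_div_pos hτ
  rw [jθ₁_inversion hτ, hT, jθ₁_inversion h1, div_div_inversion hτ, neg_one_div_inversion hτ,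
    jθ₁_neg, ← inversionFactor_mul hτ]
  linear_combination -I * inversionFactor z τ * inversionFactor (z / τ) (-1 / τ - 2)
    * jθ₁ (z / (2 * τ + 1)) (τ / (2 * τ + 1)) * I_sq

/-! ### The series `η` and the theta constants -/

/-- The eighth power of the product of the theta constants. -/
noncomputable def thetaProd (τ : ℂ) : ℂ := (Θ₂ 0 0 τ * Θ₃ 0 0 τ * Θ₄ 0 0 τ) ^ 8

lemma thetaProd_eq (τ : ℂ) : thetaProd τ = (jθ₂ 0 τ * jθ₃ 0 τ * jθ₄ 0 τ) ^ 8 := by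
  rw [thetaProd, jθ₂_eq, jθ₃_eq, jθ₄_eq]

lemma thetaProd_add_one (τ : ℂ) : thetaProd (τ + 1) = thetaProd τ := by
  rw [thetaProd_eq, thetaProd_eq, jθ₂_add_one, jθ₃_add_one, jθ₄_add_one]
  have : cexp (π * I / 4) ^ 8 = 1 := by
    rw [← Complex.exp_nat_mul, ← Complex.exp_two_pi_mul_I]
    congr 1
    push_cast
    ring
  linear_combination (jθ₂ 0 τ * jθ₄ 0 τ * jθ₃ 0 τ) ^ 8 * this

lemma thetaProd_inversion (hτ : 0 < τ.im) : thetaProd (-1 / τ) = τ ^ 12 * thetaProd τ := by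
  have h0 := ne_zero_of_im_pos hτ
  have e2 := jθ₂_inversion hτ 0
  have e3 := jθ₃_inversion 0 τ
  have e4 := jθ₄_inversion hτ 0
  rw [zero_div] at e2 e3 e4
  rw [thetaProd_eq, thetaProd_eq τ, e2, e3, e4]
  have hne : (-I * τ) ≠ 0 := mul_ne_zero (neg_ne_zero.mpr I_ne_zero) h0
  have hs := cpow_half_ne_zero hne
  have h2 := cpow_half_sq (w := -I * τ)
  have h24 : ((-I * τ) ^ (1 / 2 : ℂ)) ^ 24 = τ ^ 12 := by
    rw [show 24 = 2 * 12 by norm_num, pow_mul, h2, mul_pow]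
    have : (-I) ^ 12 = 1 := by
      rw [show 12 = 4 * 3 by norm_num, pow_mul, neg_pow, I_pow_four]; norm_num
    rw [this, one_mul]
  have hf : inversionFactor 0 τ = ((-I * τ) ^ (1 / 2 : ℂ))⁻¹ := by
    simp [inversionFactor]
  rw [hf, ← h24]
  field_simp

lemma differentiableAt_thetaProd (hτ : 0 < τ.im) : DifferentiableAt ℂ thetaProd τ :=
  (((hasDerivAt_Θ₂_zero hτ).differentiableAt.mul (hasDerivAt_Θ₃_zero hτ).differentiableAt).mul
    (hasDerivAt_Θ₄_zero hτ).differentiableAt).pow 8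

lemma tendsto_thetaProd : Tendsto thetaProd (comap im atTop) (𝓝 0) := by
  have l2 := tendsto_exp_mul_thetaSeries norm_χ₂_le (by simp [χ₂]) 0
  have l3 := tendsto_thetaSeries_zero norm_χ₃_le
  have l4 := tendsto_thetaSeries_zero norm_χ₄_le
  have hc : (0 : ℝ) < π / 4 := by positivity
  have le := tendsto_cexp_mul_I_zero hc
  have l := (((le.mul l2).mul l3).mul l4).pow 8
  rw [zero_mul, zero_mul, zero_mul, zero_pow (by norm_num)] at l
  refine l.congr fun t => ?_
  rw [← mul_assoc, ← Complex.exp_add,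
    show (((π / 4 : ℝ) : ℂ) * I * t + -(π * I * t / 4)) = 0 by push_cast; ring, Complex.exp_zero,
    one_mul, thetaProd]

/-! ### `(ϑ₂ϑ₃ϑ₄)⁸` as a cusp form of weight 12, and `E₂`. -/

section ModularForms

open UpperHalfPlane hiding I
open MatrixGroups ModularForm ModularGroup SlashInvariantForm

lemma thetaProd_slash_T :
    ((fun z : ℍ => thetaProd z) ∣[(12 : ℤ)] ModularGroup.T) = fun z : ℍ => thetaProd z := by
  ext z
  have hd : denom (ModularGroup.T : GL (Fin 2) ℝ) z = 1 := by
    rw [ModularGroup.denom_apply]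
    simp [ModularGroup.coe_T]
  rw [SL_slash_apply, modular_T_smul, hd]
  simp [add_comm (1 : ℂ), thetaProd_add_one]

lemma thetaProd_slash_S :
    ((fun z : ℍ => thetaProd z) ∣[(12 : ℤ)] ModularGroup.S) = fun z : ℍ => thetaProd z := by
  ext z
  have hz : (z : ℂ) ≠ 0 := UpperHalfPlane.ne_zero z
  rw [SlashInvariantForm.slash_S_apply]
  have h := thetaProd_inversion z.2
  rw [show (-1 / (z : ℂ)) = (-(z : ℂ))⁻¹ by rw [inv_neg]; ring] at h
  change thetaProd (-(z : ℂ))⁻¹ * _ = thetaProd z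
  rw [h, zpow_neg]
  norm_cast
  field_simp

/-- The eighth power of the product of the theta constants as a cusp form of weight 12. -/
noncomputable def thetaProdCuspForm : CuspForm 𝒮ℒ 12 where
  toFun z := thetaProd z
  slash_action_eq' A hA := by
    obtain ⟨A, rfl⟩ := hA
    exact slash_action_generators_SL2Z thetaProd_slash_S thetaProd_slash_T A
  holo' := by
    rw [UpperHalfPlane.mdifferentiable_iff]
    refine .congr (fun z hz => (differentiableAt_thetaProd hz).differentiableWithinAt)
      fun z hz => ?_
    simp [ofComplex_apply_of_im_pos hz]
  zero_at_cusps' hc := by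
    rw [Subgroup.IsArithmetic.isCusp_iff_isCusp_SL2Z] at hc
    rw [OnePoint.isZeroAt_iff_forall_SL2Z hc]
    intro γ _
    rw [slash_action_generators_SL2Z thetaProd_slash_S thetaProd_slash_T]
    exact tendsto_thetaProd.comp tendsto_coe_atImInfty

/-- Cusp forms of weight 12 are the multiples of the discriminant. The constant need not be known,
since only logarithmic derivatives are used. -/
lemma exists_thetaProd_eq_eta : ∃ c : ℂ, ∀ t : ℂ, 0 < t.im →
    thetaProd t = c * ModularForm.eta t ^ 24 := by
  obtain ⟨c, hc⟩ := CuspForm.exists_smul_discriminant_of_weight_eq_twelve thetaProdCuspForm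
  refine ⟨c, fun t ht => ?_⟩
  have := DFunLike.congr_fun hc (⟨t, ht⟩ : ℍ)
  exact this.symm

/-- Logarithmic derivatives of both sides of `exists_thetaProd_eq_eta`: the theta constants
contribute `8(i/π)(3L - (π²/4)(ϑ₃⁴ + ϑ₄⁴))`, the eta function `24 · (πi/12)E₂`. -/
lemma thetaL_sub_eq_E2 (z : ℍ) : thetaL z - π ^ 2 / 12 * (Θ₃ 0 0 z ^ 4 + Θ₄ 0 0 z ^ 4)
    = π ^ 2 / 12 * EisensteinSeries.E2 z := by
  obtain ⟨c, hc⟩ := exists_thetaProd_eq_eta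
  have hz : 0 < (z : ℂ).im := z.2
  have hη : ModularForm.eta z ≠ 0 := ModularForm.eta_ne_zero hz
  have hηd := (ModularForm.differentiableAt_eta_of_mem_upperHalfPlaneSet hz).hasDerivAt
  have hlog := ModularForm.logDeriv_eta_eq_E2 z
  rw [logDeriv_apply, div_eq_iff hη] at hlog
  rw [hlog] at hηd
  have hR := (hηd.pow 24).const_mul c
  have hL := (((hasDerivAt_Θ₂_zero hz).mul (hasDerivAt_Θ₃_zero hz)).mul
    (hasDerivAt_Θ₄_zero hz)).pow 8
  have hev : thetaProd =ᶠ[𝓝 (z : ℂ)] fun t => c * ModularForm.eta t ^ 24 := by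
    filter_upwards [isOpen_im_pos.mem_nhds hz] with t ht using hc t ht
  have hu := HasDerivAt.unique (f := thetaProd) hL (hR.congr_of_eventuallyEq hev)
  have h2 := Θ₂_zero_ne_zero hz
  have h3 := Θ₃_zero_ne_zero hz
  have h4 := Θ₄_zero_ne_zero hz
  have hval := hc z hz
  rw [thetaProd] at hval
  set A := Θ₂ 0 0 (z : ℂ)
  set B := Θ₃ 0 0 (z : ℂ)
  set D := Θ₄ 0 0 (z : ℂ)
  simp only [Pi.mul_apply, Nat.add_one_sub_one, Nat.cast_ofNat] at hu
  have hpi := pi_ne_zero'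
  have hne : (A * B * D) ^ 8 ≠ 0 := pow_ne_zero 8 (mul_ne_zero (mul_ne_zero h2 h3) h4)
  have key : (A * B * D) ^ 8 * (8 * (I / π) * (3 * thetaL z - π ^ 2 / 4 * (B ^ 4 + D ^ 4)))
      = (A * B * D) ^ 8 * (2 * π * I * EisensteinSeries.E2 z) := by
    linear_combination hu + (-(2 * π * I * EisensteinSeries.E2 z)) * hval
  have key2 := mul_left_cancel₀ hne key
  field_simp at key2
  linear_combination key2 / 96

/-- The divisor sum in `E₂` is the double series `∑_d ∑_c c q^{dc}`, whose inner sum is `q^d/(1 -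
q^d)²`. -/
lemma wη_eq_E2 (z : ℍ) : wη z = π ^ 2 / 12 * EisensteinSeries.E2 z := by
  have hq : ‖cexp (2 * π * I * z)‖ < 1 := norm_exp_two_pi_I_lt_one z
  set q := cexp (2 * π * I * z) with hqdef
  have hE := EisensteinSeries.E2_eq_tsum_cexp z
  rw [← hqdef, ← tsum_prod_pow_eq_tsum_sigma 1 hq] at hE
  have hinner : ∀ d : ℕ+, ∑' c : ℕ+, (c : ℂ) ^ 1 * q ^ (d * c : ℕ)
      = q ^ (d : ℕ) / (1 - q ^ (d : ℕ)) ^ 2 := by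
    intro d
    have hd : ‖q ^ (d : ℕ)‖ < 1 := by
      rw [norm_pow]
      exact pow_lt_one₀ (norm_nonneg _) hq d.ne_zero
    have hs := hasSum_coe_mul_geometric_of_norm_lt_one hd
    rw [← hs.tsum_eq, ← tsum_zero_pnat_eq_tsum_nat hs.summable]
    simp [pow_mul]
  rw [tsum_congr hinner,
    tsum_pnat_eq_tsum_succ (f := fun d => q ^ d / (1 - q ^ d) ^ 2)] at hE
  rw [hE, wη]
  have hterm : ∀ k : ℕ, cexp (2 * (k + 1) * π * I * z) = q ^ (k + 1) := by
    intro k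
    rw [hqdef, ← Complex.exp_nat_mul]
    congr 1
    push_cast
    ring
  simp only [hterm]
  ring

end ModularForms

lemma wη_eq (hτ : 0 < τ.im) : wη τ = thetaL τ - π ^ 2 / 12 * (Θ₃ 0 0 τ ^ 4 + Θ₄ 0 0 τ ^ 4) := by
  have h1 := wη_eq_E2 ⟨τ, hτ⟩
  have h2 := thetaL_sub_eq_E2 ⟨τ, hτ⟩
  exact h1.trans h2.symm

/-- Transformation of `η` under `τ ↦ τ/(2τ+1)`, in terms of `thetaL`. -/
lemma thetaL_gamma2 (hτ : 0 < τ.im) :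
    thetaL (τ / (2 * τ + 1)) = (2 * τ + 1) ^ 2 * thetaL τ - π * I * (2 * τ + 1) := by
  have h2 := two_mul_add_one_ne_zero hτ
  have hT := im_moeb_two_one_pos hτ
  -- Squaring removes the square root, so that both sides can be differentiated in `τ` without
  -- reference to a branch.
  have hsq : ∀ t : ℂ, 0 < t.im →
      Θ₂ 0 0 t ^ 2 * (2 * t + 1) = Θ₂ 0 0 (t / (2 * t + 1)) ^ 2 := by
    intro t ht
    have h := jθ₂_gamma2 ht 0
    have hne := cpow_half_ne_zero (two_mul_add_one_ne_zero ht)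
    have hs := cpow_half_sq (w := 2 * t + 1)
    simp only [jθ₂_eq, zero_div] at h
    rw [h, ← hs]
    simp
    field_simp
    rw [hs]
  have hd : HasDerivAt (fun t : ℂ => t / (2 * t + 1)) (1 / (2 * τ + 1) ^ 2) τ := by
    have := (hasDerivAt_id τ).div (((hasDerivAt_id τ).const_mul 2).add_const 1) h2
    refine HasDerivAt.congr_deriv (f := fun t : ℂ => t / (2 * t + 1)) this ?_
    have e : (1 * (2 * id τ + 1) - id τ * (2 * 1)) = (1 : ℂ) := by simp only [id]; ring
    rw [e]
    rfl
  have hL := ((hasDerivAt_Θ₂_zero hτ).pow 2).mul (((hasDerivAt_id τ).const_mul 2).add_const 1)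
  have hR := ((hasDerivAt_Θ₂_zero hT).comp τ hd).pow 2
  have hev : (fun t : ℂ => Θ₂ 0 0 t ^ 2 * (2 * t + 1))
      =ᶠ[𝓝 τ] fun t => Θ₂ 0 0 (t / (2 * t + 1)) ^ 2 := by
    filter_upwards [isOpen_im_pos.mem_nhds hτ] with t ht using hsq t ht
  have hu := HasDerivAt.unique (f := fun t : ℂ => Θ₂ 0 0 t ^ 2 * (2 * t + 1)) hL
    (HasDerivAt.congr_of_eventuallyEq (f := fun t => Θ₂ 0 0 (t / (2 * t + 1)) ^ 2) hR hev)
  have hval := hsq τ hτ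
  have hne := Θ₂_zero_ne_zero hτ
  simp only [Nat.add_one_sub_one, Nat.cast_ofNat, pow_one, id, Pi.pow_apply, Function.comp,
    mul_one] at hu
  have hpi := pi_ne_zero'
  have key : Θ₂ 0 0 τ ^ 2 * (2 * I / π * thetaL τ * (2 * τ + 1) + 2)
      = Θ₂ 0 0 τ ^ 2 * (2 * I / π * thetaL (τ / (2 * τ + 1)) / (2 * τ + 1)) := by
    have e : Θ₂ 0 0 τ ^ 2 = Θ₂ 0 0 (τ / (2 * τ + 1)) ^ 2 / (2 * τ + 1) := by
      rw [eq_div_iff h2, hval]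
    have : Θ₂ 0 0 τ ^ 2 * (2 * I / π * thetaL (τ / (2 * τ + 1)) / (2 * τ + 1))
      = 2 * I / π * thetaL (τ / (2 * τ + 1)) * Θ₂ 0 0 (τ / (2 * τ + 1)) ^ 2 * (1 / (2 * τ + 1) ^ 2) := by
      rw [e]; field_simp
    rw [this]
    linear_combination hu
  have key2 := mul_left_cancel₀ (pow_ne_zero 2 hne) key
  field_simp at key2
  linear_combination I * key2 + (thetaL (τ / (2 * τ + 1)) - thetaL τ * (2 * τ + 1) ^ 2) * I_sq

/-! ### The change of variables -/

/-- Continuity of the branch is enough: by `r² = cτ + δ` the difference quotient equals `c/(r(t) +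
r(τ))`. -/
lemma hasDerivAt_sqrt_branch {c δ : ℂ} {U : Set ℂ} (hU : IsOpen U) {r : ℂ → ℂ}
    (hr : ContinuousOn r U) (hrs : ∀ τ ∈ U, r τ ^ 2 = c * τ + δ) {τ : ℂ} (hτ : τ ∈ U)
    (h0 : c * τ + δ ≠ 0) : HasDerivAt r (c / (2 * r τ)) τ := by
  have hr0 : r τ ≠ 0 := by
    intro h
    apply h0
    rw [← hrs τ hτ, h]
    simp
  have hc : ContinuousAt r τ := hr.continuousAt (hU.mem_nhds hτ)
  have hsum : Tendsto (fun t => r t + r τ) (𝓝 τ) (𝓝 (2 * r τ)) := by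
    have := hc.tendsto.add_const (r τ)
    rwa [← two_mul] at this
  have h2 : (2 : ℂ) * r τ ≠ 0 := mul_ne_zero two_ne_zero hr0
  rw [hasDerivAt_iff_tendsto_slope]
  have hlim : Tendsto (fun t => c / (r t + r τ)) (𝓝[≠] τ) (𝓝 (c / (2 * r τ))) :=
    ((tendsto_const_nhds.div hsum h2).mono_left nhdsWithin_le_nhds)
  refine hlim.congr' ?_
  have e1 : ∀ᶠ t in 𝓝[≠] τ, t ∈ U := nhdsWithin_le_nhds (hU.mem_nhds hτ)
  have e2 : ∀ᶠ t in 𝓝[≠] τ, r t + r τ ≠ 0 :=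
    nhdsWithin_le_nhds (hsum.eventually_ne h2)
  filter_upwards [e1, e2, self_mem_nhdsWithin] with t ht1 ht2 ht3
  have ht3' : t - τ ≠ 0 := sub_ne_zero.mpr ht3
  rw [slope_def_field, div_eq_div_iff ht2 ht3']
  linear_combination hrs τ hτ - hrs t ht1

/-- `(cτ+δ)^{-1/2} exp(-πic(z+E)²/(cτ+δ))`. -/
noncomputable def gaussFactor (c δ : ℂ) (r : ℂ → ℂ) (E z τ : ℂ) : ℂ :=
  1 / r τ * cexp (-π * I * c / (c * τ + δ) * (z + E) ^ 2)

/-- The transforms of the `z`-derivatives of a theta series. -/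
noncomputable def transTerm (χ : ℤ → ℂ) (m : ℕ) (a b c δ : ℂ) (r : ℂ → ℂ) (D E z τ : ℂ) : ℂ :=
  gaussFactor c δ r E z τ * thetaSeries χ m ((z + E) / (c * τ + δ) + D) (moeb a b c δ τ)

/-- The logarithmic `z`-derivative of `gaussFactor`. -/
noncomputable def gaussLog (c δ E z τ : ℂ) : ℂ := -2 * π * I * c * (z + E) / (c * τ + δ)

lemma differentiableAt_div_prod {f g : ℂ × ℂ → ℂ} {p : ℂ × ℂ} (hf : DifferentiableAt ℂ f p)
    (hg : DifferentiableAt ℂ g p) (h : g p ≠ 0) : DifferentiableAt ℂ (fun q => f q / g q) p := by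
  simp only [div_eq_mul_inv]
  exact hf.fun_mul (hg.fun_inv h)

section Transform

variable {χ : ℤ → ℂ} {a b c δ D E : ℂ} {r : ℂ → ℂ} {z τ : ℂ}

lemma hasDerivAt_moeb (hdet : a * δ - b * c = 1) (h0 : c * τ + δ ≠ 0) :
    HasDerivAt (moeb a b c δ) (1 / (c * τ + δ) ^ 2) τ := by
  have := (((hasDerivAt_id τ).const_mul a).add_const b).div
    (((hasDerivAt_id τ).const_mul c).add_const δ) h0
  refine HasDerivAt.congr_deriv (f := moeb a b c δ) this ?_
  simp only [id, mul_one]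
  congr 1
  linear_combination hdet

lemma hasDerivAt_gaussFactor_fst :
    HasDerivAt (fun w => gaussFactor c δ r E w τ)
      (gaussFactor c δ r E z τ * gaussLog c δ E z τ) z := by
  have h1 := ((((hasDerivAt_id z).add_const E).pow 2).const_mul
    (-π * I * c / (c * τ + δ))).cexp.const_mul (1 / r τ)
  refine HasDerivAt.congr_deriv (f := fun w => gaussFactor c δ r E w τ) h1 ?_
  simp only [id, Pi.pow_apply, gaussFactor, gaussLog]
  push_cast
  ring

lemma hasDerivAt_gaussLog_fst :
    HasDerivAt (fun w => gaussLog c δ E w τ) (-2 * π * I * c / (c * τ + δ)) z := by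
  have h1 := (((hasDerivAt_id z).add_const E).const_mul (-2 * π * I * c)).div_const (c * τ + δ)
  refine HasDerivAt.congr_deriv (f := fun w => gaussLog c δ E w τ) h1 ?_
  ring

lemma hasDerivAt_inv_affine (h0 : c * τ + δ ≠ 0) :
    HasDerivAt (fun t => 1 / (c * t + δ)) (-c / (c * τ + δ) ^ 2) τ := by
  have := (hasDerivAt_const τ (1 : ℂ)).div (((hasDerivAt_id τ).const_mul c).add_const δ) h0
  refine HasDerivAt.congr_deriv (f := fun t => 1 / (c * t + δ)) this ?_
  simp only [id]
  ring

lemma hasDerivAt_gaussLog_snd (h0 : c * τ + δ ≠ 0) :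
    HasDerivAt (fun t => gaussLog c δ E z t)
      (-c / (c * τ + δ) * gaussLog c δ E z τ) τ := by
  have h1 := (hasDerivAt_inv_affine h0).const_mul (-2 * π * I * c * (z + E))
  have h2 : (fun t => gaussLog c δ E z t)
      = fun t => -2 * π * I * c * (z + E) * (1 / (c * t + δ)) := by
    funext t; rw [gaussLog]; ring
  rw [h2]
  refine h1.congr_deriv ?_
  rw [gaussLog]
  field_simp

lemma hasDerivAt_gaussFactor_snd (h0 : c * τ + δ ≠ 0) (hr2 : r τ ^ 2 = c * τ + δ)
    (hr : HasDerivAt r (c / (2 * r τ)) τ) :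
    HasDerivAt (fun t => gaussFactor c δ r E z t)
      (gaussFactor c δ r E z τ * (-I / (4 * π) * (gaussLog c δ E z τ ^ 2
        + -2 * π * I * c / (c * τ + δ)))) τ := by
  have hr0 : r τ ≠ 0 := by
    intro h; apply h0; rw [← hr2, h]; simp
  have e1 := ((hasDerivAt_inv_affine h0).const_mul (-π * I * c)).mul_const ((z + E) ^ 2)
  have h1 := ((hasDerivAt_const τ (1 : ℂ)).div hr hr0).mul e1.cexp
  have h2 : (fun t => gaussFactor c δ r E z t) = fun t => 1 / r t *
      cexp (-π * I * c * (1 / (c * t + δ)) * (z + E) ^ 2) := by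
    funext t; rw [gaussFactor]
    congr 2
    ring
  have hpi := pi_ne_zero'
  have h3 : gaussFactor c δ r E z τ
      = 1 / r τ * cexp (-π * I * c * (1 / (c * τ + δ)) * (z + E) ^ 2) := congrFun h2 τ
  rw [h2, h3]
  refine HasDerivAt.congr_deriv (f := fun t => 1 / r t *
      cexp (-π * I * c * (1 / (c * t + δ)) * (z + E) ^ 2)) h1 ?_
  simp only [Pi.div_apply, gaussLog]
  generalize cexp (-π * I * c * (1 / (c * τ + δ)) * (z + E) ^ 2) = e
  have e4 : -I / (4 * π) * ((-2 * π * I * c * (z + E) / (c * τ + δ)) ^ 2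
      + -2 * π * I * c / (c * τ + δ))
      = π * I * c ^ 2 * (z + E) ^ 2 / (c * τ + δ) ^ 2 - c / (2 * (c * τ + δ)) := by
    field_simp
    linear_combination 2 * c * (-4 * π * c * (z + E) ^ 2 * I + 2 * (c * τ + δ)) * I_sq
  rw [e4, ← hr2]
  field_simp
  ring

lemma hasDerivAt_transTerm_fst (hχ : ∀ k, ‖χ k‖ ≤ 1) (m : ℕ) (hT : 0 < (moeb a b c δ τ).im) :
    HasDerivAt (fun w => transTerm χ m a b c δ r D E w τ)
      (transTerm χ (m + 1) a b c δ r D E z τ / (c * τ + δ)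
        + gaussLog c δ E z τ * transTerm χ m a b c δ r D E z τ) z := by
  have hu : HasDerivAt (fun w => (w + E) / (c * τ + δ) + D) (1 / (c * τ + δ)) z :=
    (((hasDerivAt_id z).add_const E).div_const (c * τ + δ)).add_const D
  have h1 := (hasDerivAt_gaussFactor_fst (c := c) (δ := δ) (r := r) (E := E) (z := z)
    (τ := τ)).mul
    ((hasDerivAt_thetaSeries_fst hχ m ((z + E) / (c * τ + δ) + D) hT).comp z hu)
  refine HasDerivAt.congr_deriv (f := fun w => transTerm χ m a b c δ r D E w τ) h1 ?_
  simp only [transTerm, Function.comp]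
  ring

/-- The bracket is the second `z`-derivative of `transTerm`, so this is the heat equation for the
transformed series. Determinant one makes the derivative of `moeb` equal to `1/(cτ+δ)²`, which
matches the factor left by two `z`-derivatives. -/
lemma hasDerivAt_transTerm_snd (hχ : ∀ k, ‖χ k‖ ≤ 1) (m : ℕ) (hdet : a * δ - b * c = 1)
    (hT : 0 < (moeb a b c δ τ).im) (h0 : c * τ + δ ≠ 0) (hr2 : r τ ^ 2 = c * τ + δ)
    (hr : HasDerivAt r (c / (2 * r τ)) τ) :
    HasDerivAt (fun t => transTerm χ m a b c δ r D E z t)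
      (-I / (4 * π) * (transTerm χ (m + 2) a b c δ r D E z τ / (c * τ + δ) ^ 2
        + 2 * gaussLog c δ E z τ * (transTerm χ (m + 1) a b c δ r D E z τ / (c * τ + δ))
        + (gaussLog c δ E z τ ^ 2 + -2 * π * I * c / (c * τ + δ))
          * transTerm χ m a b c δ r D E z τ)) τ := by
  have hu : HasDerivAt (fun t => (z + E) / (c * t + δ) + D) ((z + E) * (-c / (c * τ + δ) ^ 2)) τ := by
    have := ((hasDerivAt_inv_affine h0).const_mul (z + E)).add_const D
    simpa only [mul_one_div] using this
  have h1 := (hasDerivAt_gaussFactor_snd (E := E) (z := z) h0 hr2 hr).mul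
    ((hasFDerivAt_thetaSeries hχ m ((z + E) / (c * τ + δ) + D) hT).comp_hasDerivAt τ
      (hu.prodMk (hasDerivAt_moeb hdet h0)))
  refine HasDerivAt.congr_deriv (f := fun t => transTerm χ m a b c δ r D E z t) h1 ?_
  have hpi := pi_ne_zero'
  simp only [transTerm, Function.comp, _root_.add_apply, _root_.smul_apply,
    ContinuousLinearMap.coe_fst', ContinuousLinearMap.coe_snd', smul_eq_mul]
  have e : ∀ x : ℂ, x / (4 * π * I) = -I / (4 * π) * x := fun x => by
    rw [div_eq_mul_one_div, inv_four_pi_I]; ring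
  rw [e]
  -- The cross term of Gaussian and series equals the contribution of the `τ`-dependence of the
  -- argument `(z+E)/(cτ+δ)`.
  have e5 : gaussLog c δ E z τ * (-I / (4 * π)) * 2 / (c * τ + δ)
      = -c * (z + E) / (c * τ + δ) ^ 2 := by
    rw [gaussLog]
    field_simp
    linear_combination 4 * c * (z + E) * I_sq
  linear_combination -gaussFactor c δ r E z τ *
    thetaSeries χ (m + 1) ((z + E) / (c * τ + δ) + D) (moeb a b c δ τ) * e5

lemma differentiableAt_transTerm (hχ : ∀ k, ‖χ k‖ ≤ 1) (m : ℕ) (hdet : a * δ - b * c = 1)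
    (hT : 0 < (moeb a b c δ τ).im) (h0 : c * τ + δ ≠ 0) (hr2 : r τ ^ 2 = c * τ + δ)
    (hr : HasDerivAt r (c / (2 * r τ)) τ) :
    DifferentiableAt ℂ (fun p : ℂ × ℂ => transTerm χ m a b c δ r D E p.1 p.2) (z, τ) := by
  have hr0 : r τ ≠ 0 := by
    intro h; apply h0; rw [← hr2, h]; simp
  have d1 : DifferentiableAt ℂ (fun p : ℂ × ℂ => p.1) (z, τ) := differentiableAt_fst
  have d2 : DifferentiableAt ℂ (fun p : ℂ × ℂ => p.2) (z, τ) := differentiableAt_snd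
  have dr : DifferentiableAt ℂ (fun p : ℂ × ℂ => r p.2) (z, τ) :=
    DifferentiableAt.comp (g := r) (z, τ) hr.differentiableAt d2
  have ds : DifferentiableAt ℂ (fun p : ℂ × ℂ => c * p.2 + δ) (z, τ) := (d2.const_mul c).add_const δ
  have dM : DifferentiableAt ℂ (fun p : ℂ × ℂ => moeb a b c δ p.2) (z, τ) :=
    DifferentiableAt.comp (g := moeb a b c δ) (z, τ) (hasDerivAt_moeb hdet h0).differentiableAt d2
  have du : DifferentiableAt ℂ (fun p : ℂ × ℂ => (p.1 + E) / (c * p.2 + δ) + D) (z, τ) :=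
    have h : DifferentiableAt ℂ (fun p : ℂ × ℂ => (p.1 + E) / (c * p.2 + δ)) (z, τ) :=
      differentiableAt_div_prod (d1.add_const E) ds h0
    h.add_const D
  have dT := DifferentiableAt.comp (g := fun q : ℂ × ℂ => thetaSeries χ m q.1 q.2) (z, τ)
    (hasFDerivAt_thetaSeries hχ m ((z + E) / (c * τ + δ) + D) hT).differentiableAt (du.prodMk dM)
  have dg : DifferentiableAt ℂ (fun p : ℂ × ℂ => gaussFactor c δ r E p.1 p.2) (z, τ) := by
    unfold gaussFactor
    exact (differentiableAt_div_prod (differentiableAt_const 1) dr hr0).fun_mul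
      (((differentiableAt_div_prod (differentiableAt_const _) ds h0).fun_mul ((d1.add_const E).fun_pow 2)).cexp)
  exact dg.fun_mul dT

end Transform

/-! ### From the `z`-system and the heat equation to the `τ`-system -/

lemma hasDerivAt_quotient_combination {f₁ f₅ f g h : ℂ → ℂ} {d₁ d₅ df dg dh z : ℂ} (κ : ℂ)
    (h₁ : HasDerivAt f₁ d₁ z) (h₅ : HasDerivAt f₅ d₅ z) (hf : HasDerivAt f df z)
    (hg : HasDerivAt g dg z) (hh : HasDerivAt h dh z) (h0 : f₁ z ≠ 0) :
    HasDerivAt (fun w => f₅ w / f₁ w * f w - κ * (g w * h w / f₁ w))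
      ((d₅ * f₁ z - f₅ z * d₁) / f₁ z ^ 2 * f z + f₅ z / f₁ z * df
        - κ * (((dg * h z + g z * dh) * f₁ z - g z * h z * d₁) / f₁ z ^ 2)) z :=
  ((h₅.fun_div h₁ h0).fun_mul hf).fun_sub (((hg.fun_mul hh).fun_div h₁ h0).const_mul κ)

/-- The unknowns solve the heat equation `4πi ∂_τ f = ∂_z² f` at `(z, τ)`. -/
def HeatAt (f : ℂ → ℂ → ℂ) (z τ : ℂ) : Prop :=
  HasDerivAt (fun t => f z t) (-I / (4 * π) * deriv (fun w => deriv (fun v => f v τ) w) z) τ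

lemma HeatAt.of_hasDerivAt {f : ℂ → ℂ → ℂ} {f' : ℂ → ℂ} {f'' z τ : ℂ} (h : HeatAt f z τ)
    (h1 : ∀ᶠ w in 𝓝 z, HasDerivAt (fun v => f v τ) (f' w) w) (h2 : HasDerivAt f' f'' z) :
    HasDerivAt (fun t => f z t) (-I / (4 * π) * f'') τ := by
  have e : (fun w => deriv (fun v => f v τ) w) =ᶠ[𝓝 z] f' := by
    filter_upwards [h1] with w hw using hw.deriv
  have := (h2.congr_of_eventuallyEq e).deriv
  rw [HeatAt, this] at h
  exact h

lemma HeatAt.mk' {f : ℂ → ℂ → ℂ} {f' : ℂ → ℂ} {f'' z τ : ℂ}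
    (h1 : ∀ w, HasDerivAt (fun v => f v τ) (f' w) w) (h2 : HasDerivAt f' f'' z)
    (h : HasDerivAt (fun t => f z t) (-I / (4 * π) * f'') τ) : HeatAt f z τ := by
  have e : (fun w => deriv (fun v => f v τ) w) = f' := funext fun w => (h1 w).deriv
  rw [HeatAt, e, h2.deriv]
  exact h

/-- The second `z`-derivative of each unknown is obtained by differentiating the right-hand side of
its `z`-equation and applying the `z`-system again; multiplied by `1/(4πi)` it is the right-hand
side of the `τ`-equation. The `z`-system is needed in a neighbourhood because it gets
differentiated. -/
lemma tauSystemAt_of_heat {K : Coeffs} {F : Unknowns} {z τ : ℂ} (h0 : F.θ₁ z τ ≠ 0)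
    (hz : ∀ᶠ w in 𝓝 z, ZSystemAt K F w τ) (h₁ : HeatAt F.θ₁ z τ) (h₂ : HeatAt F.θ₂ z τ)
    (h₃ : HeatAt F.θ₃ z τ) (h₄ : HeatAt F.θ₄ z τ) (h₅ : HeatAt F.dθ₁ z τ) :
    TauSystemAt K F z τ := by
  obtain ⟨z1, z2, z3, z4, z5⟩ := hz.self_of_nhds
  have hpi := pi_ne_zero'
  refine ⟨?_, ?_, ?_, ?_, ?_⟩
  · refine (h₁.of_hasDerivAt (hz.mono fun w hw => hw.1) z5).congr_deriv ?_
    field_simp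
    ring
  · refine (h₂.of_hasDerivAt (hz.mono fun w hw => hw.2.1)
      (hasDerivAt_quotient_combination _ z1 z5 z2 z3 z4 h0)).congr_deriv ?_
    field_simp
    ring
  · refine (h₃.of_hasDerivAt (hz.mono fun w hw => hw.2.2.1)
      (hasDerivAt_quotient_combination _ z1 z5 z3 z2 z4 h0)).congr_deriv ?_
    field_simp
    ring
  · refine (h₄.of_hasDerivAt (hz.mono fun w hw => hw.2.2.2.1)
      (hasDerivAt_quotient_combination _ z1 z5 z4 z2 z3 h0)).congr_deriv ?_
    field_simp
    ring
  · have z6 := (((z5.fun_mul z5).fun_div z1 h0)).fun_sub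
      ((((z2.fun_mul z2).fun_div z1 h0)).const_mul (π ^ 2 * K.ϑ₃ τ ^ 2 * K.ϑ₄ τ ^ 2))
    have z7 := z6.fun_sub (z1.const_mul (4 * K.lam τ))
    refine (h₅.of_hasDerivAt (hz.mono fun w hw => hw.2.2.2.2)
      (z7.congr_of_eventuallyEq (Eventually.of_forall fun w => ?_))).congr_deriv ?_
    · simp only [sq]
    field_simp
    ring

/-! ### The explicit solutions -/

/-- The transformed theta functions with constant factors. -/
noncomputable def transUnknowns (a b c δ : ℂ) (r : ℂ → ℂ) (D E μ₁ μ₂ μ₃ μ₄ : ℂ) : Unknowns where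
  θ₁ z τ := μ₁ * transTerm χ₁ 0 a b c δ r D E z τ
  θ₂ z τ := μ₂ * transTerm χ₂ 0 a b c δ r D E z τ
  θ₃ z τ := μ₃ * transTerm χ₃ 0 a b c δ r D E z τ
  θ₄ z τ := μ₄ * transTerm χ₄ 0 a b c δ r D E z τ
  dθ₁ z τ := μ₁ * (transTerm χ₁ 1 a b c δ r D E z τ / (c * τ + δ)
    + gaussLog c δ E z τ * transTerm χ₁ 0 a b c δ r D E z τ)

section Solutions

variable {a b c δ D E μ₁ μ₂ μ₃ μ₄ : ℂ} {r : ℂ → ℂ} {z τ : ℂ} {χ : ℤ → ℂ}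

lemma hasDerivAt_transTerm_deriv (hχ : ∀ k, ‖χ k‖ ≤ 1) (μ : ℂ) (m : ℕ)
    (hT : 0 < (moeb a b c δ τ).im) :
    HasDerivAt (fun w => μ * (transTerm χ (m + 1) a b c δ r D E w τ / (c * τ + δ)
        + gaussLog c δ E w τ * transTerm χ m a b c δ r D E w τ))
      (μ * (transTerm χ (m + 2) a b c δ r D E z τ / (c * τ + δ) ^ 2
        + 2 * gaussLog c δ E z τ * (transTerm χ (m + 1) a b c δ r D E z τ / (c * τ + δ))
        + (gaussLog c δ E z τ ^ 2 + -2 * π * I * c / (c * τ + δ))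
          * transTerm χ m a b c δ r D E z τ)) z := by
  refine ((((hasDerivAt_transTerm_fst hχ (m + 1) hT).div_const (c * τ + δ)).fun_add
    (hasDerivAt_gaussLog_fst.fun_mul (hasDerivAt_transTerm_fst hχ m hT))).const_mul
      μ).congr_deriv ?_
  generalize c * τ + δ = s
  ring

lemma heatAt_transTerm (hχ : ∀ k, ‖χ k‖ ≤ 1) (μ : ℂ) (hdet : a * δ - b * c = 1)
    (hT : 0 < (moeb a b c δ τ).im) (h0 : c * τ + δ ≠ 0) (hr2 : r τ ^ 2 = c * τ + δ)
    (hr : HasDerivAt r (c / (2 * r τ)) τ) :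
    HeatAt (fun z τ => μ * transTerm χ 0 a b c δ r D E z τ) z τ := by
  refine HeatAt.mk' (fun w => (hasDerivAt_transTerm_fst hχ 0 hT).const_mul μ)
    (hasDerivAt_transTerm_deriv hχ μ 0 hT) ?_
  refine ((hasDerivAt_transTerm_snd hχ 0 hdet hT h0 hr2 hr).const_mul μ).congr_deriv ?_
  ring

lemma heatAt_transTerm_deriv (hχ : ∀ k, ‖χ k‖ ≤ 1) (μ : ℂ) (hdet : a * δ - b * c = 1)
    (hT : 0 < (moeb a b c δ τ).im) (h0 : c * τ + δ ≠ 0) (hr2 : r τ ^ 2 = c * τ + δ)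
    (hr : HasDerivAt r (c / (2 * r τ)) τ) :
    HeatAt (fun z τ => μ * (transTerm χ 1 a b c δ r D E z τ / (c * τ + δ)
        + gaussLog c δ E z τ * transTerm χ 0 a b c δ r D E z τ)) z τ := by
  have hs : HasDerivAt (fun t => c * t + δ) c τ := by
    simpa using ((hasDerivAt_id τ).const_mul c).add_const δ
  have f0 := hasDerivAt_transTerm_fst (r := r) (D := D) (E := E) (z := z) hχ 0 hT
  have f1 := (hasDerivAt_transTerm_fst (r := r) (D := D) (E := E) (z := z) hχ 1 hT).div_const
    (c * τ + δ)
  have f2 := (hasDerivAt_transTerm_fst (r := r) (D := D) (E := E) (z := z) hχ 2 hT).div_const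
    ((c * τ + δ) ^ 2)
  have fγ := hasDerivAt_gaussLog_fst (c := c) (δ := δ) (E := E) (z := z) (τ := τ)
  have h2 := ((f2.fun_add ((fγ.const_mul 2).fun_mul f1)).fun_add
    (((fγ.fun_pow 2).add_const (-2 * π * I * c / (c * τ + δ))).fun_mul f0)).const_mul μ
  refine HeatAt.mk' (fun w => hasDerivAt_transTerm_deriv hχ μ 0 hT) h2 ?_
  have t0 := hasDerivAt_transTerm_snd (D := D) (E := E) (z := z) hχ 0 hdet hT h0 hr2 hr
  have t1 := hasDerivAt_transTerm_snd (D := D) (E := E) (z := z) hχ 1 hdet hT h0 hr2 hr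
  refine (((t1.fun_div hs h0).fun_add
    ((hasDerivAt_gaussLog_snd h0).fun_mul t0)).const_mul μ).congr_deriv ?_
  -- The derivative of the factor `1/(cτ+δ)` is written through the `z`-derivative of `gaussLog`,
  -- after which both sides are polynomials in the same quantities.
  have e : c / (c * τ + δ) = I / (4 * π) * 2 * (-2 * π * I * c / (c * τ + δ)) := by
    have hpi := pi_ne_zero'
    field_simp
    linear_combination 4 * c * I_sq
  have e2 : ∀ x y : ℂ, (x * (c * τ + δ) - y * c) / (c * τ + δ) ^ 2
      = x / (c * τ + δ) - c / (c * τ + δ) * (y / (c * τ + δ)) := fun x y => by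
    field_simp
  rw [e2, neg_div]
  simp only [Nat.cast_ofNat, Nat.add_one_sub_one, pow_one, zero_add, Nat.reduceAdd]
  clear f0 f1 f2 fγ h2 t0 t1 hs e2
  generalize gaussLog c δ E z τ = q
  generalize transTerm χ 0 a b c δ r D E z τ = t0
  generalize transTerm χ 1 a b c δ r D E z τ = t1
  generalize transTerm χ 2 a b c δ r D E z τ = t2
  generalize transTerm χ 3 a b c δ r D E z τ = t3
  generalize c * τ + δ = s at e ⊢
  generalize -2 * π * I * c / s = y at e ⊢
  rw [e]
  linear_combination (-(μ * q * t0)) * e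

lemma gaussFactor_ne_zero (h0 : c * τ + δ ≠ 0) (hr2 : r τ ^ 2 = c * τ + δ) :
    gaussFactor c δ r E z τ ≠ 0 := by
  have hr0 : r τ ≠ 0 := by
    intro h; apply h0; rw [← hr2, h]; simp
  exact mul_ne_zero (one_div_ne_zero hr0) (Complex.exp_ne_zero _)

/-- The Gaussian adds the same logarithmic derivative to all four functions and so drops out of the
Wronskians; in the second logarithmic derivative of `θ₁` it leaves the affine term of `kl`. The
hypotheses `k₂`, `k₃`, `k₄` say how the scale factors `μ` must match the coefficients. -/
lemma zSystemAt_transUnknowns {K : Coeffs} (hT : 0 < (moeb a b c δ τ).im) (h0 : c * τ + δ ≠ 0)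
    (hr2 : r τ ^ 2 = c * τ + δ) (h₁ : μ₁ ≠ 0) (h₂ : μ₂ ≠ 0) (h₃ : μ₃ ≠ 0) (h₄ : μ₄ ≠ 0)
    (k₂ : K.ϑ₂ τ ^ 2 * (μ₃ * μ₄) * (c * τ + δ) = Θ₂ 0 0 (moeb a b c δ τ) ^ 2 * (μ₁ * μ₂))
    (k₃ : K.ϑ₃ τ ^ 2 * (μ₂ * μ₄) * (c * τ + δ) = Θ₃ 0 0 (moeb a b c δ τ) ^ 2 * (μ₁ * μ₃))
    (k₄ : K.ϑ₄ τ ^ 2 * (μ₂ * μ₃) * (c * τ + δ) = Θ₄ 0 0 (moeb a b c δ τ) ^ 2 * (μ₁ * μ₄))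
    (kl : K.lam τ = thetaL (moeb a b c δ τ) / (c * τ + δ) ^ 2 + π * I * c / (2 * (c * τ + δ)))
    (hne : (transUnknowns a b c δ r D E μ₁ μ₂ μ₃ μ₄).θ₁ z τ ≠ 0) :
    ZSystemAt K (transUnknowns a b c δ r D E μ₁ μ₂ μ₃ μ₄) z τ := by
  have hg : gaussFactor c δ r E z τ ≠ 0 := gaussFactor_ne_zero h0 hr2
  set u := (z + E) / (c * τ + δ) + D with hu
  have w2 := wronskian_Θ₂ hT u
  have w3 := wronskian_Θ₃ hT u
  have w4 := wronskian_Θ₄ hT u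
  have w1 := second_order hT u
  have d1 := (hasDerivAt_transTerm_fst (r := r) (D := D) (E := E) (z := z) norm_χ₁_le 0 hT).const_mul μ₁
  have d2 := (hasDerivAt_transTerm_fst (r := r) (D := D) (E := E) (z := z) norm_χ₂_le 0 hT).const_mul μ₂
  have d3 := (hasDerivAt_transTerm_fst (r := r) (D := D) (E := E) (z := z) norm_χ₃_le 0 hT).const_mul μ₃
  have d4 := (hasDerivAt_transTerm_fst (r := r) (D := D) (E := E) (z := z) norm_χ₄_le 0 hT).const_mul μ₄
  have d5 := hasDerivAt_transTerm_deriv (r := r) (D := D) (E := E) (z := z) norm_χ₁_le μ₁ 0 hT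
  have e2 : K.ϑ₂ τ ^ 2 = Θ₂ 0 0 (moeb a b c δ τ) ^ 2 * (μ₁ * μ₂) / (μ₃ * μ₄ * (c * τ + δ)) := by
    rw [← k₂]; field_simp
  have e3 : K.ϑ₃ τ ^ 2 = Θ₃ 0 0 (moeb a b c δ τ) ^ 2 * (μ₁ * μ₃) / (μ₂ * μ₄ * (c * τ + δ)) := by
    rw [← k₃]; field_simp
  have e4 : K.ϑ₄ τ ^ 2 = Θ₄ 0 0 (moeb a b c δ τ) ^ 2 * (μ₁ * μ₄) / (μ₂ * μ₃ * (c * τ + δ)) := by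
    rw [← k₄]; field_simp
  simp only [transUnknowns] at hne
  unfold ZSystemAt
  simp only [transUnknowns]
  rw [e2, e3, e4, kl]
  simp only [transTerm, ← hu] at d1 d2 d3 d4 d5 hne ⊢
  have hΘ : Θ₁ 0 u (moeb a b c δ τ) ≠ 0 := fun h => hne (by rw [h]; ring)
  refine ⟨d1, d2.congr_deriv ?_, d3.congr_deriv ?_, d4.congr_deriv ?_, d5.congr_deriv ?_⟩
  all_goals
    clear d1 d2 d3 d4 d5 hne e2 e3 e4 k₂ k₃ k₄ kl
    simp only [zero_add]
  · generalize gaussLog c δ E z τ = q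
    field_simp
    linear_combination w2
  · generalize gaussLog c δ E z τ = q
    field_simp
    linear_combination w3
  · generalize gaussLog c δ E z τ = q
    field_simp
    linear_combination w4
  · generalize gaussLog c δ E z τ = q
    field_simp
    linear_combination 2 * w1

end Solutions

/-! ### Transfer of solutions -/

/-- Derivatives depend on values nearby; openness of `Ω` makes agreement on `Ω` sufficient. -/
lemma IsSolutionOn.congr {K L : Coeffs} {F G : Unknowns} {Ω : Set (ℂ × ℂ)} (hΩ : IsOpen Ω)
    (hF : IsSolutionOn K F Ω) (hG : G.AgreeOn F Ω) {U : Set ℂ} (hKL : L.AgreeOn K U)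
    (hΩU : ∀ p ∈ Ω, p.2 ∈ U) : IsSolutionOn L G Ω := by
  obtain ⟨h1, h2, h3, h4, h5, h⟩ := hF
  refine ⟨h1.congr fun p hp => (hG p hp).1, h2.congr fun p hp => (hG p hp).2.1,
    h3.congr fun p hp => (hG p hp).2.2.1, h4.congr fun p hp => (hG p hp).2.2.2.1,
    h5.congr fun p hp => (hG p hp).2.2.2.2, fun p hp => ?_⟩
  obtain ⟨z, τ⟩ := p
  obtain ⟨hne, ⟨z1, z2, z3, z4, z5⟩, t1, t2, t3, t4, t5⟩ := h _ hp
  obtain ⟨g1, g2, g3, g4, g5⟩ := hG _ hp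
  obtain ⟨k2, k3, k4, ke⟩ := hKL _ (hΩU _ hp)
  have kl : L.lam τ = K.lam τ := by simp only [Coeffs.lam, k3, k4, ke]
  have hz : ∀ᶠ w in 𝓝 z, (w, τ) ∈ Ω :=
    (Continuous.prodMk_left τ).continuousAt.preimage_mem_nhds (hΩ.mem_nhds hp)
  have ht : ∀ᶠ t in 𝓝 τ, (z, t) ∈ Ω :=
    (Continuous.prodMk_right z).continuousAt.preimage_mem_nhds (hΩ.mem_nhds hp)
  simp only at hne z1 z2 z3 z4 z5 t1 t2 t3 t4 t5 g1 g2 g3 g4 g5 k2 k3 k4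
  refine ⟨by rw [g1]; exact hne, ?_, ?_⟩
  · unfold ZSystemAt
    simp only [g1, g2, g3, g4, g5, k2, k3, k4, kl]
    exact ⟨z1.congr_of_eventuallyEq (hz.mono fun w hw => (hG _ hw).1),
      z2.congr_of_eventuallyEq (hz.mono fun w hw => (hG _ hw).2.1),
      z3.congr_of_eventuallyEq (hz.mono fun w hw => (hG _ hw).2.2.1),
      z4.congr_of_eventuallyEq (hz.mono fun w hw => (hG _ hw).2.2.2.1),
      z5.congr_of_eventuallyEq (hz.mono fun w hw => (hG _ hw).2.2.2.2)⟩
  · unfold TauSystemAt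
    simp only [g1, g2, g3, g4, g5, k2, k3, k4, kl]
    exact ⟨t1.congr_of_eventuallyEq (ht.mono fun w hw => (hG _ hw).1),
      t2.congr_of_eventuallyEq (ht.mono fun w hw => (hG _ hw).2.1),
      t3.congr_of_eventuallyEq (ht.mono fun w hw => (hG _ hw).2.2.1),
      t4.congr_of_eventuallyEq (ht.mono fun w hw => (hG _ hw).2.2.2.1),
      t5.congr_of_eventuallyEq (ht.mono fun w hw => (hG _ hw).2.2.2.2)⟩

/-! ### The general coefficients -/

section General

variable {a b c δ A B d : ℂ} {U : Set ℂ} {r : ℂ → ℂ} {τ : ℂ}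

lemma generalCoeffs_lam (hT : 0 < (moeb a b c δ τ).im) (hr2 : r τ ^ 2 = c * τ + δ) :
    (generalCoeffs a b c δ A B d r).lam τ
      = thetaL (moeb a b c δ τ) / (c * τ + δ) ^ 2 + π * I * c / (2 * (c * τ + δ)) := by
  have hr4 : r τ ^ 4 = (c * τ + δ) ^ 2 := by rw [← hr2]; ring
  simp only [Coeffs.lam, generalCoeffs, wη_eq hT, jθ₃_eq, jθ₄_eq, mul_pow, div_pow, hr4]
  generalize c * τ + δ = s
  ring

lemma generalIntegral_agreeOn (hUT : ∀ τ ∈ U, c * τ + δ ≠ 0 ∧ 0 < (moeb a b c δ τ).im)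
    (ε : Fin 4 → ℂ) (C D E : ℂ) :
    (generalIntegral a b c δ A B d r ε C D E).AgreeOn
      (transUnknowns a b c δ r D E (ε 0 * (1 / (A * B) * (d * C))) (ε 1 * (d * C))
        (ε 2 * (1 / A * C)) (ε 3 * (1 / B * C))) {p : ℂ × ℂ | p.2 ∈ U} := by
  rintro ⟨z, τ⟩ hp
  have hag1 : ∀ w, (generalIntegral a b c δ A B d r ε C D E).θ₁ w τ
      = ε 0 * (1 / (A * B) * (d * C)) * transTerm χ₁ 0 a b c δ r D E w τ := fun w => by
    simp only [generalIntegral, transTerm, gaussFactor, transformed, jθ₁_eq]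
    ring
  refine ⟨hag1 z, ?_, ?_, ?_, ?_⟩
  · simp only [generalIntegral, transUnknowns, transTerm, gaussFactor, transformed, jθ₂_eq]
    ring
  · simp only [generalIntegral, transUnknowns, transTerm, gaussFactor, transformed, jθ₃_eq]
    ring
  · simp only [generalIntegral, transUnknowns, transTerm, gaussFactor, transformed, jθ₄_eq]
    ring
  · change deriv (fun w => (generalIntegral a b c δ A B d r ε C D E).θ₁ w τ) z = _
    rw [funext hag1]
    exact ((hasDerivAt_transTerm_fst norm_χ₁_le 0 (hUT _ hp).2).const_mul _).deriv

lemma differentiableAt_transUnknowns (hdet : a * δ - b * c = 1) (hU : IsOpen U)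
    (hUT : ∀ τ ∈ U, c * τ + δ ≠ 0 ∧ 0 < (moeb a b c δ τ).im) (hrc : ContinuousOn r U)
    (hrs : ∀ τ ∈ U, r τ ^ 2 = c * τ + δ) (D E μ₁ μ₂ μ₃ μ₄ : ℂ) {p : ℂ × ℂ} (hp : p.2 ∈ U) :
    let G := transUnknowns a b c δ r D E μ₁ μ₂ μ₃ μ₄
    DifferentiableAt ℂ (fun p : ℂ × ℂ => G.θ₁ p.1 p.2) p ∧
    DifferentiableAt ℂ (fun p : ℂ × ℂ => G.θ₂ p.1 p.2) p ∧
    DifferentiableAt ℂ (fun p : ℂ × ℂ => G.θ₃ p.1 p.2) p ∧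
    DifferentiableAt ℂ (fun p : ℂ × ℂ => G.θ₄ p.1 p.2) p ∧
    DifferentiableAt ℂ (fun p : ℂ × ℂ => G.dθ₁ p.1 p.2) p := by
  have hdif : ∀ (χ : ℤ → ℂ), (∀ k, ‖χ k‖ ≤ 1) → ∀ m, DifferentiableAt ℂ
      (fun p : ℂ × ℂ => transTerm χ m a b c δ r D E p.1 p.2) p := fun χ hχ m =>
    differentiableAt_transTerm hχ m hdet (hUT _ hp).2 (hUT _ hp).1 (hrs _ hp)
      (hasDerivAt_sqrt_branch hU hrc hrs hp (hUT _ hp).1)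
  have ds : DifferentiableAt ℂ (fun p : ℂ × ℂ => c * p.2 + δ) p :=
    (differentiableAt_snd.const_mul c).add_const δ
  have dγ : DifferentiableAt ℂ (fun p : ℂ × ℂ => gaussLog c δ E p.1 p.2) p :=
    differentiableAt_div_prod ((differentiableAt_fst.add_const E).const_mul _) ds (hUT _ hp).1
  exact ⟨(hdif _ norm_χ₁_le 0).const_mul μ₁, (hdif _ norm_χ₂_le 0).const_mul μ₂,
    (hdif _ norm_χ₃_le 0).const_mul μ₃, (hdif _ norm_χ₄_le 0).const_mul μ₄,
    ((differentiableAt_div_prod (hdif _ norm_χ₁_le 1) ds (hUT _ hp).1).fun_add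
      (dγ.fun_mul (hdif _ norm_χ₁_le 0))).const_mul μ₁⟩

lemma isSolutionOn_generalIntegral (hdet : a * δ - b * c = 1) (hA : A ≠ 0) (hB : B ≠ 0)
    (hd : d ≠ 0) (hU : IsOpen U) (hUT : ∀ τ ∈ U, c * τ + δ ≠ 0 ∧ 0 < (moeb a b c δ τ).im)
    (hrc : ContinuousOn r U) (hrs : ∀ τ ∈ U, r τ ^ 2 = c * τ + δ) (ε : Fin 4 → ℂ) (C D E : ℂ)
    (hε : AdmissibleSigns ε) (hC : C ≠ 0) :
    IsSolutionOn (generalCoeffs a b c δ A B d r) (generalIntegral a b c δ A B d r ε C D E)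
      {p : ℂ × ℂ | p.2 ∈ U ∧ (generalIntegral a b c δ A B d r ε C D E).θ₁ p.1 p.2 ≠ 0} := by
  set μ₁ := ε 0 * (1 / (A * B) * (d * C)) with hμ₁
  set μ₂ := ε 1 * (d * C) with hμ₂
  set μ₃ := ε 2 * (1 / A * C) with hμ₃
  set μ₄ := ε 3 * (1 / B * C) with hμ₄
  set G := transUnknowns a b c δ r D E μ₁ μ₂ μ₃ μ₄ with hG
  set F := generalIntegral a b c δ A B d r ε C D E with hF
  have hε0 : ∀ k, ε k ≠ 0 := fun k => by
    rcases hε.1 k with h | h <;> rw [h] <;> norm_num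
  have hεs : ∀ k, ε k ^ 2 = 1 := fun k => by
    rcases hε.1 k with h | h <;> rw [h] <;> norm_num
  have n₁ : μ₁ ≠ 0 := mul_ne_zero (hε0 0)
    (mul_ne_zero (one_div_ne_zero (mul_ne_zero hA hB)) (mul_ne_zero hd hC))
  have n₂ : μ₂ ≠ 0 := mul_ne_zero (hε0 1) (mul_ne_zero hd hC)
  have n₃ : μ₃ ≠ 0 := mul_ne_zero (hε0 2) (mul_ne_zero (one_div_ne_zero hA) hC)
  have n₄ : μ₄ ≠ 0 := mul_ne_zero (hε0 3) (mul_ne_zero (one_div_ne_zero hB) hC)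
  have hdG : ∀ p : ℂ × ℂ, p.2 ∈ U → _ := fun p hp =>
    differentiableAt_transUnknowns hdet hU hUT hrc hrs D E μ₁ μ₂ μ₃ μ₄ hp
  have hagU : F.AgreeOn G {p : ℂ × ℂ | p.2 ∈ U} := generalIntegral_agreeOn hUT ε C D E
  set Ω : Set (ℂ × ℂ) := {p : ℂ × ℂ | p.2 ∈ U ∧ F.θ₁ p.1 p.2 ≠ 0} with hΩ
  have hV : IsOpen {p : ℂ × ℂ | p.2 ∈ U} := hU.preimage continuous_snd
  have hΩo : IsOpen Ω := by
    have hc : ContinuousOn (fun p : ℂ × ℂ => F.θ₁ p.1 p.2) {p : ℂ × ℂ | p.2 ∈ U} :=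
      ContinuousOn.congr (fun p hp => (hdG p hp).1.continuousAt.continuousWithinAt)
        fun p hp => (hagU p hp).1
    exact hc.isOpen_inter_preimage hV (isOpen_compl_singleton (x := (0 : ℂ)))
  have hag : F.AgreeOn G Ω := fun p hp => hagU p hp.1
  have k : ∀ τ ∈ U, ((generalCoeffs a b c δ A B d r).ϑ₂ τ ^ 2 * (μ₃ * μ₄) * (c * τ + δ)
        = Θ₂ 0 0 (moeb a b c δ τ) ^ 2 * (μ₁ * μ₂)) ∧
      ((generalCoeffs a b c δ A B d r).ϑ₃ τ ^ 2 * (μ₂ * μ₄) * (c * τ + δ)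
        = Θ₃ 0 0 (moeb a b c δ τ) ^ 2 * (μ₁ * μ₃)) ∧
      (generalCoeffs a b c δ A B d r).ϑ₄ τ ^ 2 * (μ₂ * μ₃) * (c * τ + δ)
        = Θ₄ 0 0 (moeb a b c δ τ) ^ 2 * (μ₁ * μ₄) := fun τ hτ => by
    have hs := (hUT τ hτ).1
    -- The coefficients see the signs only through products of complementary pairs, and these agree
    -- because the product of all four signs is `1`.
    have e2 : ε 2 * ε 3 = ε 0 * ε 1 := by
      linear_combination ε 0 * ε 1 * hε.2 - ε 2 * ε 3 * ε 1 ^ 2 * hεs 0 - ε 2 * ε 3 * hεs 1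
    have e3 : ε 1 * ε 3 = ε 0 * ε 2 := by
      linear_combination ε 0 * ε 2 * hε.2 - ε 1 * ε 3 * ε 2 ^ 2 * hεs 0 - ε 1 * ε 3 * hεs 2
    have e4 : ε 1 * ε 2 = ε 0 * ε 3 := by
      linear_combination ε 0 * ε 3 * hε.2 - ε 1 * ε 2 * ε 3 ^ 2 * hεs 0 - ε 1 * ε 2 * hεs 3
    have hr0 : r τ ≠ 0 := by intro h; apply hs; rw [← hrs τ hτ, h]; simp
    simp only [generalCoeffs, jθ₂_eq, jθ₃_eq, jθ₄_eq, mul_pow, div_pow, hrs τ hτ, hμ₁, hμ₂, hμ₃,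
      hμ₄]
    generalize c * τ + δ = s at hs ⊢
    refine ⟨?_, ?_, ?_⟩
    · field_simp
      linear_combination Θ₂ 0 0 (moeb a b c δ τ) ^ 2 * e2
    · field_simp
      linear_combination Θ₃ 0 0 (moeb a b c δ τ) ^ 2 * e3
    · field_simp
      linear_combination Θ₄ 0 0 (moeb a b c δ τ) ^ 2 * e4
  refine IsSolutionOn.congr (K := generalCoeffs a b c δ A B d r) (F := G) (U := U) hΩo ?_ hag
    (fun τ _ => ⟨rfl, rfl, rfl, rfl⟩) fun p hp => hp.1
  refine ⟨fun p hp => (hdG p hp.1).1.differentiableWithinAt,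
    fun p hp => (hdG p hp.1).2.1.differentiableWithinAt,
    fun p hp => (hdG p hp.1).2.2.1.differentiableWithinAt,
    fun p hp => (hdG p hp.1).2.2.2.1.differentiableWithinAt,
    fun p hp => (hdG p hp.1).2.2.2.2.differentiableWithinAt, ?_⟩
  · rintro ⟨z, τ⟩ ⟨hτ, hne⟩
    rw [(hagU (z, τ) hτ).1] at hne
    have hT := (hUT τ hτ).2
    have hs := (hUT τ hτ).1
    have hr2 := hrs τ hτ
    have hr := hasDerivAt_sqrt_branch hU hrc hrs hτ hs
    refine ⟨hne, ?_⟩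
    have hz : ∀ w, G.θ₁ w τ ≠ 0 → ZSystemAt (generalCoeffs a b c δ A B d r) G w τ := fun w hw =>
      zSystemAt_transUnknowns hT hs hr2 n₁ n₂ n₃ n₄ (k τ hτ).1 (k τ hτ).2.1 (k τ hτ).2.2
        (generalCoeffs_lam hT hr2) hw
    refine ⟨hz z hne, tauSystemAt_of_heat hne ?_ ?_ ?_ ?_ ?_ ?_⟩
    · have hc : ContinuousAt (fun w => G.θ₁ w τ) z := (hz z hne).1.continuousAt
      exact (hc.eventually_ne hne).mono fun w hw => hz w hw
    · exact heatAt_transTerm norm_χ₁_le μ₁ hdet hT hs hr2 hr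
    · exact heatAt_transTerm norm_χ₂_le μ₂ hdet hT hs hr2 hr
    · exact heatAt_transTerm norm_χ₃_le μ₃ hdet hT hs hr2 hr
    · exact heatAt_transTerm norm_χ₄_le μ₄ hdet hT hs hr2 hr
    · exact heatAt_transTerm_deriv norm_χ₁_le μ₁ hdet hT hs hr2 hr

/-- The integrability conditions at a point, with `Coeffs.lam` in place of `η`. -/
structure CoeffODE (A B : ℂ) (K : Coeffs) (τ : ℂ) : Prop where
  two : HasDerivAt K.ϑ₂ (I / π * K.lam τ * K.ϑ₂ τ) τ
  three : HasDerivAt K.ϑ₃ (I / π * (K.lam τ - π ^ 2 / 4 * (B ^ 4 * K.ϑ₄ τ ^ 4)) * K.ϑ₃ τ) τ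
  four : HasDerivAt K.ϑ₄ (I / π * (K.lam τ - π ^ 2 / 4 * (A ^ 4 * K.ϑ₃ τ ^ 4)) * K.ϑ₄ τ) τ
  lam : HasDerivAt K.lam (2 * I / π * K.lam τ ^ 2
    - I * π ^ 3 / 8 * (A ^ 4 * B ^ 4 * (K.ϑ₃ τ ^ 4 * K.ϑ₄ τ ^ 4))) τ

/-- The factor `1/r` has logarithmic derivative `-c/(2(cτ+δ))`, which is `i/π` times the affine term
`πic/(2(cτ+δ))`. So the inhomogeneous part in the transformation of `η` is exactly what the weight
`1/2` requires. -/
lemma hasDerivAt_const_div_branch {f : ℂ → ℂ} {x p l : ℂ} (hdet : a * δ - b * c = 1)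
    (hs : c * τ + δ ≠ 0) (hr2 : r τ ^ 2 = c * τ + δ) (hr : HasDerivAt r (c / (2 * r τ)) τ)
    (hf : HasDerivAt f (I / π * (l - p) * f (moeb a b c δ τ)) (moeb a b c δ τ)) :
    HasDerivAt (fun t => x * (f (moeb a b c δ t) / r t))
      (I / π * (l / (c * τ + δ) ^ 2 + π * I * c / (2 * (c * τ + δ)) - p / (c * τ + δ) ^ 2)
        * (x * (f (moeb a b c δ τ) / r τ))) τ := by
  have hr0 : r τ ≠ 0 := by intro h; apply hs; rw [← hr2, h]; simp
  refine (((hf.comp τ (hasDerivAt_moeb hdet hs)).fun_div hr hr0).const_mul x).congr_deriv ?_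
  have hpi := pi_ne_zero'
  simp only [Function.comp, ← hr2]
  field_simp
  linear_combination (-(x * f (moeb a b c δ τ) * c * π * r τ ^ 2)) * I_sq

lemma coeffODE_generalCoeffs (hdet : a * δ - b * c = 1) (hA : A ≠ 0) (hB : B ≠ 0)
    (hU : IsOpen U) (hUT : ∀ τ ∈ U, c * τ + δ ≠ 0 ∧ 0 < (moeb a b c δ τ).im)
    (hrc : ContinuousOn r U) (hrs : ∀ τ ∈ U, r τ ^ 2 = c * τ + δ) (hτ : τ ∈ U) :
    CoeffODE A B (generalCoeffs a b c δ A B d r) τ := by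
  have hT := (hUT τ hτ).2
  have hs := (hUT τ hτ).1
  have hr2 := hrs τ hτ
  have hr := hasDerivAt_sqrt_branch hU hrc hrs hτ hs
  have hr4 : r τ ^ 4 = (c * τ + δ) ^ 2 := by rw [← hr2]; ring
  have hl := generalCoeffs_lam (A := A) (B := B) (d := d) hT hr2
  have q3 : A ^ 4 * (generalCoeffs a b c δ A B d r).ϑ₃ τ ^ 4
      = Θ₃ 0 0 (moeb a b c δ τ) ^ 4 / (c * τ + δ) ^ 2 := by
    simp only [generalCoeffs, jθ₃_eq, mul_pow, div_pow, hr4]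
    field_simp
  have q4 : B ^ 4 * (generalCoeffs a b c δ A B d r).ϑ₄ τ ^ 4
      = Θ₄ 0 0 (moeb a b c δ τ) ^ 4 / (c * τ + δ) ^ 2 := by
    simp only [generalCoeffs, jθ₄_eq, mul_pow, div_pow, hr4]
    field_simp
  refine ⟨?_, ?_, ?_, ?_⟩
  · have h := hasDerivAt_Θ₂_zero hT
    rw [← sub_zero (thetaL _)] at h
    have hK : (generalCoeffs a b c δ A B d r).ϑ₂ = fun t =>
        d * (Θ₂ 0 0 (moeb a b c δ t) / r t) := by
      funext t; simp only [generalCoeffs, jθ₂_eq]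
    rw [hl, hK]
    refine (hasDerivAt_const_div_branch hdet hs hr2 hr h).congr_deriv ?_
    generalize c * τ + δ = s
    ring
  · have h := hasDerivAt_Θ₃_zero hT
    have hK : (generalCoeffs a b c δ A B d r).ϑ₃ = fun t =>
        1 / A * (Θ₃ 0 0 (moeb a b c δ t) / r t) := by
      funext t; simp only [generalCoeffs, jθ₃_eq]
    rw [hl, q4, hK]
    refine (hasDerivAt_const_div_branch hdet hs hr2 hr h).congr_deriv ?_
    generalize c * τ + δ = s
    ring
  · have h := hasDerivAt_Θ₄_zero hT
    have hK : (generalCoeffs a b c δ A B d r).ϑ₄ = fun t =>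
        1 / B * (Θ₄ 0 0 (moeb a b c δ t) / r t) := by
      funext t; simp only [generalCoeffs, jθ₄_eq]
    rw [hl, q3, hK]
    refine (hasDerivAt_const_div_branch hdet hs hr2 hr h).congr_deriv ?_
    generalize c * τ + δ = s
    ring
  · have h := ((hasDerivAt_thetaL hT).comp τ (hasDerivAt_moeb hdet hs)).fun_mul
      ((hasDerivAt_inv_affine hs).fun_pow 2)
    have h2 := h.fun_add ((hasDerivAt_inv_affine hs).const_mul (π * I * c / 2))
    have hev : (generalCoeffs a b c δ A B d r).lam =ᶠ[𝓝 τ] fun t =>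
        (thetaL ∘ moeb a b c δ) t * (1 / (c * t + δ)) ^ 2 + π * I * c / 2 * (1 / (c * t + δ)) := by
      filter_upwards [hU.mem_nhds hτ] with t ht
      rw [generalCoeffs_lam (hUT t ht).2 (hrs t ht), Function.comp]
      generalize c * t + δ = s
      ring
    refine (h2.congr_of_eventuallyEq hev).congr_deriv ?_
    have hpi := pi_ne_zero'
    have e : A ^ 4 * B ^ 4 * ((generalCoeffs a b c δ A B d r).ϑ₃ τ ^ 4
        * (generalCoeffs a b c δ A B d r).ϑ₄ τ ^ 4)
        = Θ₃ 0 0 (moeb a b c δ τ) ^ 4 / (c * τ + δ) ^ 2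
          * (Θ₄ 0 0 (moeb a b c δ τ) ^ 4 / (c * τ + δ) ^ 2) := by
      rw [← q3, ← q4]; ring
    rw [e, hl]
    simp only [Function.comp, Nat.cast_ofNat, Nat.add_one_sub_one, pow_one]
    generalize c * τ + δ = s at hs ⊢
    field_simp
    linear_combination (-8 * I * π ^ 2 * s ^ 2 * c ^ 2
      - 32 * thetaL (moeb a b c δ τ) * π * s * c) * I_sq

lemma integrability_of_coeffODE {K : Coeffs} (h : ∀ τ ∈ U, CoeffODE A B K τ) :
    Integrability A B K U := by
  intro τ hτ
  obtain ⟨h2, h3, h4, hl⟩ := h τ hτ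
  have hη : K.η = fun t => K.lam t - π ^ 2 / 12 * (K.ϑ₃ t ^ 4 + K.ϑ₄ t ^ 4) := by
    funext t; rw [Coeffs.lam]; ring
  have hpi := pi_ne_zero'
  refine ⟨h2, h3.congr_deriv ?_, h4.congr_deriv ?_, ?_⟩
  · rw [Coeffs.lam]; ring
  · rw [Coeffs.lam]; ring
  · have h := hl.fun_sub (((h3.fun_pow 4).fun_add (h4.fun_pow 4)).const_mul (π ^ 2 / 12 : ℂ))
    rw [← hη] at h
    refine h.congr_deriv ?_
    rw [Coeffs.lam]
    push_cast
    field_simp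
    ring

end General

/-! ### The element of `Γ(2)` and the coefficients -/

/-- With `T = moeb a b c δ τ`, the new matrix gives `T/(2T+1)`, so the `Γ(2)` formulas apply at `T`.
The factor `I` in the formula for `θ₄` is compensated by `1/(-IB) = I/B`. -/
lemma coeffs_gamma2 {a b c δ A B d : ℂ} {r : ℂ → ℂ} {τ : ℂ} (hdet : a * δ - b * c = 1)
    (hB : B ≠ 0) (hs : c * τ + δ ≠ 0) (hT : 0 < (moeb a b c δ τ).im)
    (hr2 : r τ ^ 2 = c * τ + δ) :
    let K := generalCoeffs a b (2 * a + c) (2 * b + δ) A (-I * B) d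
      (fun τ => r τ * (2 * moeb a b c δ τ + 1) ^ (1 / 2 : ℂ))
    let L := generalCoeffs a b c δ A B d r
    K.ϑ₂ τ = L.ϑ₂ τ ∧ K.ϑ₃ τ = L.ϑ₃ τ ∧ K.ϑ₄ τ = L.ϑ₄ τ ∧ K.η τ = L.η τ := by
  intro K L
  have h2 := two_mul_add_one_ne_zero hT
  have hm : (2 * a + c) * τ + (2 * b + δ) = (c * τ + δ) * (2 * moeb a b c δ τ + 1) := by
    rw [moeb]; field_simp; ring
  have hM : moeb a b (2 * a + c) (2 * b + δ) τ
      = moeb a b c δ τ / (2 * moeb a b c δ τ + 1) := by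
    have e : moeb a b c δ τ = (a * τ + b) / (c * τ + δ) := rfl
    rw [moeb, hm]
    nth_rewrite 2 [e]
    field_simp
  have hT' : 0 < (moeb a b (2 * a + c) (2 * b + δ) τ).im := by
    rw [hM]; exact im_moeb_two_one_pos hT
  have hr' : (fun τ => r τ * (2 * moeb a b c δ τ + 1) ^ (1 / 2 : ℂ)) τ ^ 2
      = (2 * a + c) * τ + (2 * b + δ) := by
    simp only [mul_pow]
    rw [cpow_half_sq, hr2, hm]
  have g2 := jθ₂_gamma2 hT 0
  have g3 := jθ₃_gamma2 hT 0
  have g4 := jθ₄_gamma2 hT 0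
  simp only [ne_eq, OfNat.ofNat_ne_zero, not_false_eq_true, zero_pow, mul_zero, zero_div, neg_zero,
    Complex.exp_zero, mul_one] at g2 g3 g4
  have e2 : K.ϑ₂ τ = L.ϑ₂ τ := by
    simp only [K, L, generalCoeffs, hM]
    rw [g2]; ring
  have e3 : K.ϑ₃ τ = L.ϑ₃ τ := by
    simp only [K, L, generalCoeffs, hM]
    rw [g3]; ring
  have e4 : K.ϑ₄ τ = L.ϑ₄ τ := by
    simp only [K, L, generalCoeffs, hM]
    rw [g4]
    have : 1 / (-I * B) = I * (1 / B) := by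
      have hI := I_ne_zero
      field_simp
      linear_combination -I_sq
    rw [this]
    ring
  refine ⟨e2, e3, e4, ?_⟩
  -- `lam` is compared instead of `η`, because `generalCoeffs_lam` expresses it without the
  -- constants `A`, `B`, `d`.
  have hl : K.lam τ = L.lam τ := by
    rw [generalCoeffs_lam hT' hr', generalCoeffs_lam hT hr2, hm, hM, thetaL_gamma2 hT]
    -- For `s = cτ+δ`, `s' = s(2T+1)` and `c' = 2a+c` this is `c's - cs' = 2`, a consequence of
    -- determinant one. The affine terms then differ by `πi/(ss')`, which cancels the anomaly in
    -- `thetaL_gamma2`.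
    have e : 2 * a + c = (2 + c * (c * τ + δ) * (2 * moeb a b c δ τ + 1)) / (c * τ + δ) := by
      rw [moeb]
      field_simp
      linear_combination 2 * hdet
    rw [e]
    field_simp
    ring
  have : K.η τ = K.lam τ - π ^ 2 / 12 * (K.ϑ₃ τ ^ 4 + K.ϑ₄ τ ^ 4) := by rw [Coeffs.lam]; ring
  rw [this, hl, e3, e4, Coeffs.lam]
  ring

lemma coeffs_canonical : (generalCoeffs 1 0 2 1 1 (-I) 1
    (fun τ => (2 * τ + 1) ^ (1 / 2 : ℂ))).AgreeOn canonicalCoeffs {τ : ℂ | 0 < τ.im} := by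
  intro τ hτ
  have hm : ∀ t, moeb 1 0 0 1 t = t := fun t => by simp [moeb]
  have h := coeffs_gamma2 (a := 1) (b := 0) (c := 0) (δ := 1) (A := 1) (B := 1) (d := 1)
    (r := fun _ => 1) (τ := τ) (by norm_num) one_ne_zero (by norm_num) (by rw [hm]; exact hτ)
    (by norm_num)
  simp only [hm, mul_one, one_mul, mul_zero, zero_add, add_zero] at h
  obtain ⟨e2, e3, e4, e5⟩ := h
  refine ⟨e2.trans ?_, e3.trans ?_, e4.trans ?_, e5.trans ?_⟩ <;>
    simp [generalCoeffs, canonicalCoeffs, hm]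

/-- The `Γ(2)` formulas are applied at the shifted point `z + 2Dτ + E + D`, which is the one with
quotient `(z+E)/(2τ+1) + D`. Completing the square there, the quadratic exponents cancel and only a
linear one remains. -/
lemma transformed_canonical (D E z : ℂ) {τ : ℂ} (hτ : 0 < τ.im) :
    let r : ℂ → ℂ := fun t => (2 * t + 1) ^ (1 / 2 : ℂ)
    let κ : ℂ := cexp (2 * π * I * D * (2 * E + D))
    transformed jθ₁ 1 0 2 1 r D E z τ = -I * κ * linearExp jθ₁ (2 * D) (E + D) z τ ∧
    transformed jθ₂ 1 0 2 1 r D E z τ = κ * linearExp jθ₂ (2 * D) (E + D) z τ ∧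
    transformed jθ₃ 1 0 2 1 r D E z τ = κ * linearExp jθ₃ (2 * D) (E + D) z τ ∧
    transformed jθ₄ 1 0 2 1 r D E z τ = -I * κ * linearExp jθ₄ (2 * D) (E + D) z τ := by
  intro r κ
  have h2 := two_mul_add_one_ne_zero hτ
  have hu : (z + 2 * D * τ + (E + D)) / (2 * τ + 1) = (z + E) / (2 * τ + 1) + D := by
    field_simp; ring
  have hm : moeb 1 0 2 1 τ = τ / (2 * τ + 1) := by simp [moeb]
  have hexp : cexp (-π * I * 2 / (2 * τ + 1) * (z + E) ^ 2)
      = κ * cexp (π * I * (2 * D) * (2 * z + 2 * D * τ))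
        * cexp (-(2 * π * I * (z + 2 * D * τ + (E + D)) ^ 2 / (2 * τ + 1))) := by
    simp only [κ]
    rw [← Complex.exp_add, ← Complex.exp_add]
    congr 1
    field_simp
    ring
  have g1 := jθ₁_gamma2 hτ (z + 2 * D * τ + (E + D))
  have g2 := jθ₂_gamma2 hτ (z + 2 * D * τ + (E + D))
  have g3 := jθ₃_gamma2 hτ (z + 2 * D * τ + (E + D))
  have g4 := jθ₄_gamma2 hτ (z + 2 * D * τ + (E + D))
  rw [hu] at g1 g2 g3 g4
  simp only [transformed, linearExp, hexp, hm, g1, g2, g3, g4, r]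
  have hI : ∀ p t k e q : ℂ, p * t * (k * e * q) = -I * k * (e * (I * (p * q * t))) :=
    fun p t k e q => by linear_combination p * t * (k * e * q) * I_sq
  exact ⟨hI _ _ _ _ _, by ring, by ring, hI _ _ _ _ _⟩

/-! ### Algebraic relations between the components of a solution -/

/-- Joint differentiability assembles the two partial derivatives into the Fréchet derivative, and
the symmetry of the second Fréchet derivative does the rest. -/
lemma mixed_partials_eq {f fz ft : ℂ → ℂ → ℂ} {z τ a b : ℂ}
    (hf : ∀ᶠ p : ℂ × ℂ in 𝓝 (z, τ), DifferentiableAt ℂ (fun q : ℂ × ℂ => f q.1 q.2) p ∧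
      HasDerivAt (fun w => f w p.2) (fz p.1 p.2) p.1 ∧
      HasDerivAt (fun t => f p.1 t) (ft p.1 p.2) p.2)
    (hz : DifferentiableAt ℂ (fun q : ℂ × ℂ => fz q.1 q.2) (z, τ))
    (ht : DifferentiableAt ℂ (fun q : ℂ × ℂ => ft q.1 q.2) (z, τ))
    (ha : HasDerivAt (fun t => fz z t) a τ) (hb : HasDerivAt (fun w => ft w τ) b z) : a = b := by
  have hpart : ∀ (g : ℂ × ℂ → ℂ) (p : ℂ × ℂ) (u v : ℂ), DifferentiableAt ℂ g p →
      HasDerivAt (fun w => g (w, p.2)) u p.1 → HasDerivAt (fun t => g (p.1, t)) v p.2 →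
      fderiv ℂ g p = u • ContinuousLinearMap.fst ℂ ℂ ℂ + v • ContinuousLinearMap.snd ℂ ℂ ℂ := by
    intro g p u v hg hu hv
    have h1 := (hg.hasFDerivAt (x := (p.1, p.2))).comp_hasDerivAt p.1
      ((hasDerivAt_id p.1).prodMk (hasDerivAt_const p.1 p.2))
    have h2 := (hg.hasFDerivAt (x := (p.1, p.2))).comp_hasDerivAt p.2
      ((hasDerivAt_const p.2 p.1).prodMk (hasDerivAt_id p.2))
    have e1 := h1.unique hu
    have e2 := h2.unique hv
    ext
    · simpa using e1
    · simpa using e2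
  set D : ℂ × ℂ → (ℂ × ℂ →L[ℂ] ℂ) := fun q => fz q.1 q.2 • ContinuousLinearMap.fst ℂ ℂ ℂ
    + ft q.1 q.2 • ContinuousLinearMap.snd ℂ ℂ ℂ with hD
  have h1 : ∀ᶠ p in 𝓝 (z, τ), HasFDerivAt (fun q : ℂ × ℂ => f q.1 q.2) (D p) p := by
    filter_upwards [hf] with p hp
    have := hp.1.hasFDerivAt
    rwa [hpart _ p _ _ hp.1 hp.2.1 hp.2.2] at this
  have h2 : HasFDerivAt D ((fderiv ℂ (fun q : ℂ × ℂ => fz q.1 q.2) (z, τ)).smulRight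
      (ContinuousLinearMap.fst ℂ ℂ ℂ) + (fderiv ℂ (fun q : ℂ × ℂ => ft q.1 q.2) (z, τ)).smulRight
      (ContinuousLinearMap.snd ℂ ℂ ℂ)) (z, τ) :=
    (hz.hasFDerivAt.smul_const (ContinuousLinearMap.fst ℂ ℂ ℂ)).add
      (ht.hasFDerivAt.smul_const (ContinuousLinearMap.snd ℂ ℂ ℂ))
  have hs := second_derivative_symmetric_of_eventually h1 h2 (0, 1) (1, 0)
  have hz2 := hz.hasFDerivAt.comp_hasDerivAt τ ((hasDerivAt_const τ z).prodMk (hasDerivAt_id τ))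
  have ht2 := ht.hasFDerivAt.comp_hasDerivAt z ((hasDerivAt_id z).prodMk (hasDerivAt_const z τ))
  have ea := ha.unique hz2
  have eb := hb.unique ht2
  rw [ea, eb]
  simpa using hs

/-- The quotient of a component of `F` by the first one. -/
noncomputable def quo (f : ℂ → ℂ → ℂ) (F : Unknowns) (z τ : ℂ) : ℂ := f z τ / F.θ₁ z τ

lemma hasDerivAt_quo {f g : ℂ → ℂ} {a b x v : ℂ} (hf : HasDerivAt f a x) (hg : HasDerivAt g b x)
    (h0 : g x ≠ 0) (h : a * g x - f x * b = v * g x ^ 2) :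
    HasDerivAt (fun w => f w / g w) v x := by
  refine (hf.fun_div hg h0).congr_deriv ?_
  rw [h, mul_div_assoc, div_self (pow_ne_zero 2 h0), mul_one]

section Relations

variable {A B : ℂ} {K : Coeffs} {F : Unknowns} {z τ : ℂ}

lemma hasDerivAt_quo_fst (h0 : F.θ₁ z τ ≠ 0) (hz : ZSystemAt K F z τ) :
    HasDerivAt (fun w => quo F.θ₂ F w τ)
      (-π * K.ϑ₂ τ ^ 2 * (quo F.θ₃ F z τ * quo F.θ₄ F z τ)) z ∧
    HasDerivAt (fun w => quo F.θ₃ F w τ)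
      (-π * K.ϑ₃ τ ^ 2 * (quo F.θ₂ F z τ * quo F.θ₄ F z τ)) z ∧
    HasDerivAt (fun w => quo F.θ₄ F w τ)
      (-π * K.ϑ₄ τ ^ 2 * (quo F.θ₂ F z τ * quo F.θ₃ F z τ)) z ∧
    HasDerivAt (fun w => quo F.dθ₁ F w τ)
      (-π ^ 2 * (K.ϑ₃ τ ^ 2 * K.ϑ₄ τ ^ 2 * quo F.θ₂ F z τ ^ 2) - 4 * K.lam τ) z := by
  obtain ⟨z1, z2, z3, z4, z5⟩ := hz
  refine ⟨hasDerivAt_quo z2 z1 h0 ?_, hasDerivAt_quo z3 z1 h0 ?_, hasDerivAt_quo z4 z1 h0 ?_,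
    hasDerivAt_quo z5 z1 h0 ?_⟩ <;> simp only [quo] <;> field_simp <;> ring

lemma hasDerivAt_quo_snd (h0 : F.θ₁ z τ ≠ 0) (ht : TauSystemAt K F z τ) :
    HasDerivAt (fun t => quo F.θ₂ F z t)
      (I / 2 * K.ϑ₂ τ ^ 2 * quo F.dθ₁ F z τ * (quo F.θ₃ F z τ * quo F.θ₄ F z τ)
        - I * π / 4 * (K.ϑ₂ τ ^ 2 * K.ϑ₄ τ ^ 2 * quo F.θ₃ F z τ ^ 2
          + K.ϑ₂ τ ^ 2 * K.ϑ₃ τ ^ 2 * quo F.θ₄ F z τ ^ 2) * quo F.θ₂ F z τ) τ ∧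
    HasDerivAt (fun t => quo F.θ₃ F z t)
      (I / 2 * K.ϑ₃ τ ^ 2 * quo F.dθ₁ F z τ * (quo F.θ₂ F z τ * quo F.θ₄ F z τ)
        - I * π / 4 * (K.ϑ₂ τ ^ 2 * K.ϑ₃ τ ^ 2 * quo F.θ₄ F z τ ^ 2
          + K.ϑ₃ τ ^ 2 * K.ϑ₄ τ ^ 2 * quo F.θ₂ F z τ ^ 2) * quo F.θ₃ F z τ) τ ∧
    HasDerivAt (fun t => quo F.θ₄ F z t)
      (I / 2 * K.ϑ₄ τ ^ 2 * quo F.dθ₁ F z τ * (quo F.θ₂ F z τ * quo F.θ₃ F z τ)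
        - I * π / 4 * (K.ϑ₃ τ ^ 2 * K.ϑ₄ τ ^ 2 * quo F.θ₂ F z τ ^ 2
          + K.ϑ₂ τ ^ 2 * K.ϑ₄ τ ^ 2 * quo F.θ₃ F z τ ^ 2) * quo F.θ₄ F z τ) τ ∧
    HasDerivAt (fun t => quo F.dθ₁ F z t)
      (quo F.dθ₁ F z τ * (I * π / 2 * (K.ϑ₃ τ ^ 2 * K.ϑ₄ τ ^ 2 * quo F.θ₂ F z τ ^ 2)
          + 2 * I / π * K.lam τ)
        - I / 2 * π ^ 2 * (K.ϑ₂ τ ^ 2 * K.ϑ₃ τ ^ 2 * K.ϑ₄ τ ^ 2)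
          * (quo F.θ₂ F z τ * quo F.θ₃ F z τ * quo F.θ₄ F z τ)) τ := by
  obtain ⟨t1, t2, t3, t4, t5⟩ := ht
  have hpi := pi_ne_zero'
  refine ⟨hasDerivAt_quo t2 t1 h0 ?_, hasDerivAt_quo t3 t1 h0 ?_, hasDerivAt_quo t4 t1 h0 ?_,
    hasDerivAt_quo t5 t1 h0 ?_⟩ <;> simp only [quo] <;> field_simp <;> ring

/-- Products of the squares of the quotients with the squares of the coefficients. -/
noncomputable def sqQuo (k l : ℂ → ℂ) (f : ℂ → ℂ → ℂ) (F : Unknowns) (z τ : ℂ) : ℂ :=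
  k τ ^ 2 * l τ ^ 2 * quo f F z τ ^ 2

lemma hasDerivAt_sqQuo_fst {k l : ℂ → ℂ} {f : ℂ → ℂ → ℂ} {v : ℂ}
    (h : HasDerivAt (fun w => quo f F w τ) v z) :
    HasDerivAt (fun w => sqQuo k l f F w τ) (2 * k τ ^ 2 * l τ ^ 2 * quo f F z τ * v) z := by
  refine ((h.fun_pow 2).const_mul (k τ ^ 2 * l τ ^ 2)).congr_deriv ?_
  push_cast
  ring

lemma hasDerivAt_sqQuo_snd {k l : ℂ → ℂ} {f : ℂ → ℂ → ℂ} {v a b : ℂ}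
    (h : HasDerivAt (fun t => quo f F z t) v τ) (hk : HasDerivAt k (a * k τ) τ)
    (hl : HasDerivAt l (b * l τ) τ) :
    HasDerivAt (fun t => sqQuo k l f F z t)
      (2 * (a + b) * sqQuo k l f F z τ + 2 * k τ ^ 2 * l τ ^ 2 * quo f F z τ * v) τ := by
  refine (((hk.fun_pow 2).fun_mul (hl.fun_pow 2)).fun_mul (h.fun_pow 2)).congr_deriv ?_
  simp only [sqQuo]
  push_cast
  ring

/-- `x₂x₃x₄`. -/
noncomputable def triQuo (F : Unknowns) (z τ : ℂ) : ℂ :=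
  quo F.θ₂ F z τ * quo F.θ₃ F z τ * quo F.θ₄ F z τ

/-- The `z`-derivatives. -/
lemma sqQuo_fst (h0 : F.θ₁ z τ ≠ 0) (hz : ZSystemAt K F z τ) :
    HasDerivAt (fun w => sqQuo K.ϑ₃ K.ϑ₄ F.θ₂ F w τ)
      (-2 * π * (K.ϑ₂ τ ^ 2 * K.ϑ₃ τ ^ 2 * K.ϑ₄ τ ^ 2) * triQuo F z τ) z ∧
    HasDerivAt (fun w => sqQuo K.ϑ₂ K.ϑ₄ F.θ₃ F w τ)
      (-2 * π * (K.ϑ₂ τ ^ 2 * K.ϑ₃ τ ^ 2 * K.ϑ₄ τ ^ 2) * triQuo F z τ) z ∧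
    HasDerivAt (fun w => sqQuo K.ϑ₂ K.ϑ₃ F.θ₄ F w τ)
      (-2 * π * (K.ϑ₂ τ ^ 2 * K.ϑ₃ τ ^ 2 * K.ϑ₄ τ ^ 2) * triQuo F z τ) z ∧
    HasDerivAt (fun w => K.ϑ₂ τ ^ 2 * K.ϑ₃ τ ^ 2 * K.ϑ₄ τ ^ 2 * triQuo F w τ)
      (-π * (sqQuo K.ϑ₂ K.ϑ₄ F.θ₃ F z τ * sqQuo K.ϑ₂ K.ϑ₃ F.θ₄ F z τ
        + sqQuo K.ϑ₃ K.ϑ₄ F.θ₂ F z τ * sqQuo K.ϑ₂ K.ϑ₃ F.θ₄ F z τ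
        + sqQuo K.ϑ₃ K.ϑ₄ F.θ₂ F z τ * sqQuo K.ϑ₂ K.ϑ₄ F.θ₃ F z τ)) z := by
  obtain ⟨q2, q3, q4, -⟩ := hasDerivAt_quo_fst h0 hz
  refine ⟨(hasDerivAt_sqQuo_fst q2).congr_deriv ?_, (hasDerivAt_sqQuo_fst q3).congr_deriv ?_,
    (hasDerivAt_sqQuo_fst q4).congr_deriv ?_,
    (((q2.fun_mul q3).fun_mul q4).const_mul _).congr_deriv ?_⟩
  · rw [triQuo]; ring
  · rw [triQuo]; ring
  · rw [triQuo]; ring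
  · simp only [sqQuo]; ring

/-- The `τ`-derivatives. -/
lemma sqQuo_snd (h0 : F.θ₁ z τ ≠ 0) (ht : TauSystemAt K F z τ) (hK : CoeffODE A B K τ) :
    HasDerivAt (fun t => sqQuo K.ϑ₃ K.ϑ₄ F.θ₂ F z t)
      (I * (K.ϑ₂ τ ^ 2 * K.ϑ₃ τ ^ 2 * K.ϑ₄ τ ^ 2) * quo F.dθ₁ F z τ * triQuo F z τ
        - I * π / 2 * (sqQuo K.ϑ₂ K.ϑ₄ F.θ₃ F z τ + sqQuo K.ϑ₂ K.ϑ₃ F.θ₄ F z τ)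
          * sqQuo K.ϑ₃ K.ϑ₄ F.θ₂ F z τ
        + (4 * I / π * K.lam τ - I * π / 2 * (A ^ 4 * K.ϑ₃ τ ^ 4 + B ^ 4 * K.ϑ₄ τ ^ 4))
          * sqQuo K.ϑ₃ K.ϑ₄ F.θ₂ F z τ) τ ∧
    HasDerivAt (fun t => sqQuo K.ϑ₂ K.ϑ₄ F.θ₃ F z t)
      (I * (K.ϑ₂ τ ^ 2 * K.ϑ₃ τ ^ 2 * K.ϑ₄ τ ^ 2) * quo F.dθ₁ F z τ * triQuo F z τ
        - I * π / 2 * (sqQuo K.ϑ₃ K.ϑ₄ F.θ₂ F z τ + sqQuo K.ϑ₂ K.ϑ₃ F.θ₄ F z τ)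
          * sqQuo K.ϑ₂ K.ϑ₄ F.θ₃ F z τ
        + (4 * I / π * K.lam τ - I * π / 2 * (A ^ 4 * K.ϑ₃ τ ^ 4))
          * sqQuo K.ϑ₂ K.ϑ₄ F.θ₃ F z τ) τ ∧
    HasDerivAt (fun t => sqQuo K.ϑ₂ K.ϑ₃ F.θ₄ F z t)
      (I * (K.ϑ₂ τ ^ 2 * K.ϑ₃ τ ^ 2 * K.ϑ₄ τ ^ 2) * quo F.dθ₁ F z τ * triQuo F z τ
        - I * π / 2 * (sqQuo K.ϑ₃ K.ϑ₄ F.θ₂ F z τ + sqQuo K.ϑ₂ K.ϑ₄ F.θ₃ F z τ)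
          * sqQuo K.ϑ₂ K.ϑ₃ F.θ₄ F z τ
        + (4 * I / π * K.lam τ - I * π / 2 * (B ^ 4 * K.ϑ₄ τ ^ 4))
          * sqQuo K.ϑ₂ K.ϑ₃ F.θ₄ F z τ) τ := by
  obtain ⟨q2, q3, q4, -⟩ := hasDerivAt_quo_snd h0 ht
  have hpi := pi_ne_zero'
  refine ⟨(hasDerivAt_sqQuo_snd q2 hK.three hK.four).congr_deriv ?_,
    (hasDerivAt_sqQuo_snd q3 hK.two hK.four).congr_deriv ?_,
    (hasDerivAt_sqQuo_snd q4 hK.two hK.three).congr_deriv ?_⟩ <;>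
  · simp only [sqQuo, triQuo]
    field_simp
    ring

end Relations

section SolutionRelations

variable {A B : ℂ} {K : Coeffs} {F : Unknowns} {Ω : Set (ℂ × ℂ)}

lemma IsSolutionOn.differentiableAt_quo (hF : IsSolutionOn K F Ω) (hΩ : IsOpen Ω)
    {p : ℂ × ℂ} (hp : p ∈ Ω) :
    DifferentiableAt ℂ (fun q : ℂ × ℂ => quo F.θ₂ F q.1 q.2) p ∧
    DifferentiableAt ℂ (fun q : ℂ × ℂ => quo F.θ₃ F q.1 q.2) p ∧
    DifferentiableAt ℂ (fun q : ℂ × ℂ => quo F.θ₄ F q.1 q.2) p ∧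
    DifferentiableAt ℂ (fun q : ℂ × ℂ => quo F.dθ₁ F q.1 q.2) p := by
  obtain ⟨h1, h2, h3, h4, h5, h⟩ := hF
  have hn := hΩ.mem_nhds hp
  have d1 := h1.differentiableAt hn
  exact ⟨differentiableAt_div_prod (h2.differentiableAt hn) d1 (h p hp).1,
    differentiableAt_div_prod (h3.differentiableAt hn) d1 (h p hp).1,
    differentiableAt_div_prod (h4.differentiableAt hn) d1 (h p hp).1,
    differentiableAt_div_prod (h5.differentiableAt hn) d1 (h p hp).1⟩

lemma CoeffODE.differentiableAt {τ z : ℂ} (hK : CoeffODE A B K τ) :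
    DifferentiableAt ℂ (fun q : ℂ × ℂ => K.ϑ₂ q.2) (z, τ) ∧
    DifferentiableAt ℂ (fun q : ℂ × ℂ => K.ϑ₃ q.2) (z, τ) ∧
    DifferentiableAt ℂ (fun q : ℂ × ℂ => K.ϑ₄ q.2) (z, τ) ∧
    DifferentiableAt ℂ (fun q : ℂ × ℂ => K.lam q.2) (z, τ) := by
  have d2 : DifferentiableAt ℂ (fun p : ℂ × ℂ => p.2) (z, τ) := differentiableAt_snd
  exact ⟨DifferentiableAt.comp (g := K.ϑ₂) (z, τ) hK.two.differentiableAt d2,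
    DifferentiableAt.comp (g := K.ϑ₃) (z, τ) hK.three.differentiableAt d2,
    DifferentiableAt.comp (g := K.ϑ₄) (z, τ) hK.four.differentiableAt d2,
    DifferentiableAt.comp (g := K.lam) (z, τ) hK.lam.differentiableAt d2⟩

lemma differentiableAt_sqQuo {k l : ℂ → ℂ} {f : ℂ → ℂ → ℂ} {p : ℂ × ℂ}
    (hf : DifferentiableAt ℂ (fun q : ℂ × ℂ => quo f F q.1 q.2) p)
    (hk : DifferentiableAt ℂ (fun q : ℂ × ℂ => k q.2) p)
    (hl : DifferentiableAt ℂ (fun q : ℂ × ℂ => l q.2) p) :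
    DifferentiableAt ℂ (fun q : ℂ × ℂ => sqQuo k l f F q.1 q.2) p :=
  ((hk.fun_pow 2).fun_mul (hl.fun_pow 2)).fun_mul (hf.fun_pow 2)

/-- The mixed second derivatives give algebraic relations. -/
lemma IsSolutionOn.relations (hF : IsSolutionOn K F Ω) (hΩ : IsOpen Ω)
    (hK : ∀ p ∈ Ω, CoeffODE A B K p.2) {z τ : ℂ} (hp : (z, τ) ∈ Ω) :
    K.ϑ₂ τ ^ 2 * K.ϑ₃ τ ^ 2 * K.ϑ₄ τ ^ 2 * triQuo F z τ
      * (sqQuo K.ϑ₂ K.ϑ₄ F.θ₃ F z τ - sqQuo K.ϑ₃ K.ϑ₄ F.θ₂ F z τ - B ^ 4 * K.ϑ₄ τ ^ 4) = 0 ∧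
    K.ϑ₂ τ ^ 2 * K.ϑ₃ τ ^ 2 * K.ϑ₄ τ ^ 2 * triQuo F z τ
      * (sqQuo K.ϑ₂ K.ϑ₃ F.θ₄ F z τ - sqQuo K.ϑ₃ K.ϑ₄ F.θ₂ F z τ - A ^ 4 * K.ϑ₃ τ ^ 4) = 0 ∧
    sqQuo K.ϑ₂ K.ϑ₄ F.θ₃ F z τ * sqQuo K.ϑ₂ K.ϑ₃ F.θ₄ F z τ
      = (sqQuo K.ϑ₃ K.ϑ₄ F.θ₂ F z τ + A ^ 4 * K.ϑ₃ τ ^ 4)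
        * (sqQuo K.ϑ₃ K.ϑ₄ F.θ₂ F z τ + B ^ 4 * K.ϑ₄ τ ^ 4) := by
  have hne : ∀ p ∈ Ω, F.θ₁ p.1 p.2 ≠ 0 := fun p hp => (hF.2.2.2.2.2 p hp).1
  have hZ : ∀ p ∈ Ω, ZSystemAt K F p.1 p.2 := fun p hp => (hF.2.2.2.2.2 p hp).2.1
  have hT : ∀ p ∈ Ω, TauSystemAt K F p.1 p.2 := fun p hp => (hF.2.2.2.2.2 p hp).2.2
  have dQ : ∀ p ∈ Ω, DifferentiableAt ℂ (fun q : ℂ × ℂ => sqQuo K.ϑ₃ K.ϑ₄ F.θ₂ F q.1 q.2) p :=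
    fun p hp => differentiableAt_sqQuo (hF.differentiableAt_quo hΩ hp).1
      (hK p hp).differentiableAt.2.1 (hK p hp).differentiableAt.2.2.1
  have dR : ∀ p ∈ Ω, DifferentiableAt ℂ (fun q : ℂ × ℂ => sqQuo K.ϑ₂ K.ϑ₄ F.θ₃ F q.1 q.2) p :=
    fun p hp => differentiableAt_sqQuo (hF.differentiableAt_quo hΩ hp).2.1
      (hK p hp).differentiableAt.1 (hK p hp).differentiableAt.2.2.1
  have dS : ∀ p ∈ Ω, DifferentiableAt ℂ (fun q : ℂ × ℂ => sqQuo K.ϑ₂ K.ϑ₃ F.θ₄ F q.1 q.2) p :=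
    fun p hp => differentiableAt_sqQuo (hF.differentiableAt_quo hΩ hp).2.2.1
      (hK p hp).differentiableAt.1 (hK p hp).differentiableAt.2.1
  have hpi := pi_ne_zero'
  obtain ⟨d2, d3, d4, dl⟩ := (hK _ hp).differentiableAt (z := z)
  obtain ⟨q2, q3, q4, qw⟩ := hF.differentiableAt_quo hΩ hp
  obtain ⟨zQ, zR, zS, zY⟩ := sqQuo_fst (hne _ hp) (hZ _ hp)
  obtain ⟨tQ, tR, tS⟩ := sqQuo_snd (hne _ hp) (hT _ hp) (hK _ hp)
  obtain ⟨-, -, -, zw⟩ := hasDerivAt_quo_fst (hne _ hp) (hZ _ hp)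
  have hΩn := hΩ.mem_nhds hp
  have hc : DifferentiableAt ℂ (fun _ : ℂ × ℂ => (0 : ℂ)) (z, τ) := differentiableAt_const _
  have hc0 : HasDerivAt (fun _ : ℂ => (0 : ℂ)) 0 τ := hasDerivAt_const _ _
  refine ⟨?_, ?_, ?_⟩
  -- The difference `R - Q` does not depend on `z`, hence neither does its `τ`-derivative; the
  -- `z`-derivative of that expression must vanish.
  · have h := mixed_partials_eq
      (f := fun z τ => sqQuo K.ϑ₂ K.ϑ₄ F.θ₃ F z τ - sqQuo K.ϑ₃ K.ϑ₄ F.θ₂ F z τ)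
      (fz := fun _ _ => 0)
      (ft := fun z τ => -(I * π / 2) * (sqQuo K.ϑ₂ K.ϑ₃ F.θ₄ F z τ
          * (sqQuo K.ϑ₂ K.ϑ₄ F.θ₃ F z τ - sqQuo K.ϑ₃ K.ϑ₄ F.θ₂ F z τ))
        + ((4 * I / π * K.lam τ - I * π / 2 * (A ^ 4 * K.ϑ₃ τ ^ 4))
          * (sqQuo K.ϑ₂ K.ϑ₄ F.θ₃ F z τ - sqQuo K.ϑ₃ K.ϑ₄ F.θ₂ F z τ)
        + I * π / 2 * (B ^ 4 * K.ϑ₄ τ ^ 4) * sqQuo K.ϑ₃ K.ϑ₄ F.θ₂ F z τ))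
      (z := z) (τ := τ) (a := 0) ?_ hc ?_ hc0
      (((zS.fun_mul (zR.fun_sub zQ)).const_mul _).fun_add
        (((zR.fun_sub zQ).const_mul _).fun_add (zQ.const_mul _)))
    · generalize K.ϑ₂ τ ^ 2 * K.ϑ₃ τ ^ 2 * K.ϑ₄ τ ^ 2 = P at *
      have hI := I_ne_zero
      have hIp : I * π ^ 2 ≠ 0 := mul_ne_zero hI (pow_ne_zero 2 hpi)
      apply mul_left_cancel₀ hIp
      linear_combination -h
    · filter_upwards [hΩn] with p hp
      obtain ⟨a1, a2, -, -⟩ := sqQuo_fst (hne _ hp) (hZ _ hp)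
      obtain ⟨b1, b2, -⟩ := sqQuo_snd (hne _ hp) (hT _ hp) (hK _ hp)
      refine ⟨(dR p hp).fun_sub (dQ p hp), (a2.fun_sub a1).congr_deriv (by ring),
        (b2.fun_sub b1).congr_deriv (by ring)⟩
    · have e1 := dQ _ hp
      have e2 := dR _ hp
      have e3 := dS _ hp
      fun_prop
  · have h := mixed_partials_eq
      (f := fun z τ => sqQuo K.ϑ₂ K.ϑ₃ F.θ₄ F z τ - sqQuo K.ϑ₃ K.ϑ₄ F.θ₂ F z τ)
      (fz := fun _ _ => 0)
      (ft := fun z τ => -(I * π / 2) * (sqQuo K.ϑ₂ K.ϑ₄ F.θ₃ F z τ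
          * (sqQuo K.ϑ₂ K.ϑ₃ F.θ₄ F z τ - sqQuo K.ϑ₃ K.ϑ₄ F.θ₂ F z τ))
        + ((4 * I / π * K.lam τ - I * π / 2 * (B ^ 4 * K.ϑ₄ τ ^ 4))
          * (sqQuo K.ϑ₂ K.ϑ₃ F.θ₄ F z τ - sqQuo K.ϑ₃ K.ϑ₄ F.θ₂ F z τ)
        + I * π / 2 * (A ^ 4 * K.ϑ₃ τ ^ 4) * sqQuo K.ϑ₃ K.ϑ₄ F.θ₂ F z τ))
      (z := z) (τ := τ) (a := 0) ?_ hc ?_ hc0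
      (((zR.fun_mul (zS.fun_sub zQ)).const_mul _).fun_add
        (((zS.fun_sub zQ).const_mul _).fun_add (zQ.const_mul _)))
    · generalize K.ϑ₂ τ ^ 2 * K.ϑ₃ τ ^ 2 * K.ϑ₄ τ ^ 2 = P at *
      have hI := I_ne_zero
      have hIp : I * π ^ 2 ≠ 0 := mul_ne_zero hI (pow_ne_zero 2 hpi)
      apply mul_left_cancel₀ hIp
      linear_combination -h
    · filter_upwards [hΩn] with p hp
      obtain ⟨a1, -, a2, -⟩ := sqQuo_fst (hne _ hp) (hZ _ hp)
      obtain ⟨b1, -, b2⟩ := sqQuo_snd (hne _ hp) (hT _ hp) (hK _ hp)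
      refine ⟨(dS p hp).fun_sub (dQ p hp), (a2.fun_sub a1).congr_deriv (by ring),
        (b2.fun_sub b1).congr_deriv (by ring)⟩
    · have e1 := dQ _ hp
      have e2 := dR _ hp
      have e3 := dS _ hp
      fun_prop
  -- The third relation is the compatibility condition for `θ₁'/θ₁`; the derivative of `lam` enters
  -- through `CoeffODE`.
  · have h := mixed_partials_eq (f := quo F.dθ₁ F)
      (fz := fun z τ => -π ^ 2 * sqQuo K.ϑ₃ K.ϑ₄ F.θ₂ F z τ - 4 * K.lam τ)
      (ft := fun z τ => quo F.dθ₁ F z τ * (I * π / 2 * sqQuo K.ϑ₃ K.ϑ₄ F.θ₂ F z τ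
          + 2 * I / π * K.lam τ)
        - I / 2 * π ^ 2 * (K.ϑ₂ τ ^ 2 * K.ϑ₃ τ ^ 2 * K.ϑ₄ τ ^ 2 * triQuo F z τ))
      (z := z) (τ := τ) ?_ ?_ ?_ ((tQ.const_mul _).fun_sub ((hK _ hp).lam.const_mul 4))
      ((zw.fun_mul ((zQ.const_mul _).add_const _)).fun_sub (zY.const_mul _))
    · have e0 : K.ϑ₃ τ ^ 2 * K.ϑ₄ τ ^ 2 * quo F.θ₂ F z τ ^ 2 = sqQuo K.ϑ₃ K.ϑ₄ F.θ₂ F z τ := rfl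
      rw [e0] at h
      simp only at h
      clear tQ tR tS zQ zR zS zY zw e0
      generalize sqQuo K.ϑ₃ K.ϑ₄ F.θ₂ F z τ = Q at h ⊢
      generalize sqQuo K.ϑ₂ K.ϑ₄ F.θ₃ F z τ = R at h ⊢
      generalize sqQuo K.ϑ₂ K.ϑ₃ F.θ₄ F z τ = S at h ⊢
      generalize K.ϑ₂ τ ^ 2 * K.ϑ₃ τ ^ 2 * K.ϑ₄ τ ^ 2 = P at h ⊢
      generalize quo F.dθ₁ F z τ = w at h ⊢
      generalize triQuo F z τ = Y at h ⊢
      have h8 : (8 : ℂ) * π ^ 4 ≠ 0 := mul_ne_zero (by norm_num) (pow_ne_zero 4 hpi)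
      apply mul_left_cancel₀ h8
      field_simp at h
      linear_combination -h
    · filter_upwards [hΩn] with p hp
      obtain ⟨-, -, -, a1⟩ := hasDerivAt_quo_fst (hne _ hp) (hZ _ hp)
      obtain ⟨-, -, -, b1⟩ := hasDerivAt_quo_snd (hne _ hp) (hT _ hp)
      refine ⟨(hF.differentiableAt_quo hΩ hp).2.2.2, a1, b1.congr_deriv ?_⟩
      simp only [sqQuo, triQuo]
      ring
    · have e1 := dQ _ hp
      fun_prop
    · have e1 := dQ _ hp
      simp only [triQuo]
      fun_prop

/-- The hypersurface on which every solution lies. -/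
lemma IsSolutionOn.hypersurface (hF : IsSolutionOn K F Ω) (hΩ : IsOpen Ω)
    (hK : ∀ p ∈ Ω, CoeffODE A B K p.2) (hA : A ≠ 0) (hB : B ≠ 0)
    (h2 : ∀ p ∈ Ω, K.ϑ₂ p.2 ≠ 0) (h3 : ∀ p ∈ Ω, K.ϑ₃ p.2 ≠ 0) (h4 : ∀ p ∈ Ω, K.ϑ₄ p.2 ≠ 0)
    (hAB : ∀ p ∈ Ω, A ^ 4 * K.ϑ₃ p.2 ^ 4 ≠ B ^ 4 * K.ϑ₄ p.2 ^ 4) {p : ℂ × ℂ} (hp : p ∈ Ω) :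
    sqQuo K.ϑ₂ K.ϑ₄ F.θ₃ F p.1 p.2 - sqQuo K.ϑ₃ K.ϑ₄ F.θ₂ F p.1 p.2 - B ^ 4 * K.ϑ₄ p.2 ^ 4 = 0 ∧
    sqQuo K.ϑ₂ K.ϑ₃ F.θ₄ F p.1 p.2 - sqQuo K.ϑ₃ K.ϑ₄ F.θ₂ F p.1 p.2 - A ^ 4 * K.ϑ₃ p.2 ^ 4 = 0 := by
  have hne : ∀ p ∈ Ω, F.θ₁ p.1 p.2 ≠ 0 := fun p hp => (hF.2.2.2.2.2 p hp).1
  have hZ : ∀ p ∈ Ω, ZSystemAt K F p.1 p.2 := fun p hp => (hF.2.2.2.2.2 p hp).2.1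
  have hT : ∀ p ∈ Ω, TauSystemAt K F p.1 p.2 := fun p hp => (hF.2.2.2.2.2 p hp).2.2
  have hP : ∀ p ∈ Ω, K.ϑ₂ p.2 ^ 2 * K.ϑ₃ p.2 ^ 2 * K.ϑ₄ p.2 ^ 2 ≠ 0 := fun p hp =>
    mul_ne_zero (mul_ne_zero (pow_ne_zero 2 (h2 p hp)) (pow_ne_zero 2 (h3 p hp)))
      (pow_ne_zero 2 (h4 p hp))
  have hα : ∀ p ∈ Ω, A ^ 4 * K.ϑ₃ p.2 ^ 4 ≠ 0 := fun p hp =>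
    mul_ne_zero (pow_ne_zero 4 hA) (pow_ne_zero 4 (h3 p hp))
  have hβ : ∀ p ∈ Ω, B ^ 4 * K.ϑ₄ p.2 ^ 4 ≠ 0 := fun p hp =>
    mul_ne_zero (pow_ne_zero 4 hB) (pow_ne_zero 4 (h4 p hp))
  have hrel := fun (p : ℂ × ℂ) (hp : p ∈ Ω) => hF.relations hΩ hK (z := p.1) (τ := p.2) hp
  have hpi := pi_ne_zero'
  -- The first two relations carry the factor `x₂x₃x₄` and would be void where it vanishes
  -- identically. This cannot happen on an open set.
  have main : ∀ p ∈ Ω, ¬ ∀ᶠ q : ℂ × ℂ in 𝓝 p, triQuo F q.1 q.2 = 0 := by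
    rintro p hp hY
    have hRS : ∀ q ∈ Ω, (∀ᶠ q : ℂ × ℂ in 𝓝 q, triQuo F q.1 q.2 = 0) →
        sqQuo K.ϑ₂ K.ϑ₄ F.θ₃ F q.1 q.2 = 0 ∧ sqQuo K.ϑ₂ K.ϑ₃ F.θ₄ F q.1 q.2 = 0 := by
      rintro ⟨z, τ⟩ hq hYq
      obtain ⟨-, -, -, zY⟩ := sqQuo_fst (hne _ hq) (hZ _ hq)
      have hYz : ∀ᶠ w in 𝓝 z, triQuo F w τ = 0 :=
        (Continuous.prodMk_left τ).continuousAt.eventually hYq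
      have e0 : (fun w => K.ϑ₂ τ ^ 2 * K.ϑ₃ τ ^ 2 * K.ϑ₄ τ ^ 2 * triQuo F w τ) =ᶠ[𝓝 z]
          fun _ => 0 := hYz.mono fun w hw => by simp only [hw, mul_zero]
      have e1 := zY.unique ((hasDerivAt_const z (0 : ℂ)).congr_of_eventuallyEq e0)
      have e2 : triQuo F z τ = 0 := hYq.self_of_nhds
      have e3 : sqQuo K.ϑ₃ K.ϑ₄ F.θ₂ F z τ
          * (sqQuo K.ϑ₂ K.ϑ₄ F.θ₃ F z τ * sqQuo K.ϑ₂ K.ϑ₃ F.θ₄ F z τ) = 0 := by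
        have : sqQuo K.ϑ₃ K.ϑ₄ F.θ₂ F z τ
            * (sqQuo K.ϑ₂ K.ϑ₄ F.θ₃ F z τ * sqQuo K.ϑ₂ K.ϑ₃ F.θ₄ F z τ)
            = (K.ϑ₂ τ ^ 2 * K.ϑ₃ τ ^ 2 * K.ϑ₄ τ ^ 2 * triQuo F z τ) ^ 2 := by
          simp only [sqQuo, triQuo]; ring
        rw [this, e2]
        ring
      have e4 := (hrel (z, τ) hq).2.2
      have hα' := hα _ hq
      have hβ' := hβ _ hq
      simp only at e4 hα' hβ' e1 e3 ⊢
      generalize sqQuo K.ϑ₃ K.ϑ₄ F.θ₂ F z τ = Q at e1 e3 e4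
      generalize sqQuo K.ϑ₂ K.ϑ₄ F.θ₃ F z τ = R at e1 e3 e4 ⊢
      generalize sqQuo K.ϑ₂ K.ϑ₃ F.θ₄ F z τ = S at e1 e3 e4 ⊢
      have e5 : R * S + Q * S + Q * R = 0 :=
        (mul_eq_zero.mp e1).resolve_left (neg_ne_zero.mpr hpi)
      -- With `α = A⁴ϑ₃⁴` and `β = B⁴ϑ₄⁴`: if `Q = 0`, then `RS = 0`, against `RS = αβ ≠ 0`.
      -- Otherwise `RS = 0` and `Q(R + S) = 0`, so `R = S = 0`.
      rcases mul_eq_zero.mp e3 with hQ | hRS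
      · rw [hQ] at e4 e5
        have : R * S = 0 := by linear_combination e5
        rw [this, zero_add, zero_add] at e4
        exact absurd e4.symm (mul_ne_zero hα' hβ')
      · have hQ : Q ≠ 0 := by
          rintro rfl
          rw [hRS, zero_add, zero_add] at e4
          exact absurd e4.symm (mul_ne_zero hα' hβ')
        have e6 : S + R = 0 := mul_left_cancel₀ hQ (by linear_combination e5 - hRS)
        rcases mul_eq_zero.mp hRS with h | h
        · exact ⟨h, by rw [h, add_zero] at e6; exact e6⟩
        · exact ⟨by rw [h, zero_add] at e6; exact e6, h⟩
    obtain ⟨z, τ⟩ := p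
    -- With `R = S = 0` the third relation leaves `Q = -α` or `Q = -β` at each nearby point.
    -- Differentiating the product in `τ` yields a nonzero multiple of `α(α - β)²` or `β(α - β)²`,
    -- so `α = β`, a contradiction.
    have hev : ∀ᶠ q : ℂ × ℂ in 𝓝 (z, τ), (sqQuo K.ϑ₃ K.ϑ₄ F.θ₂ F q.1 q.2 + A ^ 4 * K.ϑ₃ q.2 ^ 4)
        * (sqQuo K.ϑ₃ K.ϑ₄ F.θ₂ F q.1 q.2 + B ^ 4 * K.ϑ₄ q.2 ^ 4) = 0 := by
      filter_upwards [hY.eventually_nhds, hΩ.mem_nhds hp] with q hq hqΩ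
      rw [← (hrel q hqΩ).2.2, (hRS q hqΩ hq).1, zero_mul]
    have hevt : ∀ᶠ t in 𝓝 τ, (sqQuo K.ϑ₃ K.ϑ₄ F.θ₂ F z t + A ^ 4 * K.ϑ₃ t ^ 4)
        * (sqQuo K.ϑ₃ K.ϑ₄ F.θ₂ F z t + B ^ 4 * K.ϑ₄ t ^ 4) = 0 :=
      (Continuous.prodMk_right z).continuousAt.eventually hev
    obtain ⟨tQ, -, -⟩ := sqQuo_snd (hne _ hp) (hT _ hp) (hK _ hp)
    have hKp := hK _ hp
    have hd := ((tQ.fun_add ((hKp.three.fun_pow 4).const_mul (A ^ 4))).fun_mul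
      (tQ.fun_add ((hKp.four.fun_pow 4).const_mul (B ^ 4)))).unique
      ((hasDerivAt_const τ (0 : ℂ)).congr_of_eventuallyEq hevt)
    have h0 := hev.self_of_nhds
    obtain ⟨hR, hS⟩ := hRS _ hp hY
    have hY0 := hY.self_of_nhds
    have hα' := hα _ hp
    have hβ' := hβ _ hp
    have hAB' := hAB _ hp
    simp only at hd h0 hR hS hY0 hα' hβ' hAB'
    rw [hR, hS, hY0] at hd
    generalize sqQuo K.ϑ₃ K.ϑ₄ F.θ₂ F z τ = Q at hd h0
    have hI := I_ne_zero
    have hsub := sub_ne_zero.mpr hAB'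
    push_cast at hd
    simp only [mul_zero, add_zero, zero_mul, sub_zero, zero_add] at hd
    have hd2 : (Q * (4 * K.lam τ - π ^ 2 / 2 * (A ^ 4 * K.ϑ₃ τ ^ 4 + B ^ 4 * K.ϑ₄ τ ^ 4))
          + 4 * (A ^ 4 * K.ϑ₃ τ ^ 4) * (K.lam τ - π ^ 2 / 4 * (B ^ 4 * K.ϑ₄ τ ^ 4)))
          * (Q + B ^ 4 * K.ϑ₄ τ ^ 4)
        + (Q + A ^ 4 * K.ϑ₃ τ ^ 4)
          * (Q * (4 * K.lam τ - π ^ 2 / 2 * (A ^ 4 * K.ϑ₃ τ ^ 4 + B ^ 4 * K.ϑ₄ τ ^ 4))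
          + 4 * (B ^ 4 * K.ϑ₄ τ ^ 4) * (K.lam τ - π ^ 2 / 4 * (A ^ 4 * K.ϑ₃ τ ^ 4))) = 0 := by
      have hIpi : I / π ≠ 0 := div_ne_zero hI hpi
      apply mul_left_cancel₀ hIpi
      rw [mul_zero, ← hd]
      field_simp
    generalize A ^ 4 * K.ϑ₃ τ ^ 4 = α at hd2 h0 hα' hβ' hAB' hsub
    generalize B ^ 4 * K.ϑ₄ τ ^ 4 = β at hd2 h0 hα' hβ' hAB' hsub
    have hfin : ∀ x : ℂ, x ≠ 0 → (π : ℂ) ^ 2 / 2 * x * (α - β) * (α - β) = 0 → False :=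
      fun x hx hx0 => mul_ne_zero (mul_ne_zero (mul_ne_zero (div_ne_zero (pow_ne_zero 2 hpi)
        two_ne_zero) hx) hsub) hsub hx0
    rcases mul_eq_zero.mp h0 with h | h
    · have hQ : Q = -α := by linear_combination h
      rw [hQ] at hd2
      refine hfin α hα' ?_
      linear_combination -hd2
    · have hQ : Q = -β := by linear_combination h
      rw [hQ] at hd2
      refine hfin β hβ' ?_
      linear_combination -hd2
  -- If `f(p) ≠ 0`, then `f ≠ 0` nearby by continuity, and the relation would force `x₂x₃x₄ = 0` on
  -- an open set, against `main`.
  have hcont : ∀ (f : ℂ × ℂ → ℂ), (∀ p ∈ Ω, DifferentiableAt ℂ f p) →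
      (∀ p ∈ Ω, K.ϑ₂ p.2 ^ 2 * K.ϑ₃ p.2 ^ 2 * K.ϑ₄ p.2 ^ 2 * triQuo F p.1 p.2 * f p = 0) →
      ∀ p ∈ Ω, f p = 0 := by
    intro f hf h p hp
    by_contra hfp
    refine main p hp ?_
    filter_upwards [(hf p hp).continuousAt.eventually_ne hfp, hΩ.mem_nhds hp] with q hq hqΩ
    exact (mul_eq_zero.mp ((mul_eq_zero.mp (h q hqΩ)).resolve_right hq)).resolve_left (hP q hqΩ)
  constructor
  · refine hcont (fun p => sqQuo K.ϑ₂ K.ϑ₄ F.θ₃ F p.1 p.2 - sqQuo K.ϑ₃ K.ϑ₄ F.θ₂ F p.1 p.2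
      - B ^ 4 * K.ϑ₄ p.2 ^ 4) (fun q hq => ?_) (fun q hq => (hrel q hq).1) p hp
    have e1 := differentiableAt_sqQuo (hF.differentiableAt_quo hΩ hq).1
      (hK q hq).differentiableAt.2.1 (hK q hq).differentiableAt.2.2.1
    have e2 := differentiableAt_sqQuo (hF.differentiableAt_quo hΩ hq).2.1
      (hK q hq).differentiableAt.1 (hK q hq).differentiableAt.2.2.1
    exact (e2.fun_sub e1).fun_sub (((hK q hq).differentiableAt.2.2.1.fun_pow 4).const_mul _)
  · refine hcont (fun p => sqQuo K.ϑ₂ K.ϑ₃ F.θ₄ F p.1 p.2 - sqQuo K.ϑ₃ K.ϑ₄ F.θ₂ F p.1 p.2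
      - A ^ 4 * K.ϑ₃ p.2 ^ 4) (fun q hq => ?_) (fun q hq => (hrel q hq).2.1) p hp
    have e1 := differentiableAt_sqQuo (hF.differentiableAt_quo hΩ hq).1
      (hK q hq).differentiableAt.2.1 (hK q hq).differentiableAt.2.2.1
    have e2 := differentiableAt_sqQuo (hF.differentiableAt_quo hΩ hq).2.2.1
      (hK q hq).differentiableAt.1 (hK q hq).differentiableAt.2.1
    exact (e2.fun_sub e1).fun_sub (((hK q hq).differentiableAt.2.1.fun_pow 4).const_mul _)

end SolutionRelations

/-! ### Doubly periodic functions and values of quotients of theta functions -/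

/-- All values are taken on the compact period parallelogram, so Liouville's theorem applies. -/
lemma apply_eq_apply_of_doubly_periodic {f : ℂ → ℂ} (hf : Differentiable ℂ f) {τ : ℂ}
    (hτ : 0 < τ.im) (h1 : ∀ z, f (z + 1) = f z) (h2 : ∀ z, f (z + τ) = f z) (z w : ℂ) :
    f z = f w := by
  have h1' : ∀ (n : ℤ) z, f (z + n) = f z := fun n z => by
    have : Function.Periodic f 1 := h1
    simpa using this.int_mul n z
  have h2' : ∀ (n : ℤ) z, f (z + n * τ) = f z := fun n z => by
    have : Function.Periodic f τ := h2
    exact this.int_mul n z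
  apply hf.apply_eq_apply_of_bounded
  have hc : IsCompact ((fun p : ℝ × ℝ => f (p.1 + p.2 * τ)) ''
      (Set.Icc (0 : ℝ) 1 ×ˢ Set.Icc (0 : ℝ) 1)) := by
    apply (isCompact_Icc.prod isCompact_Icc).image
    have := hf.continuous
    fun_prop
  refine hc.isBounded.subset ?_
  rintro _ ⟨z, rfl⟩
  set y : ℝ := z.im / τ.im with hy
  set x : ℝ := z.re - y * τ.re with hx
  have hz : z = x + y * τ := by
    apply Complex.ext
    · simp [hx]
    · simp [hy, hτ.ne']
  refine ⟨(Int.fract x, Int.fract y), ⟨⟨Int.fract_nonneg x, (Int.fract_lt_one x).le⟩,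
    ⟨Int.fract_nonneg y, (Int.fract_lt_one y).le⟩⟩, ?_⟩
  have e : z = ((Int.fract x : ℝ) : ℂ) + ((Int.fract y : ℝ) : ℂ) * τ + (⌊y⌋ : ℤ) * τ + (⌊x⌋ : ℤ) := by
    have ex : (x : ℂ) = (Int.fract x : ℝ) + (⌊x⌋ : ℤ) := by
      exact_mod_cast (Int.fract_add_floor x).symm
    have ey : (y : ℂ) = (Int.fract y : ℝ) + (⌊y⌋ : ℤ) := by
      exact_mod_cast (Int.fract_add_floor y).symm
    rw [hz]
    nth_rewrite 1 [ex]
    nth_rewrite 1 [ey]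
    ring
  conv_rhs => rw [e, h1', h2']

variable {τ : ℂ}

lemma jθ₂_add_one_fst (z τ : ℂ) : jθ₂ (z + 1) τ = -jθ₂ z τ := by
  simp only [jθ₂_eq]
  rw [show z + 1 = z + 1 / 2 + 1 / 2 by ring, thetaSeries_χ₂_add_half, thetaSeries_χ₁_add_half]

lemma jθ₁_add_one_fst (z τ : ℂ) : jθ₁ (z + 1) τ = -jθ₁ z τ := by
  rw [jθ₁_eq_neg_jθ₂, jθ₁_eq_neg_jθ₂ z, show z + 1 + 1 / 2 = z + 1 / 2 + 1 by ring,
    jθ₂_add_one_fst]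

lemma jθ₂_add_tau (z τ : ℂ) : jθ₂ (z + τ) τ = cexp (-π * I * τ - 2 * π * I * z) * jθ₂ z τ := by
  rw [jθ₂_eq_jacobiTheta₂, jθ₂_eq_jacobiTheta₂, show z + τ + τ / 2 = z + τ / 2 + τ by ring,
    jacobiTheta₂_add_left', ← mul_assoc, ← mul_assoc, ← Complex.exp_add, ← Complex.exp_add]
  congr 2
  ring

lemma jθ₁_add_tau (z τ : ℂ) : jθ₁ (z + τ) τ = -(cexp (-π * I * τ - 2 * π * I * z) * jθ₁ z τ) := by
  rw [jθ₁_eq_neg_jθ₂, jθ₁_eq_neg_jθ₂ z, show z + τ + 1 / 2 = z + 1 / 2 + τ by ring, jθ₂_add_tau]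
  have : cexp (-π * I * τ - 2 * π * I * (z + 1 / 2))
      = -cexp (-π * I * τ - 2 * π * I * z) := by
    rw [show -π * I * τ - 2 * π * I * (z + 1 / 2) = -π * I * τ - 2 * π * I * z - π * I by ring,
      Complex.exp_sub, Complex.exp_pi_mul_I]
    ring
  rw [this]
  ring

lemma exists_Θ₁_ne_zero (hτ : 0 < τ.im) : ∃ z, Θ₁ 0 z τ ≠ 0 := by
  by_contra! hz
  have hder := hasDerivAt_thetaSeries_fst norm_χ₁_le 0 0 hτ
  have h0 : (fun z => Θ₁ 0 z τ) = fun _ => 0 := funext hz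
  rw [h0] at hder
  exact Θ₁_one_zero_ne_zero hτ (hder.unique (hasDerivAt_const _ _))

/-- At a common zero the quadratic relations make `θ₃` and `θ₄` vanish too, hence `θ₂` and `θ₃`
vanish at `(2u|2τ)`. The product formula then gives `θ₁(u+h)θ₁(u-h) = 0` for all `h`, although `θ₁`
is not identically zero. -/
lemma Θ₁_Θ₂_no_common_zero (hτ : 0 < τ.im) {u : ℂ} (h1 : Θ₁ 0 u τ = 0) (h2 : Θ₂ 0 u τ = 0) :
    False := by
  have n2 := Θ₂_zero_ne_zero hτ
  have r3 := Θ₄_sq_mul_Θ₁_sq hτ u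
  have r4 := Θ₃_sq_mul_Θ₁_sq hτ u
  rw [h1, h2] at r3 r4
  have h3 : Θ₃ 0 u τ = 0 := by
    have : Θ₂ 0 0 τ ^ 2 * Θ₃ 0 u τ ^ 2 = 0 := by linear_combination -r3
    simpa [n2] using this
  have h4 : Θ₄ 0 u τ = 0 := by
    have : Θ₂ 0 0 τ ^ 2 * Θ₄ 0 u τ ^ 2 = 0 := by linear_combination -r4
    simpa [n2] using this
  have hτ2 := im_two_mul_pos hτ
  have p3 := Θ₃_mul_Θ₃ hτ u u
  have p4 := Θ₄_mul_Θ₄ hτ u u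
  rw [h3, sub_self] at p3
  rw [h4, sub_self] at p4
  have d3 : Θ₃ 0 (u + u) (2 * τ) = 0 := by
    have : 2 * (Θ₃ 0 (u + u) (2 * τ) * Θ₃ 0 0 (2 * τ)) = 0 := by linear_combination -p3 - p4
    simpa [Θ₃_zero_ne_zero hτ2] using this
  have d2 : Θ₂ 0 (u + u) (2 * τ) = 0 := by
    have : 2 * (Θ₂ 0 (u + u) (2 * τ) * Θ₂ 0 0 (2 * τ)) = 0 := by linear_combination p4 - p3
    simpa [Θ₂_zero_ne_zero hτ2] using this
  have hprod : ∀ h, Θ₁ 0 (u + h) τ * Θ₁ 0 (u - h) τ = 0 := fun h => by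
    rw [Θ₁_mul_Θ₁ hτ, show u + h + (u - h) = u + u by ring, d2, d3]
    ring
  have hd := differentiable_thetaSeries norm_χ₁_le 0 hτ
  obtain ⟨z₁, hz₁⟩ := exists_Θ₁_ne_zero hτ
  have hz := eq_zero_of_mul_eq_zero_of_entire (f := fun h => Θ₁ 0 (u + h) τ)
    (g := fun h => Θ₁ 0 (u - h) τ) (hd.comp (by fun_prop)) (hd.comp (by fun_prop)) hprod
    (z₀ := z₁ - u) (by simpa using hz₁) (u - z₁)
  exact hz₁ (by simpa using hz)

/-- The elliptic function `θ₂²/θ₁²` takes every finite value: if it omitted `κ`, then `θ₁²/(θ₂² -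
κθ₁²)` would be entire and doubly periodic, hence constant, hence zero as at `z = 0`. -/
lemma exists_Θ₂_sq_eq (hτ : 0 < τ.im) (κ : ℂ) :
    ∃ u : ℂ, Θ₁ 0 u τ ≠ 0 ∧ Θ₂ 0 u τ ^ 2 = κ * Θ₁ 0 u τ ^ 2 := by
  by_contra! hcon
  have hne : ∀ u, jθ₂ u τ ^ 2 - κ * jθ₁ u τ ^ 2 ≠ 0 := by
    intro u hu
    rw [jθ₁_eq, jθ₂_eq] at hu
    by_cases h1 : Θ₁ 0 u τ = 0
    · refine Θ₁_Θ₂_no_common_zero hτ h1 ?_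
      rw [h1] at hu
      simpa using hu
    · exact hcon u h1 (sub_eq_zero.mp hu)
  have d1 : Differentiable ℂ fun u => jθ₁ u τ := by
    simp only [jθ₁_eq]; exact differentiable_thetaSeries norm_χ₁_le 0 hτ
  have d2 : Differentiable ℂ fun u => jθ₂ u τ := by
    simp only [jθ₂_eq]; exact differentiable_thetaSeries norm_χ₂_le 0 hτ
  have hd : Differentiable ℂ fun u => jθ₁ u τ ^ 2 / (jθ₂ u τ ^ 2 - κ * jθ₁ u τ ^ 2) :=
    (d1.fun_pow 2).fun_div ((d2.fun_pow 2).fun_sub ((d1.fun_pow 2).const_mul κ)) hne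
  have hconst := apply_eq_apply_of_doubly_periodic hd hτ
    (fun z => by rw [jθ₁_add_one_fst, jθ₂_add_one_fst, neg_sq, neg_sq])
    (fun z => by
      rw [jθ₁_add_tau, jθ₂_add_tau, neg_sq, mul_pow, mul_pow, ← mul_left_comm, ← mul_sub,
        mul_div_mul_left _ _ (pow_ne_zero 2 (Complex.exp_ne_zero _))])
  have h10 : jθ₁ 0 τ = 0 := by rw [jθ₁_eq]; exact thetaSeries_χ₁_zero τ (by norm_num)
  have hz : ∀ u, Θ₁ 0 u τ = 0 := fun u => by
    have := hconst u 0
    rw [h10] at this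
    simp only [ne_eq, OfNat.ofNat_ne_zero, not_false_eq_true, zero_pow, zero_div] at this
    have h2 := (div_eq_zero_iff.mp this).resolve_right (hne u)
    rw [← jθ₁_eq]
    exact pow_eq_zero_iff (two_ne_zero) |>.mp h2
  obtain ⟨z, hz1⟩ := exists_Θ₁_ne_zero hτ
  exact hz1 (hz z)

/-! ### Uniqueness of solutions with given initial values -/

/-- The coefficients as a vector. -/
noncomputable def Coeffs.vec (K : Coeffs) (τ : ℂ) : Fin 4 → ℂ := ![K.ϑ₂ τ, K.ϑ₃ τ, K.ϑ₄ τ, K.lam τ]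

/-- The unknowns as a vector. -/
def Unknowns.vec (F : Unknowns) (p : ℂ × ℂ) : Fin 5 → ℂ :=
  ![F.θ₁ p.1 p.2, F.θ₂ p.1 p.2, F.θ₃ p.1 p.2, F.θ₄ p.1 p.2, F.dθ₁ p.1 p.2]

/-- The right-hand sides of the `z`-system. -/
noncomputable def zField (q : (Fin 4 → ℂ) × (Fin 5 → ℂ)) : Fin 5 → ℂ :=
  ![q.2 4,
    q.2 4 / q.2 0 * q.2 1 - π * q.1 0 ^ 2 * (q.2 2 * q.2 3 / q.2 0),
    q.2 4 / q.2 0 * q.2 2 - π * q.1 1 ^ 2 * (q.2 1 * q.2 3 / q.2 0),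
    q.2 4 / q.2 0 * q.2 3 - π * q.1 2 ^ 2 * (q.2 1 * q.2 2 / q.2 0),
    q.2 4 ^ 2 / q.2 0 - π ^ 2 * q.1 1 ^ 2 * q.1 2 ^ 2 * (q.2 1 ^ 2 / q.2 0)
      - 4 * q.1 3 * q.2 0]

/-- The right-hand sides of the `τ`-system. -/
noncomputable def tauField (q : (Fin 4 → ℂ) × (Fin 5 → ℂ)) : Fin 5 → ℂ :=
  ![-I / (4 * π) * (q.2 4 ^ 2 / q.2 0 ^ 2) * q.2 0
      + I / 4 * π * (q.1 1 ^ 2 * q.1 2 ^ 2 * q.2 1 ^ 2) * (q.2 0 / q.2 0 ^ 2)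
      + I / π * q.1 3 * q.2 0,
    -I / (4 * π) * (q.2 4 ^ 2 / q.2 0 ^ 2) * q.2 1
      + I / 2 * q.1 0 ^ 2 * q.2 4 * (q.2 2 * q.2 3 / q.2 0 ^ 2)
      + I / 4 * π * (q.1 1 ^ 2 * q.1 2 ^ 2 * q.2 1 ^ 2
          - q.1 0 ^ 2 * q.1 2 ^ 2 * q.2 2 ^ 2
          - q.1 0 ^ 2 * q.1 1 ^ 2 * q.2 3 ^ 2) * (q.2 1 / q.2 0 ^ 2)
      + I / π * q.1 3 * q.2 1,
    -I / (4 * π) * (q.2 4 ^ 2 / q.2 0 ^ 2) * q.2 2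
      + I / 2 * q.1 1 ^ 2 * q.2 4 * (q.2 3 * q.2 1 / q.2 0 ^ 2)
      + I / 4 * π * (q.1 1 ^ 2 * q.1 2 ^ 2 * q.2 1 ^ 2
          - q.1 1 ^ 2 * q.1 0 ^ 2 * q.2 3 ^ 2
          - q.1 1 ^ 2 * q.1 2 ^ 2 * q.2 1 ^ 2) * (q.2 2 / q.2 0 ^ 2)
      + I / π * q.1 3 * q.2 2,
    -I / (4 * π) * (q.2 4 ^ 2 / q.2 0 ^ 2) * q.2 3
      + I / 2 * q.1 2 ^ 2 * q.2 4 * (q.2 1 * q.2 2 / q.2 0 ^ 2)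
      + I / 4 * π * (q.1 1 ^ 2 * q.1 2 ^ 2 * q.2 1 ^ 2
          - q.1 2 ^ 2 * q.1 1 ^ 2 * q.2 1 ^ 2
          - q.1 2 ^ 2 * q.1 0 ^ 2 * q.2 2 ^ 2) * (q.2 3 / q.2 0 ^ 2)
      + I / π * q.1 3 * q.2 3,
    -I / (4 * π) * (q.2 4 ^ 3 / q.2 0 ^ 2)
      + 3 * I / π * (π ^ 2 / 4 * q.1 1 ^ 2 * q.1 2 ^ 2 * (q.2 1 ^ 2 / q.2 0 ^ 2)
          + q.1 3) * q.2 4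
      - I / 2 * π ^ 2 * q.1 0 ^ 2 * q.1 1 ^ 2 * q.1 2 ^ 2
          * (q.2 1 * q.2 2 * q.2 3 / q.2 0 ^ 2)]

lemma contDiffAt_zField {q : (Fin 4 → ℂ) × (Fin 5 → ℂ)} (h : q.2 0 ≠ 0) :
    ContDiffAt ℂ 1 zField q := by
  rw [contDiffAt_pi]
  intro i
  fin_cases i <;> simp [zField] <;> fun_prop (disch := assumption)

lemma contDiffAt_tauField {q : (Fin 4 → ℂ) × (Fin 5 → ℂ)} (h : q.2 0 ≠ 0) :
    ContDiffAt ℂ 1 tauField q := by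
  have h2 := pow_ne_zero 2 h
  rw [contDiffAt_pi]
  intro i
  fin_cases i <;> simp [tauField] <;> fun_prop (disch := assumption)

section Uniqueness

variable {A B : ℂ} {K : Coeffs} {F G : Unknowns} {Ω : Set (ℂ × ℂ)} {p : ℂ × ℂ}

lemma IsSolutionOn.hasFDerivAt_vec (hF : IsSolutionOn K F Ω) (hΩ : IsOpen Ω) (hp : p ∈ Ω) :
    HasFDerivAt F.vec ((ContinuousLinearMap.fst ℂ ℂ ℂ).smulRight (zField (K.vec p.2, F.vec p))
      + (ContinuousLinearMap.snd ℂ ℂ ℂ).smulRight (tauField (K.vec p.2, F.vec p))) p := by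
  obtain ⟨h1, h2, h3, h4, h5, h⟩ := hF
  have hn := hΩ.mem_nhds hp
  have hpart : ∀ (g : ℂ × ℂ → ℂ) (u v : ℂ), DifferentiableAt ℂ g p →
      HasDerivAt (fun w => g (w, p.2)) u p.1 → HasDerivAt (fun t => g (p.1, t)) v p.2 →
      HasFDerivAt g (u • ContinuousLinearMap.fst ℂ ℂ ℂ + v • ContinuousLinearMap.snd ℂ ℂ ℂ) p := by
    intro g u v hg hu hv
    have h1 := (hg.hasFDerivAt (x := (p.1, p.2))).comp_hasDerivAt p.1
      ((hasDerivAt_id p.1).prodMk (hasDerivAt_const p.1 p.2))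
    have h2 := (hg.hasFDerivAt (x := (p.1, p.2))).comp_hasDerivAt p.2
      ((hasDerivAt_const p.2 p.1).prodMk (hasDerivAt_id p.2))
    have e1 := h1.unique hu
    have e2 := h2.unique hv
    refine hg.hasFDerivAt.congr_fderiv ?_
    ext
    · simpa using e1
    · simpa using e2
  obtain ⟨-, ⟨z1, z2, z3, z4, z5⟩, t1, t2, t3, t4, t5⟩ := h p hp
  rw [hasFDerivAt_pi']
  intro i
  fin_cases i
  · refine (hpart _ _ _ (h1.differentiableAt hn) z1 t1).congr_fderiv ?_
    ext <;> simp [zField, tauField, Coeffs.vec, Unknowns.vec]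
  · refine (hpart _ _ _ (h2.differentiableAt hn) z2 t2).congr_fderiv ?_
    ext <;> simp [zField, tauField, Coeffs.vec, Unknowns.vec]
  · refine (hpart _ _ _ (h3.differentiableAt hn) z3 t3).congr_fderiv ?_
    ext <;> simp [zField, tauField, Coeffs.vec, Unknowns.vec]
  · refine (hpart _ _ _ (h4.differentiableAt hn) z4 t4).congr_fderiv ?_
    ext <;> simp [zField, tauField, Coeffs.vec, Unknowns.vec]
  · refine (hpart _ _ _ (h5.differentiableAt hn) z5 t5).congr_fderiv ?_
    ext <;> simp [zField, tauField, Coeffs.vec, Unknowns.vec]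

lemma CoeffODE.continuousAt_vec {τ : ℂ} (hK : CoeffODE A B K τ) : ContinuousAt K.vec τ := by
  rw [continuousAt_pi]
  intro i
  fin_cases i
  · exact hK.two.continuousAt
  · exact hK.three.continuousAt
  · exact hK.four.continuousAt
  · exact hK.lam.continuousAt

/-- Along a segment from `p` both solutions satisfy the same ordinary differential equation, with a
field that is locally Lipschitz because `θ₁(p) ≠ 0`; Grönwall's inequality forces their difference
to vanish. -/
lemma eventually_vec_eq (hΩ : IsOpen Ω) (hF : IsSolutionOn K F Ω) (hG : IsSolutionOn K G Ω)
    (hp : p ∈ Ω) (hK : CoeffODE A B K p.2) (h : F.vec p = G.vec p) :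
    ∀ᶠ q in 𝓝 p, F.vec q = G.vec q := by
  have h0 : (F.vec p) 0 ≠ 0 := (hF.2.2.2.2.2 p hp).1
  obtain ⟨κ, N, hN, hL⟩ := ((contDiffAt_zField (q := (K.vec p.2, F.vec p)) h0).prodMk
    (contDiffAt_tauField (q := (K.vec p.2, F.vec p)) h0)).exists_lipschitzOnWith
  have cK : ContinuousAt (fun q : ℂ × ℂ => K.vec q.2) p :=
    ContinuousAt.comp (g := K.vec) hK.continuousAt_vec continuousAt_snd
  have cF : ContinuousAt (fun q : ℂ × ℂ => (K.vec q.2, F.vec q)) p :=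
    cK.prodMk (hF.hasFDerivAt_vec hΩ hp).continuousAt
  have cG : ContinuousAt (fun q : ℂ × ℂ => (K.vec q.2, G.vec q)) p :=
    cK.prodMk (hG.hasFDerivAt_vec hΩ hp).continuousAt
  have eF := cF.preimage_mem_nhds hN
  have eG : _ ∈ 𝓝 p := cG.preimage_mem_nhds (by rw [← h]; exact hN)
  obtain ⟨ρ, hρ, hball⟩ := Metric.mem_nhds_iff.mp
    (inter_mem (hΩ.mem_nhds hp) (inter_mem eF eG))
  filter_upwards [Metric.ball_mem_nhds p hρ] with q hq
  -- The segment `p + tv`, `0 ≤ t ≤ 1`, stays in the ball on which the Lipschitz estimate holds for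
  -- both solutions.
  set v : ℂ × ℂ := q - p with hv
  have hγ : ∀ t ∈ Set.Icc (0 : ℝ) 1, p + t • v ∈ Metric.ball p ρ := by
    intro t ht
    have hvρ : ‖v‖ < ρ := by rwa [hv, ← dist_eq_norm]
    rw [Metric.mem_ball, dist_eq_norm, add_sub_cancel_left, norm_smul, Real.norm_of_nonneg ht.1]
    calc t * ‖v‖ ≤ 1 * ‖v‖ := by gcongr; exact ht.2
      _ < ρ := by rwa [one_mul]
  have hder : ∀ (H : Unknowns), IsSolutionOn K H Ω → ∀ t ∈ Set.Icc (0 : ℝ) 1,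
      HasDerivAt (fun t : ℝ => H.vec (p + t • v))
        (v.1 • zField (K.vec (p + t • v).2, H.vec (p + t • v))
          + v.2 • tauField (K.vec (p + t • v).2, H.vec (p + t • v))) t := by
    intro H hH t ht
    have h1 := (hH.hasFDerivAt_vec hΩ (hball (hγ t ht)).1).restrictScalars ℝ
    have h2 : HasDerivAt (fun t : ℝ => p + t • v) v t := by
      simpa using ((hasDerivAt_id t).smul_const v).const_add p
    exact h1.comp_hasDerivAt t h2
  have key := eq_zero_of_abs_deriv_le_mul_abs_self_of_eq_zero_right
    (f := fun t : ℝ => F.vec (p + t • v) - G.vec (p + t • v))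
    (f' := fun t : ℝ => (v.1 • zField (K.vec (p + t • v).2, F.vec (p + t • v))
          + v.2 • tauField (K.vec (p + t • v).2, F.vec (p + t • v)))
        - (v.1 • zField (K.vec (p + t • v).2, G.vec (p + t • v))
          + v.2 • tauField (K.vec (p + t • v).2, G.vec (p + t • v))))
    (K := (‖v.1‖ + ‖v.2‖) * κ) (a := 0) (b := 1) ?_ ?_ ?_ ?_ 1 (by simp)
  · have e : p + (1 : ℝ) • v = q := by rw [one_smul, hv]; abel
    rw [e] at key
    exact sub_eq_zero.mp key
  · intro t ht
    exact ((hder F hF t ht).sub (hder G hG t ht)).continuousAt.continuousWithinAt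
  · intro t ht
    exact ((hder F hF t ⟨ht.1, ht.2.le⟩).sub (hder G hG t ⟨ht.1, ht.2.le⟩)).hasDerivWithinAt
  · simp [h]
  · intro t ht
    have hb := (hball (hγ t ⟨ht.1, ht.2.le⟩)).2
    have hl := hL.dist_le_mul _ hb.1 _ hb.2
    rw [Prod.dist_eq, Prod.dist_eq, dist_self, max_eq_right dist_nonneg] at hl
    obtain ⟨l1, l2⟩ := max_le_iff.mp hl
    simp only [dist_eq_norm] at l1 l2
    have e : ∀ a b a' b' : Fin 5 → ℂ, (v.1 • a + v.2 • b) - (v.1 • a' + v.2 • b')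
        = v.1 • (a - a') + v.2 • (b - b') := fun a b a' b' => by
      rw [smul_sub, smul_sub]; abel
    rw [e]
    refine (norm_add_le _ _).trans ?_
    rw [norm_smul, norm_smul, add_mul, add_mul, mul_assoc, mul_assoc]
    gcongr

/-- The explicit `G` is only known to be a solution where its first component is nonzero, but it is
continuous on `Ω`. Where `F` and `G` agree, the first component of `G` is that of `F`, hence
nonzero. So the set of local agreement is open and relatively closed in `Ω`. -/
lemma eqOn_of_eq (hΩ : IsOpen Ω) (hc : IsPreconnected Ω) (hK : ∀ p ∈ Ω, CoeffODE A B K p.2)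
    (hF : IsSolutionOn K F Ω) (hGc : ContinuousOn G.vec Ω)
    (hG : IsSolutionOn K G {p | p ∈ Ω ∧ G.θ₁ p.1 p.2 ≠ 0}) (hp : p ∈ Ω)
    (h : F.vec p = G.vec p) : ∀ q ∈ Ω, F.vec q = G.vec q := by
  have hΩ' : IsOpen {p | p ∈ Ω ∧ G.θ₁ p.1 p.2 ≠ 0} := by
    have h1 : ContinuousOn (fun p => G.vec p 0) Ω := (continuous_apply 0).comp_continuousOn hGc
    exact h1.isOpen_inter_preimage hΩ (isOpen_compl_singleton (x := (0 : ℂ)))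
  have hF' : IsSolutionOn K F {p | p ∈ Ω ∧ G.θ₁ p.1 p.2 ≠ 0} := by
    obtain ⟨h1, h2, h3, h4, h5, h⟩ := hF
    have hs : {p | p ∈ Ω ∧ G.θ₁ p.1 p.2 ≠ 0} ⊆ Ω := fun p hp => hp.1
    exact ⟨h1.mono hs, h2.mono hs, h3.mono hs, h4.mono hs, h5.mono hs, fun p hp => h p hp.1⟩
  have hloc : ∀ q ∈ Ω, F.vec q = G.vec q → ∀ᶠ x in 𝓝 q, F.vec x = G.vec x := by
    intro q hq he
    have h0 : F.θ₁ q.1 q.2 ≠ 0 := (hF.2.2.2.2.2 q hq).1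
    have h1 : F.θ₁ q.1 q.2 = G.θ₁ q.1 q.2 := congrFun he 0
    exact eventually_vec_eq hΩ' hF' hG ⟨hq, by rwa [← h1]⟩ (hK q hq) he
  have hsub : Ω ⊆ {q | ∀ᶠ x in 𝓝 q, F.vec x = G.vec x} := by
    refine hc.subset_of_closure_inter_subset isOpen_setOfPred_eventually_nhds ⟨p, hp, hloc p hp h⟩ ?_
    rintro q ⟨hq, hqΩ⟩
    refine hloc q hqΩ ?_
    by_contra hne
    have cF : ContinuousAt F.vec q := (hF.hasFDerivAt_vec hΩ hqΩ).continuousAt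
    have cG : ContinuousAt G.vec q := hGc.continuousAt (hΩ.mem_nhds hqΩ)
    have hev : ∀ᶠ x in 𝓝 q, F.vec x ≠ G.vec x := cF.ne_iff_eventually_ne cG |>.mp hne
    obtain ⟨x, hx1, hx2⟩ := (mem_closure_iff_frequently.mp hq).and_eventually hev |>.exists
    exact hx2 hx1.self_of_nhds
  exact fun q hq => (hsub hq).self_of_nhds

lemma agreeOn_iff_vec : F.AgreeOn G Ω ↔ ∀ q ∈ Ω, F.vec q = G.vec q := by
  refine forall₂_congr fun q _ => ?_
  simp [Unknowns.vec, Matrix.vecCons_inj]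

end Uniqueness

/-! ### Matching initial values -/

lemma exists_sign_mul_of_sq_eq {x y : ℂ} (h : x ^ 2 = y ^ 2) :
    ∃ e : ℂ, (e = 1 ∨ e = -1) ∧ x = e * y := by
  rcases sq_eq_sq_iff_eq_or_eq_neg.mp h with h | h
  · exact ⟨1, Or.inl rfl, by rw [h, one_mul]⟩
  · exact ⟨-1, Or.inr rfl, by rw [h, neg_one_mul]⟩

/-- The quotients of the theta functions parametrize the hypersurface. -/
lemma exists_theta_quotients {τ A B d x₂ x₃ x₄ : ℂ} (hτ : 0 < τ.im) (hA : A ≠ 0) (hB : B ≠ 0)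
    (hd : d ≠ 0)
    (h3 : d ^ 2 * Θ₂ 0 0 τ ^ 2 * x₃ ^ 2 = Θ₃ 0 0 τ ^ 2 * x₂ ^ 2 / A ^ 2 + B ^ 2 * Θ₄ 0 0 τ ^ 2)
    (h4 : d ^ 2 * Θ₂ 0 0 τ ^ 2 * x₄ ^ 2 = Θ₄ 0 0 τ ^ 2 * x₂ ^ 2 / B ^ 2 + A ^ 2 * Θ₃ 0 0 τ ^ 2) :
    ∃ u e₂ e₃ e₄ : ℂ, Θ₁ 0 u τ ≠ 0 ∧ (e₂ = 1 ∨ e₂ = -1) ∧ (e₃ = 1 ∨ e₃ = -1) ∧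
      (e₄ = 1 ∨ e₄ = -1) ∧ e₂ * e₃ * e₄ = 1 ∧ x₂ * Θ₁ 0 u τ = e₂ * (A * B * Θ₂ 0 u τ) ∧
      x₃ * Θ₁ 0 u τ = e₃ * (B / d * Θ₃ 0 u τ) ∧ x₄ * Θ₁ 0 u τ = e₄ * (A / d * Θ₄ 0 u τ) := by
  -- The argument `u` is chosen to match `x₂²`; the quadratic theta relations then match `x₃²` and
  -- `x₄²` automatically, and only signs remain.
  obtain ⟨u, hu, hu2⟩ := exists_Θ₂_sq_eq hτ (x₂ ^ 2 / (A ^ 2 * B ^ 2))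
  have n2 := Θ₂_zero_ne_zero hτ
  have r3 := Θ₄_sq_mul_Θ₁_sq hτ u
  have r4 := Θ₃_sq_mul_Θ₁_sq hτ u
  have s2 : (x₂ * Θ₁ 0 u τ) ^ 2 = (A * B * Θ₂ 0 u τ) ^ 2 := by
    rw [mul_pow (A * B), hu2]
    field_simp
  have hnn : d ^ 2 * Θ₂ 0 0 τ ^ 2 ≠ 0 := mul_ne_zero (pow_ne_zero 2 hd) (pow_ne_zero 2 n2)
  have s3 : (x₃ * Θ₁ 0 u τ) ^ 2 = (B / d * Θ₃ 0 u τ) ^ 2 := by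
    apply mul_left_cancel₀ hnn
    have e : Θ₂ 0 0 τ ^ 2 * Θ₃ 0 u τ ^ 2 = Θ₄ 0 0 τ ^ 2 * Θ₁ 0 u τ ^ 2
        + Θ₃ 0 0 τ ^ 2 * (x₂ ^ 2 / (A ^ 2 * B ^ 2) * Θ₁ 0 u τ ^ 2) := by
      rw [← hu2]; linear_combination -r3
    calc d ^ 2 * Θ₂ 0 0 τ ^ 2 * (x₃ * Θ₁ 0 u τ) ^ 2
        = (d ^ 2 * Θ₂ 0 0 τ ^ 2 * x₃ ^ 2) * Θ₁ 0 u τ ^ 2 := by ring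
      _ = B ^ 2 * (Θ₂ 0 0 τ ^ 2 * Θ₃ 0 u τ ^ 2) := by rw [h3, e]; field_simp; ring
      _ = d ^ 2 * Θ₂ 0 0 τ ^ 2 * (B / d * Θ₃ 0 u τ) ^ 2 := by field_simp
  have s4 : (x₄ * Θ₁ 0 u τ) ^ 2 = (A / d * Θ₄ 0 u τ) ^ 2 := by
    apply mul_left_cancel₀ hnn
    have e : Θ₂ 0 0 τ ^ 2 * Θ₄ 0 u τ ^ 2 = Θ₃ 0 0 τ ^ 2 * Θ₁ 0 u τ ^ 2
        + Θ₄ 0 0 τ ^ 2 * (x₂ ^ 2 / (A ^ 2 * B ^ 2) * Θ₁ 0 u τ ^ 2) := by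
      rw [← hu2]; linear_combination -r4
    calc d ^ 2 * Θ₂ 0 0 τ ^ 2 * (x₄ * Θ₁ 0 u τ) ^ 2
        = (d ^ 2 * Θ₂ 0 0 τ ^ 2 * x₄ ^ 2) * Θ₁ 0 u τ ^ 2 := by ring
      _ = A ^ 2 * (Θ₂ 0 0 τ ^ 2 * Θ₄ 0 u τ ^ 2) := by rw [h4, e]; field_simp; ring
      _ = d ^ 2 * Θ₂ 0 0 τ ^ 2 * (A / d * Θ₄ 0 u τ) ^ 2 := by field_simp
  obtain ⟨e₂, he2, q2⟩ := exists_sign_mul_of_sq_eq s2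
  obtain ⟨e₃, he3, q3⟩ := exists_sign_mul_of_sq_eq s3
  obtain ⟨e₄, he4, q4⟩ := exists_sign_mul_of_sq_eq s4
  have hsign : e₂ * e₃ * e₄ = 1 ∨ e₂ * e₃ * e₄ = -1 := by
    rcases he2 with rfl | rfl <;> rcases he3 with rfl | rfl <;> rcases he4 with rfl | rfl <;>
      norm_num
  have hneg : ∀ e : ℂ, (e = 1 ∨ e = -1) → (-e = 1 ∨ -e = -1) := by
    rintro e (rfl | rfl)
    · exact Or.inr rfl
    · exact Or.inl (neg_neg 1)
  rcases hsign with h | h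
  · exact ⟨u, e₂, e₃, e₄, hu, he2, he3, he4, h, q2, q3, q4⟩
  -- Passing from `u` to `-u` reverses `θ₁` alone, hence all three signs, and so corrects a product
  -- `-1`.
  · have m1 : Θ₁ 0 (-u) τ = -Θ₁ 0 u τ := by rw [← jθ₁_eq, jθ₁_neg, jθ₁_eq]
    have m2 : Θ₂ 0 (-u) τ = Θ₂ 0 u τ := by rw [← jθ₂_eq, jθ₂_neg, jθ₂_eq]
    have m3 : Θ₃ 0 (-u) τ = Θ₃ 0 u τ := by rw [← jθ₃_eq, jθ₃_neg, jθ₃_eq]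
    have m4 : Θ₄ 0 (-u) τ = Θ₄ 0 u τ := by rw [← jθ₄_eq, jθ₄_neg, jθ₄_eq]
    refine ⟨-u, -e₂, -e₃, -e₄, ?_, hneg _ he2, hneg _ he3, hneg _ he4, by linear_combination -h,
      ?_, ?_, ?_⟩
    · rw [m1]; exact neg_ne_zero.mpr hu
    · rw [m1, m2]; linear_combination -q2
    · rw [m1, m3]; linear_combination -q3
    · rw [m1, m4]; linear_combination -q4

section Matching

variable {a b c δ A B d : ℂ} {U : Set ℂ} {r : ℂ → ℂ} {Ω : Set (ℂ × ℂ)} {F : Unknowns}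

/-- The last inequality is Jacobi's identity `ϑ₃⁴ = ϑ₂⁴ + ϑ₄⁴` together with `ϑ₂ ≠ 0`. -/
lemma generalCoeffs_nondegenerate {τ : ℂ} (hA : A ≠ 0) (hB : B ≠ 0) (hd : d ≠ 0)
    (hs : c * τ + δ ≠ 0) (hT : 0 < (moeb a b c δ τ).im) (hr2 : r τ ^ 2 = c * τ + δ) :
    let K := generalCoeffs a b c δ A B d r
    K.ϑ₂ τ ≠ 0 ∧ K.ϑ₃ τ ≠ 0 ∧ K.ϑ₄ τ ≠ 0 ∧ A ^ 4 * K.ϑ₃ τ ^ 4 ≠ B ^ 4 * K.ϑ₄ τ ^ 4 := by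
  have hr0 : r τ ≠ 0 := by intro h; apply hs; rw [← hr2, h]; simp
  have n2 := Θ₂_zero_ne_zero hT
  have n3 := Θ₃_zero_ne_zero hT
  have n4 := Θ₄_zero_ne_zero hT
  simp only [generalCoeffs, jθ₂_eq, jθ₃_eq, jθ₄_eq]
  refine ⟨mul_ne_zero hd (div_ne_zero n2 hr0), mul_ne_zero (one_div_ne_zero hA)
    (div_ne_zero n3 hr0), mul_ne_zero (one_div_ne_zero hB) (div_ne_zero n4 hr0), fun h => ?_⟩
  have h4 := Θ₃_zero_pow_four hT
  field_simp at h
  rw [h4] at h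
  exact pow_ne_zero 4 n2 (by linear_combination h)

lemma exists_matching (hdet : a * δ - b * c = 1) (hA : A ≠ 0) (hB : B ≠ 0) (hd : d ≠ 0)
    (hU : IsOpen U) (hUT : ∀ τ ∈ U, c * τ + δ ≠ 0 ∧ 0 < (moeb a b c δ τ).im)
    (hrc : ContinuousOn r U) (hrs : ∀ τ ∈ U, r τ ^ 2 = c * τ + δ) (hc : c ≠ 0) (hΩ : IsOpen Ω)
    (hΩU : ∀ p ∈ Ω, p.2 ∈ U) (hF : IsSolutionOn (generalCoeffs a b c δ A B d r) F Ω)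
    {p : ℂ × ℂ} (hp : p ∈ Ω) :
    ∃ (ε : Fin 4 → ℂ) (C D E : ℂ), AdmissibleSigns ε ∧ C ≠ 0 ∧
      F.vec p = (generalIntegral a b c δ A B d r ε C D E).vec p := by
  obtain ⟨z, τ⟩ := p
  have hτ := hΩU _ hp
  obtain ⟨hs, hT⟩ := hUT _ hτ
  have hr2 := hrs _ hτ
  have hnd := fun p hp => generalCoeffs_nondegenerate (b := b) hA hB hd (hUT _ (hΩU p hp)).1
    (hUT _ (hΩU p hp)).2 (hrs _ (hΩU p hp))
  obtain ⟨k3, k4⟩ := hF.hypersurface hΩ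
    (fun p hp => coeffODE_generalCoeffs hdet hA hB hU hUT hrc hrs (hΩU p hp)) hA hB
    (fun p hp => (hnd p hp).1) (fun p hp => (hnd p hp).2.1) (fun p hp => (hnd p hp).2.2.1)
    (fun p hp => (hnd p hp).2.2.2) hp
  have hF1 : F.θ₁ z τ ≠ 0 := (hF.2.2.2.2.2 _ hp).1
  simp only at hτ hs hT hr2 k3 k4
  have n2 := Θ₂_zero_ne_zero hT
  have n3 := Θ₃_zero_ne_zero hT
  have n4 := Θ₄_zero_ne_zero hT
  have hr0 : r τ ≠ 0 := by intro h; apply hs; rw [← hr2, h]; simp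
  simp only [sqQuo, generalCoeffs, jθ₂_eq, jθ₃_eq, jθ₄_eq] at k3 k4
  obtain ⟨u, e₂, e₃, e₄, hu, he2, he3, he4, hprod, q2, q3, q4⟩ := exists_theta_quotients
    (x₂ := quo F.θ₂ F z τ) (x₃ := quo F.θ₃ F z τ) (x₄ := quo F.θ₄ F z τ) hT hA hB hd
    (by
      field_simp at k3
      rw [mul_zero] at k3
      have := (mul_eq_zero.mp k3).resolve_left (pow_ne_zero 2 n4)
      field_simp
      linear_combination this)
    (by
      field_simp at k4
      rw [mul_zero] at k4
      have := (mul_eq_zero.mp k4).resolve_left (pow_ne_zero 2 n3)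
      field_simp
      linear_combination this)
  have hpi := pi_ne_zero'
  have hI := I_ne_zero
  set s := c * τ + δ with hsdef
  -- Solves for the prescribed `θ₁'/θ₁`: its Gaussian part is `-2πic(z+E)/(cτ+δ)`, so `E` is
  -- determined because `c ≠ 0`. Afterwards `D` places the argument at `u`, and `C` fixes the value
  -- of `θ₁`.
  set E : ℂ := -z + (Θ₁ 1 u (moeb a b c δ τ) / (s * Θ₁ 0 u (moeb a b c δ τ)) - quo F.dθ₁ F z τ)
    * s / (2 * π * I * c) with hE
  set D : ℂ := u - (z + E) / s with hD
  have hu' : (z + E) / s + D = u := by rw [hD]; ring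
  have hγ : gaussLog c δ E z τ
      = quo F.dθ₁ F z τ - Θ₁ 1 u (moeb a b c δ τ) / (s * Θ₁ 0 u (moeb a b c δ τ)) := by
    rw [gaussLog, ← hsdef, hE]
    field_simp
    ring
  have hg : gaussFactor c δ r E z τ ≠ 0 := gaussFactor_ne_zero hs hr2
  set g := gaussFactor c δ r E z τ with hgdef
  set C : ℂ := F.θ₁ z τ * (A * B) / (d * g * Θ₁ 0 u (moeb a b c δ τ)) with hC
  have hC0 : C ≠ 0 := div_ne_zero (mul_ne_zero hF1 (mul_ne_zero hA hB))
    (mul_ne_zero (mul_ne_zero hd hg) hu)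
  refine ⟨![1, e₂, e₃, e₄], C, D, E, ⟨?_, ?_⟩, hC0, ?_⟩
  · intro k
    fin_cases k
    · exact Or.inl rfl
    · exact he2
    · exact he3
    · exact he4
  · simpa using hprod
  · obtain ⟨g1, g2, g3, g4, g5⟩ := generalIntegral_agreeOn (A := A) (B := B) (d := d) (r := r) hUT
      ![1, e₂, e₃, e₄] C D E (z, τ) hτ
    simp only [transUnknowns, transTerm, ← hsdef, hu', ← hgdef, hγ] at g1 g2 g3 g4 g5
    have f2 : F.θ₂ z τ = quo F.θ₂ F z τ * F.θ₁ z τ := by rw [quo]; field_simp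
    have f3 : F.θ₃ z τ = quo F.θ₃ F z τ * F.θ₁ z τ := by rw [quo]; field_simp
    have f4 : F.θ₄ z τ = quo F.θ₄ F z τ * F.θ₁ z τ := by rw [quo]; field_simp
    have f5 : F.dθ₁ z τ = quo F.dθ₁ F z τ * F.θ₁ z τ := by rw [quo]; field_simp
    have f1 : F.θ₁ z τ = 1 / (A * B) * (d * C) * (g * Θ₁ 0 u (moeb a b c δ τ)) := by
      rw [hC]; field_simp
    simp only [Unknowns.vec, g1, g2, g3, g4, g5]
    clear_value C
    have c1 : F.θ₁ z τ = (![1, e₂, e₃, e₄] : Fin 4 → ℂ) 0 * (1 / (A * B) * (d * C))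
        * (g * Θ₁ 0 u (moeb a b c δ τ)) := by
      rw [f1]; simp
    have c2 : F.θ₂ z τ = (![1, e₂, e₃, e₄] : Fin 4 → ℂ) 1 * (d * C)
        * (g * Θ₂ 0 u (moeb a b c δ τ)) := by
      rw [f2, f1]
      simp only [Matrix.cons_val_one, Matrix.cons_val_zero]
      field_simp
      linear_combination q2
    have c3 : F.θ₃ z τ = (![1, e₂, e₃, e₄] : Fin 4 → ℂ) 2 * (1 / A * C)
        * (g * Θ₃ 0 u (moeb a b c δ τ)) := by
      rw [f3, f1]
      field_simp at q3
      simp only [Matrix.cons_val]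
      field_simp
      linear_combination q3
    have c4 : F.θ₄ z τ = (![1, e₂, e₃, e₄] : Fin 4 → ℂ) 3 * (1 / B * C)
        * (g * Θ₄ 0 u (moeb a b c δ τ)) := by
      rw [f4, f1]
      field_simp at q4
      simp only [Matrix.cons_val]
      field_simp
      linear_combination q4
    rw [← c1, ← c2, ← c3, ← c4]
    have c5 : F.dθ₁ z τ = (![1, e₂, e₃, e₄] : Fin 4 → ℂ) 0 * (1 / (A * B) * (d * C))
        * (g * Θ₁ 1 u (moeb a b c δ τ) / s + (quo F.dθ₁ F z τ
          - Θ₁ 1 u (moeb a b c δ τ) / (s * Θ₁ 0 u (moeb a b c δ τ)))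
          * (g * Θ₁ 0 u (moeb a b c δ τ))) := by
      rw [f5, f1]
      simp only [Matrix.cons_val_zero]
      field_simp
      ring
    rw [← c5]

lemma exists_agreeOn_generalIntegral (hdet : a * δ - b * c = 1) (hA : A ≠ 0) (hB : B ≠ 0)
    (hd : d ≠ 0) (hU : IsOpen U) (hUT : ∀ τ ∈ U, c * τ + δ ≠ 0 ∧ 0 < (moeb a b c δ τ).im)
    (hrc : ContinuousOn r U) (hrs : ∀ τ ∈ U, r τ ^ 2 = c * τ + δ) (hc : c ≠ 0) (hΩ : IsOpen Ω)
    (hconn : IsPreconnected Ω) (hΩU : ∀ p ∈ Ω, p.2 ∈ U)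
    (hF : IsSolutionOn (generalCoeffs a b c δ A B d r) F Ω) :
    ∃ (ε : Fin 4 → ℂ) (C D E : ℂ), AdmissibleSigns ε ∧ C ≠ 0 ∧
      F.AgreeOn (generalIntegral a b c δ A B d r ε C D E) Ω := by
  -- A preconnected set may be empty; then any constants do.
  rcases Ω.eq_empty_or_nonempty with rfl | ⟨p, hp⟩
  · exact ⟨fun _ => 1, 1, 0, 0, ⟨fun _ => Or.inl rfl, by norm_num⟩, one_ne_zero,
      fun p hp => absurd hp (Set.notMem_empty p)⟩
  obtain ⟨ε, C, D, E, hε, hC, hvec⟩ :=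
    exists_matching hdet hA hB hd hU hUT hrc hrs hc hΩ hΩU hF hp
  refine ⟨ε, C, D, E, hε, hC, agreeOn_iff_vec.mpr ?_⟩
  have hag := agreeOn_iff_vec.mp
    (generalIntegral_agreeOn (A := A) (B := B) (d := d) (r := r) hUT ε C D E)
  refine eqOn_of_eq hΩ hconn
    (fun p hp => coeffODE_generalCoeffs hdet hA hB hU hUT hrc hrs (hΩU p hp)) hF ?_ ?_ hp hvec
  · refine ContinuousOn.congr (f := (transUnknowns a b c δ r D E _ _ _ _).vec) (fun q hq => ?_)
      fun q hq => hag q (hΩU q hq)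
    obtain ⟨d1, d2, d3, d4, d5⟩ := differentiableAt_transUnknowns hdet hU hUT hrc hrs D E
      (ε 0 * (1 / (A * B) * (d * C))) (ε 1 * (d * C)) (ε 2 * (1 / A * C)) (ε 3 * (1 / B * C))
      (hΩU q hq)
    refine ContinuousAt.continuousWithinAt (continuousAt_pi.mpr fun i => ?_)
    fin_cases i
    · exact d1.continuousAt
    · exact d2.continuousAt
    · exact d3.continuousAt
    · exact d4.continuousAt
    · exact d5.continuousAt
  · obtain ⟨h1, h2, h3, h4, h5, h⟩ :=
      isSolutionOn_generalIntegral hdet hA hB hd hU hUT hrc hrs ε C D E hε hC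
    have hs : ∀ q ∈ {p | p ∈ Ω ∧ (generalIntegral a b c δ A B d r ε C D E).θ₁ p.1 p.2 ≠ 0},
        q ∈ {p : ℂ × ℂ | p.2 ∈ U ∧ (generalIntegral a b c δ A B d r ε C D E).θ₁ p.1 p.2 ≠ 0} :=
      fun q hq => ⟨hΩU q hq.1, hq.2⟩
    exact ⟨h1.mono hs, h2.mono hs, h3.mono hs, h4.mono hs, h5.mono hs, fun q hq => h q (hs q hq)⟩

end Matching

/-! ### Translations by `1` and `τ`, and the absorption of signs. -/

lemma jθ₃_add_one_fst (z τ : ℂ) : jθ₃ (z + 1) τ = jθ₃ z τ := by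
  rw [jθ₃_eq_jacobiTheta₂, jθ₃_eq_jacobiTheta₂, jacobiTheta₂_add_left]

lemma jθ₄_add_one_fst (z τ : ℂ) : jθ₄ (z + 1) τ = jθ₄ z τ := by
  rw [jθ₄_eq_jacobiTheta₂, jθ₄_eq_jacobiTheta₂, add_right_comm, jacobiTheta₂_add_left]

lemma jθ₃_add_tau (z τ : ℂ) : jθ₃ (z + τ) τ = cexp (-π * I * τ - 2 * π * I * z) * jθ₃ z τ := by
  rw [jθ₃_eq_jacobiTheta₂, jθ₃_eq_jacobiTheta₂, jacobiTheta₂_add_left']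
  congr 2
  ring

lemma jθ₄_add_tau (z τ : ℂ) : jθ₄ (z + τ) τ = -(cexp (-π * I * τ - 2 * π * I * z) * jθ₄ z τ) := by
  rw [jθ₄_eq_jacobiTheta₂, jθ₄_eq_jacobiTheta₂, add_right_comm, jacobiTheta₂_add_left',
    show -π * I * (τ + 2 * (z + 1 / 2)) = (-π * I * τ - 2 * π * I * z) - π * I by ring,
    Complex.exp_sub, exp_pi_mul_I]
  ring

lemma linearExp_add_one_right {θ : ℂ → ℂ → ℂ} {e : ℂ} (h : ∀ z τ, θ (z + 1) τ = e * θ z τ)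
    (α β z τ : ℂ) : linearExp θ α (β + 1) z τ = e * linearExp θ α β z τ := by
  rw [linearExp, ← add_assoc, h, linearExp]
  ring

lemma linearExp_add_one_left {θ : ℂ → ℂ → ℂ} {e : ℂ}
    (h : ∀ z τ, θ (z + τ) τ = e * (cexp (-π * I * τ - 2 * π * I * z) * θ z τ)) (α β z τ : ℂ) :
    cexp (2 * π * I * β) * linearExp θ (α + 1) β z τ = e * linearExp θ α β z τ := by
  have he : cexp (π * I * α * (2 * z + α * τ)) = cexp (2 * π * I * β)
      * (cexp (π * I * (α + 1) * (2 * z + (α + 1) * τ))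
        * cexp (-π * I * τ - 2 * π * I * (z + α * τ + β))) := by
    rw [← Complex.exp_add, ← Complex.exp_add]
    congr 1
    ring
  rw [linearExp, linearExp, he, show z + (α + 1) * τ + β = z + α * τ + β + τ by ring, h]
  ring

/-- The function `C exp(πiα(2z + ατ)) θ(z + ατ + β | τ)` for the four theta series. -/
noncomputable def linearExps (C α β z τ : ℂ) : Fin 4 → ℂ :=
  ![C * linearExp jθ₁ α β z τ, C * linearExp jθ₂ α β z τ, C * linearExp jθ₃ α β z τ,
    C * linearExp jθ₄ α β z τ]

lemma linearExps_smul (s C α β z τ : ℂ) : linearExps (s * C) α β z τ = s • linearExps C α β z τ := by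
  ext k
  fin_cases k <;> simp [linearExps, mul_assoc]

/-- The step `β ↦ β + 1` realizes the sign pattern `(-, -, +, +)`. -/
lemma exists_linearExps_shift_right {e : ℂ} (he : e = 1 ∨ e = -1) (C α β : ℂ) :
    ∃ β', ∀ z τ, linearExps C α β' z τ = ![e, e, 1, 1] * linearExps C α β z τ := by
  rcases he with rfl | rfl
  · refine ⟨β, fun z τ => ?_⟩
    ext k
    fin_cases k <;> simp
  · refine ⟨β + 1, fun z τ => ?_⟩
    have h1 := linearExp_add_one_right (e := -1) (θ := jθ₁)
      (fun z τ => by rw [jθ₁_add_one_fst]; ring) α β z τ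
    have h2 := linearExp_add_one_right (e := -1) (θ := jθ₂)
      (fun z τ => by rw [jθ₂_add_one_fst]; ring) α β z τ
    have h3 := linearExp_add_one_right (e := 1) (θ := jθ₃)
      (fun z τ => by rw [jθ₃_add_one_fst]; ring) α β z τ
    have h4 := linearExp_add_one_right (e := 1) (θ := jθ₄)
      (fun z τ => by rw [jθ₄_add_one_fst]; ring) α β z τ
    ext k
    fin_cases k <;> simp [linearExps, h1, h2, h3, h4]

/-- The step `α ↦ α + 1` realizes `(-, +, +, -)`, at the price of the constant `e^{2πiβ}`, which
goes into `C`. -/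
lemma exists_linearExps_shift_left {e C : ℂ} (he : e = 1 ∨ e = -1) (hC : C ≠ 0) (α β : ℂ) :
    ∃ C' α', C' ≠ 0 ∧
      ∀ z τ, linearExps C' α' β z τ = ![e, 1, 1, e] * linearExps C α β z τ := by
  rcases he with rfl | rfl
  · refine ⟨C, α, hC, fun z τ => ?_⟩
    ext k
    fin_cases k <;> simp
  · refine ⟨C * cexp (2 * π * I * β), α + 1, mul_ne_zero hC (exp_ne_zero _), fun z τ => ?_⟩
    have h1 := linearExp_add_one_left (e := -1) (θ := jθ₁)
      (fun z τ => by rw [jθ₁_add_tau]; ring) α β z τ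
    have h2 := linearExp_add_one_left (e := 1) (θ := jθ₂)
      (fun z τ => by rw [jθ₂_add_tau]; ring) α β z τ
    have h3 := linearExp_add_one_left (e := 1) (θ := jθ₃)
      (fun z τ => by rw [jθ₃_add_tau]; ring) α β z τ
    have h4 := linearExp_add_one_left (e := -1) (θ := jθ₄)
      (fun z τ => by rw [jθ₄_add_tau]; ring) α β z τ
    generalize cexp (2 * π * I * β) = x at *
    ext k
    fin_cases k <;> simp [linearExps, mul_assoc, h1, h2, h3, h4]

/-- Admissible signs are absorbed by the half-period shifts of the four theta series. -/
lemma exists_linearExps_signs {ε : Fin 4 → ℂ} (hε : AdmissibleSigns ε) {C : ℂ} (hC : C ≠ 0)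
    (α β : ℂ) : ∃ C' α' β', C' ≠ 0 ∧ ∀ z τ, linearExps C' α' β' z τ = ε * linearExps C α β z τ := by
  obtain ⟨hs, hprod⟩ := hε
  have hsq : ∀ k, ε k ^ 2 = 1 := fun k => by rcases hs k with h | h <;> simp [h]
  have hmul : ∀ j k, ε j * ε k = 1 ∨ ε j * ε k = -1 := fun j k => by
    rcases hs j with h | h <;> rcases hs k with h' | h' <;> simp [h, h']
  have h2 : ε 2 ≠ 0 := fun h => by simpa [h] using hsq 2
  -- A common sign `ε 2` is put into `C`. The remaining signs of `θ₂` and `θ₄` relative to `θ₃`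
  -- prescribe the two shifts, and the sign of `θ₁` is then right because the product of all is `1`.
  obtain ⟨β', hβ⟩ := exists_linearExps_shift_right (hmul 1 2) (ε 2 * C) α β
  obtain ⟨C', α', hC', hα⟩ := exists_linearExps_shift_left (hmul 3 2) (mul_ne_zero h2 hC) α β'
  refine ⟨C', α', β', hC', fun z τ => ?_⟩
  rw [hα, hβ, linearExps_smul]
  have h0 : ε 3 * ε 2 * (ε 1 * ε 2 * ε 2) = ε 0 := by
    linear_combination (-(ε 1 * ε 2 * ε 3)) * hsq 0 + ε 0 * hprod
      + ε 1 * ε 2 * ε 3 * hsq 2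
  ext k
  fin_cases k
  · simp only [Fin.zero_eta, Pi.mul_apply, Pi.smul_apply, smul_eq_mul, Matrix.cons_val]
    linear_combination linearExps C α β z τ 0 * h0
  · simp only [Fin.mk_one, Pi.mul_apply, Pi.smul_apply, smul_eq_mul, Matrix.cons_val]
    linear_combination ε 1 * linearExps C α β z τ 1 * hsq 2
  · simp
  · simp only [Fin.reduceFinMk, Pi.mul_apply, Pi.smul_apply, smul_eq_mul, Matrix.cons_val]
    linear_combination ε 3 * linearExps C α β z τ 3 * hsq 2

/-! ### The canonical case. -/

lemma generalIntegral_agreeOn_canonicalIntegral {ε : Fin 4 → ℂ} {C D E C' α β : ℂ}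
    (h : ∀ z τ, linearExps C' α β z τ
      = ε * linearExps (C * cexp (2 * π * I * D * (2 * E + D))) (2 * D) (E + D) z τ) :
    (generalIntegral 1 0 2 1 1 (-I) 1 (fun τ => (2 * τ + 1) ^ (1 / 2 : ℂ)) ε C D E).AgreeOn
      (canonicalIntegral C' α β) {p | 0 < p.2.im} := by
  rintro ⟨z, τ⟩ (hτ : 0 < τ.im)
  -- The factor `1/B` with `B = -I` cancels the `-I` of the transformation; the same happens for
  -- `θ₄`.
  have h1 : ∀ w, ε 0 * (1 / (1 * -I) * (1 * C)
      * transformed jθ₁ 1 0 2 1 (fun τ => (2 * τ + 1) ^ (1 / 2 : ℂ)) D E w τ)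
        = C' * linearExp jθ₁ α β w τ := fun w => by
    have := congrFun (h w τ) 0
    simp only [linearExps, Pi.mul_apply, Matrix.cons_val] at this
    rw [this, (transformed_canonical D E w hτ).1]
    have := I_ne_zero
    field_simp
  obtain ⟨-, e2, e3, e4⟩ := transformed_canonical D E z hτ
  refine ⟨h1 z, ?_, ?_, ?_, congrFun (congrArg deriv (funext h1)) z⟩
  · have := congrFun (h z τ) 1
    simp only [linearExps, Pi.mul_apply, Matrix.cons_val] at this
    simp only [generalIntegral, canonicalIntegral, this, e2]
    ring
  · have := congrFun (h z τ) 2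
    simp only [linearExps, Pi.mul_apply, Matrix.cons_val] at this
    simp only [generalIntegral, canonicalIntegral, this, e3]
    ring
  · have := congrFun (h z τ) 3
    simp only [linearExps, Pi.mul_apply, Matrix.cons_val] at this
    simp only [generalIntegral, canonicalIntegral, this, e4]
    have := I_ne_zero
    field_simp

/-- The general result is applied to the matrix `(1, 0; 2, 1)`, whose coefficients are the canonical
ones and whose entry `c = 2` is nonzero. -/
lemma isSolutionOn_canonicalCoeffs_iff {Ω : Set (ℂ × ℂ)} (hΩ : IsOpen Ω)
    (hconn : IsPreconnected Ω) (hΩU : ∀ p ∈ Ω, 0 < p.2.im) (F : Unknowns) :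
    IsSolutionOn canonicalCoeffs F Ω ↔ (∀ p ∈ Ω, F.θ₁ p.1 p.2 ≠ 0) ∧
      ∃ C α β : ℂ, C ≠ 0 ∧ F.AgreeOn (canonicalIntegral C α β) Ω := by
  have hdet : (1 : ℂ) * 1 - 0 * 2 = 1 := by norm_num
  have hB : (-I : ℂ) ≠ 0 := neg_ne_zero.mpr I_ne_zero
  have hU : IsOpen {τ : ℂ | 0 < τ.im} := isOpen_im_pos
  have hUT : ∀ τ ∈ {τ : ℂ | 0 < τ.im}, 2 * τ + 1 ≠ 0 ∧ 0 < (moeb 1 0 2 1 τ).im := fun τ hτ => by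
    refine ⟨two_mul_add_one_ne_zero hτ, ?_⟩
    rw [show moeb 1 0 2 1 τ = τ / (2 * τ + 1) by simp [moeb]]
    exact im_moeb_two_one_pos hτ
  have hrc : ContinuousOn (fun τ : ℂ => (2 * τ + 1) ^ (1 / 2 : ℂ)) {τ : ℂ | 0 < τ.im} := by
    refine ContinuousOn.cpow_const (by fun_prop) fun τ hτ => ?_
    exact mem_slitPlane_iff.mpr (Or.inr (im_two_mul_add_one_pos hτ).ne')
  have hrs : ∀ τ ∈ {τ : ℂ | 0 < τ.im}, ((2 * τ + 1) ^ (1 / 2 : ℂ)) ^ 2 = 2 * τ + 1 :=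
    fun τ _ => cpow_half_sq
  have hself : F.AgreeOn F Ω := fun _ _ => ⟨rfl, rfl, rfl, rfl, rfl⟩
  constructor
  · intro hF
    refine ⟨fun p hp => (hF.2.2.2.2.2 p hp).1, ?_⟩
    have hF' := IsSolutionOn.congr hΩ hF hself coeffs_canonical hΩU
    obtain ⟨ε, C, D, E, hε, hC, hag⟩ := exists_agreeOn_generalIntegral hdet one_ne_zero hB
      one_ne_zero hU hUT hrc hrs two_ne_zero hΩ hconn hΩU hF'
    obtain ⟨C', α, β, hC', h⟩ := exists_linearExps_signs hε
      (mul_ne_zero hC (exp_ne_zero (2 * π * I * D * (2 * E + D)))) (2 * D) (E + D)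
    have h' := generalIntegral_agreeOn_canonicalIntegral h
    refine ⟨C', α, β, hC', fun p hp => ?_⟩
    obtain ⟨a1, a2, a3, a4, a5⟩ := hag p hp
    obtain ⟨b1, b2, b3, b4, b5⟩ := h' p (hΩU p hp)
    exact ⟨a1.trans b1, a2.trans b2, a3.trans b3, a4.trans b4, a5.trans b5⟩
  · rintro ⟨h0, C, α, β, hC, hag⟩
    -- Conversely, `2D = α` and `E + D = β` are solved for `D` and `E`, all signs are `1`, and `C`
    -- is divided by the constant that the transformation produces.
    set κ : ℂ := cexp (2 * π * I * (α / 2) * (2 * (β - α / 2) + α / 2)) with hκ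
    have hκ0 : κ ≠ 0 := exp_ne_zero _
    have h' := generalIntegral_agreeOn_canonicalIntegral (ε := 1) (C := C / κ) (D := α / 2)
      (E := β - α / 2) (C' := C) (α := α) (β := β) fun z τ => by
        rw [← hκ, div_mul_cancel₀ C hκ0, one_mul, mul_div_cancel₀ α two_ne_zero, sub_add_cancel]
    have hag' : F.AgreeOn (generalIntegral 1 0 2 1 1 (-I) 1
        (fun τ => (2 * τ + 1) ^ (1 / 2 : ℂ)) 1 (C / κ) (α / 2) (β - α / 2)) Ω := fun p hp => by
      obtain ⟨a1, a2, a3, a4, a5⟩ := hag p hp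
      obtain ⟨b1, b2, b3, b4, b5⟩ := h' p (hΩU p hp)
      exact ⟨a1.trans b1.symm, a2.trans b2.symm, a3.trans b3.symm, a4.trans b4.symm,
        a5.trans b5.symm⟩
    obtain ⟨s1, s2, s3, s4, s5, s⟩ := isSolutionOn_generalIntegral hdet one_ne_zero hB
      one_ne_zero hU hUT hrc hrs 1 (C / κ) (α / 2) (β - α / 2)
      ⟨fun _ => Or.inl rfl, by simp⟩ (div_ne_zero hC hκ0)
    have hsub : ∀ q ∈ Ω, q ∈ {p : ℂ × ℂ | p.2 ∈ {τ : ℂ | 0 < τ.im} ∧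
        (generalIntegral 1 0 2 1 1 (-I) 1 (fun τ => (2 * τ + 1) ^ (1 / 2 : ℂ)) 1 (C / κ) (α / 2)
          (β - α / 2)).θ₁ p.1 p.2 ≠ 0} :=
      fun q hq => ⟨hΩU q hq, fun h => h0 q hq ((hag' q hq).1.trans h)⟩
    exact IsSolutionOn.congr hΩ ⟨s1.mono hsub, s2.mono hsub, s3.mono hsub, s4.mono hsub,
      s5.mono hsub, fun q hq => s q (hsub q hq)⟩ hag' (fun τ hτ => by
        obtain ⟨c1, c2, c3, c4⟩ := coeffs_canonical τ hτ
        exact ⟨c1.symm, c2.symm, c3.symm, c4.symm⟩) hΩU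

end ThetaODE

theorem theorem9p10 :
    (∀ (a b c δ A B d : ℂ), a * δ - b * c = 1 → A ≠ 0 → B ≠ 0 → d ≠ 0 →
      ∀ (U : Set ℂ), IsOpen U →
      (∀ τ ∈ U, c * τ + δ ≠ 0 ∧ 0 < (ThetaODE.moeb a b c δ τ).im) →
      ∀ (r : ℂ → ℂ), ContinuousOn r U → (∀ τ ∈ U, r τ ^ 2 = c * τ + δ) →
        -- the coefficients satisfy the integrability conditions
        ThetaODE.Integrability A B (ThetaODE.generalCoeffs a b c δ A B d r) U ∧
        -- the explicit functions solve both systems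
        (∀ (ε : Fin 4 → ℂ) (C D E : ℂ), ThetaODE.AdmissibleSigns ε → C ≠ 0 →
          ThetaODE.IsSolutionOn (ThetaODE.generalCoeffs a b c δ A B d r)
            (ThetaODE.generalIntegral a b c δ A B d r ε C D E)
            {p : ℂ × ℂ | p.2 ∈ U ∧
              (ThetaODE.generalIntegral a b c δ A B d r ε C D E).θ₁ p.1 p.2 ≠ 0}) ∧
        -- and every simultaneous solution is one of them
        (c ≠ 0 → ∀ (Ω : Set (ℂ × ℂ)), IsOpen Ω → IsPreconnected Ω → (∀ p ∈ Ω, p.2 ∈ U) →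
          ∀ F : ThetaODE.Unknowns,
            ThetaODE.IsSolutionOn (ThetaODE.generalCoeffs a b c δ A B d r) F Ω →
            ∃ (ε : Fin 4 → ℂ) (C D E : ℂ), ThetaODE.AdmissibleSigns ε ∧ C ≠ 0 ∧
              F.AgreeOn (ThetaODE.generalIntegral a b c δ A B d r ε C D E) Ω) ∧
        -- an element of Γ(2) changes the matrix but not the coefficients, so `c ≠ 0` can be arranged
        (ThetaODE.generalCoeffs a b (2 * a + c) (2 * b + δ) A (-Complex.I * B) d
          (fun τ => r τ * (2 * ThetaODE.moeb a b c δ τ + 1) ^ (1 / 2 : ℂ))).AgreeOn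
            (ThetaODE.generalCoeffs a b c δ A B d r) U) ∧
    -- the canonical case, by the matrix (1, 0; 2, 1) of Γ(2): the coefficients,
    (ThetaODE.generalCoeffs 1 0 2 1 1 (-Complex.I) 1 (fun τ => (2 * τ + 1) ^ (1 / 2 : ℂ))).AgreeOn
      ThetaODE.canonicalCoeffs {τ : ℂ | 0 < τ.im} ∧
    -- the functions,
    (∀ D E z τ : ℂ, 0 < τ.im →
      let r : ℂ → ℂ := fun t => (2 * t + 1) ^ (1 / 2 : ℂ)
      let κ : ℂ := Complex.exp (2 * Real.pi * Complex.I * D * (2 * E + D))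
      ThetaODE.transformed ThetaODE.jθ₁ 1 0 2 1 r D E z τ
        = -Complex.I * κ * ThetaODE.linearExp ThetaODE.jθ₁ (2 * D) (E + D) z τ ∧
      ThetaODE.transformed ThetaODE.jθ₂ 1 0 2 1 r D E z τ
        = κ * ThetaODE.linearExp ThetaODE.jθ₂ (2 * D) (E + D) z τ ∧
      ThetaODE.transformed ThetaODE.jθ₃ 1 0 2 1 r D E z τ
        = κ * ThetaODE.linearExp ThetaODE.jθ₃ (2 * D) (E + D) z τ ∧
      ThetaODE.transformed ThetaODE.jθ₄ 1 0 2 1 r D E z τ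
        = -Complex.I * κ * ThetaODE.linearExp ThetaODE.jθ₄ (2 * D) (E + D) z τ) ∧
    -- and the general simultaneous integral
    (∀ (Ω : Set (ℂ × ℂ)), IsOpen Ω → IsPreconnected Ω → (∀ p ∈ Ω, 0 < p.2.im) →
      ∀ F : ThetaODE.Unknowns,
        ThetaODE.IsSolutionOn ThetaODE.canonicalCoeffs F Ω ↔
          (∀ p ∈ Ω, F.θ₁ p.1 p.2 ≠ 0) ∧
            ∃ C α β : ℂ, C ≠ 0 ∧ F.AgreeOn (ThetaODE.canonicalIntegral C α β) Ω) := by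
  refine ⟨fun a b c δ A B d hdet hA hB hd U hU hUT r hrc hrs => ⟨?_, ?_, ?_, ?_⟩,
    ThetaODE.coeffs_canonical, fun D E z τ hτ => ThetaODE.transformed_canonical D E z hτ,
    fun Ω hΩ hconn hΩU F => ThetaODE.isSolutionOn_canonicalCoeffs_iff hΩ hconn hΩU F⟩
  · exact ThetaODE.integrability_of_coeffODE fun τ hτ =>
      ThetaODE.coeffODE_generalCoeffs hdet hA hB hU hUT hrc hrs hτ
  · exact fun ε C D E hε hC =>
      ThetaODE.isSolutionOn_generalIntegral hdet hA hB hd hU hUT hrc hrs ε C D E hε hC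
  · exact fun hc Ω hΩ hconn hΩU F hF =>
      ThetaODE.exists_agreeOn_generalIntegral hdet hA hB hd hU hUT hrc hrs hc hΩ hconn hΩU hF
  · exact fun τ hτ => ThetaODE.coeffs_gamma2 hdet hB (hUT τ hτ).1 (hUT τ hτ).2 (hrs τ hτ)
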